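/- Let $q\in\mathbb C$, $q\neq 0$, be not a root of unity. For $n\ge 0$ let $M=L(n,+1)$ be the simple $U_q(\mathfrak{sl}_2)$-module of dimension $n+1$ and type $+1$, with natural basis $x_0,\dots,x_n$, where $$Kx_i=q^{n-2i}x_i,\qquad Fx_i=x_{i+1},\qquad Ex_i=[i]\,[n+1-i]\,x_{i-1}\qquad(x_{-1}=x_{n+1}=0),$$ $[m]=\frac{q^m-q^{-m}}{q-q^{-1}}$. For weights $a\alpha/2,\ b\alpha/2$ ($a,b\in\mathbb Z$) put $f(a\alpha/2,b\alpha/2)=q^{-2-\lfloor ab/2\rfloor}$, so that $f(0,0)=f(\alpha/2,\alpha/2)=q^{-2}$. Let $c$ be the braiding of $M$ given for weight vectors $v\in M_\mu$, $w\in M_{\mu'}$ by $$c(v\otimes w)=f(\mu',\mu)\sum_{m\ge 0}(-1)^m q^{-m(m-1)/2}\,\frac{(q-q^{-1})^m}{[m]!}\;F^m w\otimes E^m v .$$ Let $\mathcal B(M)=T(M)/I$ be the Nichols algebra of $(M,c)$, where $T(M)$ is the braided tensor Hopf algebra in which the elements of $M$ are primitive, and $I$ is its largest homogeneous ideal that is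 contained in degrees $\ge 2$ and is a coideal. Order the letters by $x_0<\dots<x_n$, order words of equal length lexicographically, and regard a shorter word as bigger than a longer one. Call a word reducible if it is congruent modulo $I$ to a linear combination of bigger words. Let $S$ be the set of irreducible Lyndon words (nonempty words lexicographically smaller than each of their proper endings), and let the height of $u\in S$ be the least $t$ such that $u^t$ is reducible ($\infty$ if there is none). For $n=1,2,3$ the algebra $\mathcal B(M)$ is quadratic, i.e. $I$ is generated by its elements of degree two, and all elements of $S$ have infinite height. Moreover: 1. For $n=1$: the space of relations of degree two is spanned by $x_0x_1-q\,x_1x_0$; $S=\{x_0,x_1\}$; the elements $x_1^ix_0^j$ $(i,j\ge 0)$ form a basis of $\mathcal B(M)$. 2. For $n=2$: the space of relations of degree two is spanned by $x_0x_1-q^2x_1x_0$, $\;x_1x_2-q^2x_2x_1$, $\;x_0x_2-(q^2-1)x_1^2-x_2x_0$; $S=\{x_0,x_1,x_2\}$; the elements $x_2^ix_1^jx_0^k$ $(i,j,k\ge0)$ form a basis of $\mathcal B(M)$. 3. For $n=3$: the space of relations of degree two is spanned by $$x_0x_1-q^3x_1x_0,\qquad x_0x_2+\tfrac{1-q^4}{q}x_1^2-x_2x_0,$$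 $$q^3x_0x_3+q^2(q^2+1-q^4)x_1x_2+(q-q^3-q^5)x_2x_1-x_3x_0,$$ $$x_1x_3+\tfrac{1-q^6}{q(q^2+1)}x_2^2-x_3x_1,\qquad x_2x_3-q^3x_3x_2;$$ $S=\{x_0,x_1,x_2,x_3,x_1x_2\}$; the elements $x_3^ax_2^b(x_1x_2)^cx_1^dx_0^e$ $(a,b,c,d,e\ge 0)$ form a basis of $\mathcal B(M)$. -/

import Mathlib

open scoped TensorProduct

noncomputable section

namespace NicholsSl2

/-! Words and Lyndon words. -/

section Words

variable {k : Type*} [Field k] {ι : Type*}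

/-- The monomial of the free algebra given by a word in the letters `ι`. -/
def word (k : Type*) [Field k] {ι : Type*} (u : List ι) : FreeAlgebra k ι :=
  (u.map (FreeAlgebra.ι k)).prod

/-- The subspace of homogeneous elements of degree `m` of the free algebra. -/
def homogeneousPart (k : Type*) [Field k] (ι : Type*) (m : ℕ) : Submodule k (FreeAlgebra k ι) :=
  Submodule.span k {a | ∃ u : List ι, u.length = m ∧ a = word k u}

/-- The underlying subspace of a two-sided ideal. -/
def idealSubmodule (I : TwoSidedIdeal (FreeAlgebra k ι)) : Submodule k (FreeAlgebra k ι) :=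
  (TwoSidedIdeal.asIdeal I).restrictScalars k

/-- A Lyndon word: nonempty and lexicographically smaller than all its proper endings
(a proper beginning of a word is smaller than the word). -/
def IsLyndon [LinearOrder ι] (u : List ι) : Prop :=
  u ≠ [] ∧ ∀ v w : List ι, v ≠ [] → w ≠ [] → u = v ++ w → u < w

/-- `StdLT u v`: `v` is bigger than `u` in the standard order, i.e. `v` is shorter than `u`, or
they have the same length and `v` is lexicographically bigger. -/
def StdLT [LinearOrder ι] (u v : List ι) : Prop :=
  v.length < u.length ∨ (v.length = u.length ∧ u < v)

/-- The word `u` is, modulo `I`, a linear combination of words that are bigger in the standard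
order. -/
def IsReducible [LinearOrder ι] (I : TwoSidedIdeal (FreeAlgebra k ι)) (u : List ι) : Prop :=
  word k u ∈ Submodule.span k {a | ∃ v : List ι, StdLT u v ∧ a = word k v} ⊔ idealSubmodule I

/-- The set of PBW generators: the irreducible Lyndon words. -/
def pbwGenerators [LinearOrder ι] (I : TwoSidedIdeal (FreeAlgebra k ι)) : Set (List ι) :=
  {u | IsLyndon u ∧ ¬ IsReducible I u}

/-- The height of a word `u`: the least `t` such that the power `u ^ t` is reducible,
and `∞` if there is none. -/
def pbwHeight [LinearOrder ι] (I : TwoSidedIdeal (FreeAlgebra k ι)) (u : List ι) : ℕ∞ :=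
  sInf {t : ℕ∞ | ∃ m : ℕ, t = m ∧ IsReducible I (List.replicate m u).flatten}

/-- The quotient of the free algebra by `I` is quadratic: `I` is generated, as a two-sided ideal,
by its elements of degree two. -/
def IsQuadratic (I : TwoSidedIdeal (FreeAlgebra k ι)) : Prop :=
  I = TwoSidedIdeal.span {a | a ∈ I ∧ a ∈ homogeneousPart k ι 2}

/-- The space of relations of degree two. -/
def quadraticRelations (I : TwoSidedIdeal (FreeAlgebra k ι)) : Submodule k (FreeAlgebra k ι) :=
  idealSubmodule I ⊓ homogeneousPart k ι 2

/-- The family `v` is a basis of the vector space `A`. -/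
def IsBasisFamily (k : Type*) [Field k] {A κ : Type*} [AddCommGroup A] [Module k A]
    (v : κ → A) : Prop :=
  LinearIndependent k v ∧ Submodule.span k (Set.range v) = ⊤

end Words

/-! The Nichols algebra of a braiding `c` on the vector space `V` with basis `ι`. The tensor
algebra `T` of `V` is identified with the free algebra on `ι`. -/

section Nichols

variable {k : Type*} [Field k] {ι : Type*} [Fintype ι] [DecidableEq ι]

/-- The structure constants of `c`: the coefficient of `x_r ⊗ x_s` in `c (x_i ⊗ x_j)`. -/
def braidCoeff (c : ((ι → k) ⊗[k] (ι → k)) →ₗ[k] ((ι → k) ⊗[k] (ι → k))) (i j r s : ι) : k :=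
  ((Pi.basisFun k ι).tensorProduct (Pi.basisFun k ι)).repr
    (c (Pi.single i 1 ⊗ₜ[k] Pi.single j 1)) (r, s)

/-- The braiding `V ⊗ T → T ⊗ V` in coordinates:
`x_i ⊗ a ↦ ∑ s, braidMatrix c a i s ⊗ x_s`. It is `c` for `a` of degree one, and
`V ⊗ a b → T ⊗ V` is obtained by first moving `V` past `a` and then past `b`, i.e. by matrix
multiplication. -/
def braidMatrix (c : ((ι → k) ⊗[k] (ι → k)) →ₗ[k] ((ι → k) ⊗[k] (ι → k))) :
    FreeAlgebra k ι →ₐ[k] Matrix ι ι (FreeAlgebra k ι) :=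
  FreeAlgebra.lift k fun j =>
    Matrix.of fun i s => ∑ r, braidCoeff c i j r s • FreeAlgebra.ι k r

/-- Left multiplication by `1 ⊗ x_i` in the braided tensor product algebra of `T` with itself:
`a ⊗ b ↦ c (x_i ⊗ a) (1 ⊗ b)`. -/
def mulRightFactor (c : ((ι → k) ⊗[k] (ι → k)) →ₗ[k] ((ι → k) ⊗[k] (ι → k))) (i : ι) :
    Module.End k (FreeAlgebra k ι ⊗[k] FreeAlgebra k ι) :=
  ∑ s, TensorProduct.map
    ((Matrix.entryLinearMap k (FreeAlgebra k ι) i s).comp (braidMatrix c).toLinearMap)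
    (LinearMap.mulLeft k (FreeAlgebra.ι k s))

/-- Left multiplication by `x_i ⊗ 1` in the braided tensor product algebra of `T` with itself. -/
def mulLeftFactor (k : Type*) [Field k] {ι : Type*} (i : ι) :
    Module.End k (FreeAlgebra k ι ⊗[k] FreeAlgebra k ι) :=
  TensorProduct.map (LinearMap.mulLeft k (FreeAlgebra.ι k i)) LinearMap.id

/-- The comultiplication of the braided Hopf algebra `T`: the algebra homomorphism from `T` to
the braided tensor product algebra of `T` with itself such that all `x_i` are primitive.
A product `x_i ⋯ x_j` is sent to `(x_i ⊗ 1 + 1 ⊗ x_i) ⋯ (x_j ⊗ 1 + 1 ⊗ x_j)`, and this product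
is obtained from `1 ⊗ 1` by successive left multiplications. -/
def comul (c : ((ι → k) ⊗[k] (ι → k)) →ₗ[k] ((ι → k) ⊗[k] (ι → k))) :
    FreeAlgebra k ι →ₗ[k] FreeAlgebra k ι ⊗[k] FreeAlgebra k ι :=
  (LinearMap.applyₗ (1 ⊗ₜ[k] 1)).comp
    (FreeAlgebra.lift k fun i => mulLeftFactor k i + mulRightFactor c i).toLinearMap

/-- The homogeneous two-sided ideals of `T` that are concentrated in degrees at least two. -/
def IsHomogeneousIdeal {k : Type*} [Field k] {ι : Type*}
    (I : TwoSidedIdeal (FreeAlgebra k ι)) : Prop :=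
  idealSubmodule I = ⨆ m : ℕ, idealSubmodule I ⊓ homogeneousPart k ι (m + 2)

/-- The coideal condition `Δ(I) ⊆ I ⊗ T + T ⊗ I` (for ideals in positive degrees the
condition on the counit is automatic). -/
def IsCoideal (c : ((ι → k) ⊗[k] (ι → k)) →ₗ[k] ((ι → k) ⊗[k] (ι → k)))
    (I : TwoSidedIdeal (FreeAlgebra k ι)) : Prop :=
  (idealSubmodule I).map (comul c) ≤
    LinearMap.range (TensorProduct.map (idealSubmodule I).subtype
      (LinearMap.id : FreeAlgebra k ι →ₗ[k] FreeAlgebra k ι)) ⊔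
    LinearMap.range (TensorProduct.map
      (LinearMap.id : FreeAlgebra k ι →ₗ[k] FreeAlgebra k ι) (idealSubmodule I).subtype)

/-- The defining ideal of the Nichols algebra: the largest homogeneous ideal in degrees at least
two that is a coideal. -/
def nicholsIdeal (c : ((ι → k) ⊗[k] (ι → k)) →ₗ[k] ((ι → k) ⊗[k] (ι → k))) :
    TwoSidedIdeal (FreeAlgebra k ι) :=
  sSup {I | IsHomogeneousIdeal I ∧ IsCoideal c I}

/-- The Nichols algebra of `(V, c)`. -/
abbrev NicholsAlgebra (c : ((ι → k) ⊗[k] (ι → k)) →ₗ[k] ((ι → k) ⊗[k] (ι → k))) : Type _ :=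
  (nicholsIdeal c).ringCon.Quotient

/-- The image of the basis vector `x_i` of `V` in the Nichols algebra. -/
def nicholsGen (c : ((ι → k) ⊗[k] (ι → k)) →ₗ[k] ((ι → k) ⊗[k] (ι → k))) (i : ι) :
    NicholsAlgebra c :=
  RingCon.mkₐ k (nicholsIdeal c).ringCon (FreeAlgebra.ι k i)

end Nichols

/-! The quantum group `U_q(sl_2)` and its simple modules `L(n, +1)`. -/

section QuantumGroup

/-- Generators of `U_q(sl_2)`. -/
inductive UqGen
  | E
  | F
  | K
  | Kinv

/-- Defining relations of `U_q(sl_2)`. -/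
inductive UqRel (q : ℂ) : FreeAlgebra ℂ UqGen → FreeAlgebra ℂ UqGen → Prop
  | mul_inv : UqRel q (FreeAlgebra.ι ℂ UqGen.K * FreeAlgebra.ι ℂ UqGen.Kinv) 1
  | inv_mul : UqRel q (FreeAlgebra.ι ℂ UqGen.Kinv * FreeAlgebra.ι ℂ UqGen.K) 1
  | conj_E : UqRel q
      (FreeAlgebra.ι ℂ UqGen.K * FreeAlgebra.ι ℂ UqGen.E * FreeAlgebra.ι ℂ UqGen.Kinv)
      (q ^ 2 • FreeAlgebra.ι ℂ UqGen.E)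
  | conj_F : UqRel q
      (FreeAlgebra.ι ℂ UqGen.K * FreeAlgebra.ι ℂ UqGen.F * FreeAlgebra.ι ℂ UqGen.Kinv)
      (q ^ (-2 : ℤ) • FreeAlgebra.ι ℂ UqGen.F)
  | comm : UqRel q
      (FreeAlgebra.ι ℂ UqGen.E * FreeAlgebra.ι ℂ UqGen.F
        - FreeAlgebra.ι ℂ UqGen.F * FreeAlgebra.ι ℂ UqGen.E)
      ((q - q⁻¹)⁻¹ • (FreeAlgebra.ι ℂ UqGen.K - FreeAlgebra.ι ℂ UqGen.Kinv))

/-- The quantized enveloping algebra `U_q(sl_2)`. -/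
abbrev Uq (q : ℂ) : Type := RingQuot (UqRel q)

/-- The quantum integer `[m] = (q^m - q^(-m)) / (q - q⁻¹)`. -/
def qInt (q : ℂ) (m : ℤ) : ℂ := (q ^ m - q ^ (-m)) / (q - q⁻¹)

/-- The quantum factorial `[m]!`. -/
def qFactorial (q : ℂ) (m : ℕ) : ℂ := ∏ j ∈ Finset.range m, qInt q (j + 1)

/-- The natural basis `x_0, …, x_n` of `L(n, +1)`, with the convention `x_i = 0` for `i > n`. -/
def natVec (n i : ℕ) : Fin (n + 1) → ℂ :=
  if h : i < n + 1 then Pi.single ⟨i, h⟩ 1 else 0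

/-- The weight of `x_i` (the integer `a` stands for `a α / 2`). -/
def wt (n i : ℕ) : ℤ := (n : ℤ) - 2 * i

/-- The action of `E` on `L(n, +1)`: `E x_i = [i] [n + 1 - i] x_{i-1}`, and `E x_0 = 0`. -/
def opE (q : ℂ) (n : ℕ) : Module.End ℂ (Fin (n + 1) → ℂ) :=
  (Pi.basisFun ℂ (Fin (n + 1))).constr ℂ fun i =>
    (qInt q i * qInt q ((n : ℤ) + 1 - i)) • natVec n (i - 1)

/-- The action of `F` on `L(n, +1)`: `F x_i = x_{i+1}`, and `F x_n = 0`. -/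
def opF (n : ℕ) : Module.End ℂ (Fin (n + 1) → ℂ) :=
  (Pi.basisFun ℂ (Fin (n + 1))).constr ℂ fun i => natVec n (i + 1)

/-- The action of `K` on `L(n, +1)`: `K x_i = q^(n - 2i) x_i`. -/
def opK (q : ℂ) (n : ℕ) : Module.End ℂ (Fin (n + 1) → ℂ) :=
  (Pi.basisFun ℂ (Fin (n + 1))).constr ℂ fun i => q ^ wt n i • natVec n i

/-- The action of the inverse of `K` on `L(n, +1)`. -/
def opKinv (q : ℂ) (n : ℕ) : Module.End ℂ (Fin (n + 1) → ℂ) :=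
  (Pi.basisFun ℂ (Fin (n + 1))).constr ℂ fun i => q ^ (-wt n i) • natVec n i

theorem natVec_fin (n : ℕ) (i : Fin (n + 1)) : natVec n i = Pi.basisFun ℂ (Fin (n + 1)) i := by
  simp [natVec, i.2]

theorem natVec_of_lt {n i : ℕ} (h : n < i) : natVec n i = 0 := by
  unfold natVec
  rw [dif_neg (by omega)]

theorem qInt_zero (q : ℂ) : qInt q 0 = 0 := by simp [qInt]

theorem opE_natVec (q : ℂ) (n i : ℕ) (hi : i ≤ n + 1) :
    opE q n (natVec n i) = (qInt q i * qInt q ((n : ℤ) + 1 - i)) • natVec n (i - 1) := by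
  rcases Nat.lt_or_ge i (n + 1) with h | h
  · have := natVec_fin n ⟨i, h⟩
    simp only at this
    rw [this, opE, Module.Basis.constr_basis]
  · obtain rfl : i = n + 1 := by omega
    rw [natVec_of_lt (by omega)]
    simp [qInt_zero]

theorem opF_natVec (n i : ℕ) : opF n (natVec n i) = natVec n (i + 1) := by
  rcases Nat.lt_or_ge i (n + 1) with h | h
  · have := natVec_fin n ⟨i, h⟩
    simp only at this
    rw [this, opF, Module.Basis.constr_basis]
  · rw [natVec_of_lt (by omega), natVec_of_lt (by omega), map_zero]

theorem opK_natVec (q : ℂ) (n i : ℕ) : opK q n (natVec n i) = q ^ wt n i • natVec n i := by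
  rcases Nat.lt_or_ge i (n + 1) with h | h
  · have := natVec_fin n ⟨i, h⟩
    simp only at this
    conv_lhs => rw [this]
    rw [opK, Module.Basis.constr_basis]
  · rw [natVec_of_lt (by omega), map_zero, smul_zero]

theorem opKinv_natVec (q : ℂ) (n i : ℕ) :
    opKinv q n (natVec n i) = q ^ (-wt n i) • natVec n i := by
  rcases Nat.lt_or_ge i (n + 1) with h | h
  · have := natVec_fin n ⟨i, h⟩
    simp only at this
    conv_lhs => rw [this]
    rw [opKinv, Module.Basis.constr_basis]
  · rw [natVec_of_lt (by omega), map_zero, smul_zero]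

theorem end_ext {n : ℕ} {f g : Module.End ℂ (Fin (n + 1) → ℂ)}
    (h : ∀ i ≤ n, f (natVec n i) = g (natVec n i)) : f = g := by
  refine (Pi.basisFun ℂ (Fin (n + 1))).ext fun i => ?_
  rw [← natVec_fin]
  exact h i (by omega)

theorem sub_inv_ne_zero {q : ℂ} (hq0 : q ≠ 0) (hq2 : q ^ 2 ≠ 1) : q - q⁻¹ ≠ 0 := by
  intro h
  apply hq2
  have : q * (q - q⁻¹) = 0 := by rw [h, mul_zero]
  rw [mul_sub, mul_inv_cancel₀ hq0] at this
  linear_combination this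

theorem qInt_comm {q : ℂ} (hq0 : q ≠ 0) (hq2 : q ^ 2 ≠ 1) (i n : ℤ) :
    qInt q (i + 1) * qInt q (n - i) - qInt q i * qInt q (n + 1 - i) = qInt q (n - 2 * i) := by
  have h := sub_inv_ne_zero hq0 hq2
  have e1 : ∀ a b : ℤ, q ^ (a + b) = q ^ a * q ^ b := fun a b => zpow_add₀ hq0 a b
  have key : (q ^ (i + 1) - q ^ (-(i + 1))) * (q ^ (n - i) - q ^ (-(n - i)))
      - (q ^ i - q ^ (-i)) * (q ^ (n + 1 - i) - q ^ (-(n + 1 - i)))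
      = (q ^ (n - 2 * i) - q ^ (-(n - 2 * i))) * (q - q⁻¹) := by
    have e2 : ∀ x : ℤ, q ^ x * q = q ^ (x + 1) := fun x => by rw [e1, zpow_one]
    have e3 : ∀ x : ℤ, q ^ x * q⁻¹ = q ^ (x - 1) := fun x => by
      rw [sub_eq_add_neg, e1, zpow_neg_one]
    simp only [sub_mul, mul_sub, ← e1, e2, e3]
    ring_nf
  unfold qInt
  field_simp at key ⊢
  linear_combination key

/-- The representation of `U_q(sl_2)` on `L(n, +1)`. -/
def simpleRep (q : ℂ) (hq0 : q ≠ 0) (hq2 : q ^ 2 ≠ 1) (n : ℕ) :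
    Uq q →ₐ[ℂ] Module.End ℂ (Fin (n + 1) → ℂ) :=
  RingQuot.liftAlgHom ℂ ⟨FreeAlgebra.lift ℂ fun g : UqGen => match g with
    | UqGen.E => opE q n
    | UqGen.F => opF n
    | UqGen.K => opK q n
    | UqGen.Kinv => opKinv q n, by
      have hz : ∀ a b : ℤ, q ^ a * q ^ b = q ^ (a + b) := fun a b => (zpow_add₀ hq0 a b).symm
      intro x y h
      cases h with
      | mul_inv =>
        simp only [map_mul, FreeAlgebra.lift_ι_apply, map_one]
        refine end_ext fun i _ => ?_
        simp [opK_natVec, opKinv_natVec, smul_smul, hz, -zpow_neg]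
      | inv_mul =>
        simp only [map_mul, FreeAlgebra.lift_ι_apply, map_one]
        refine end_ext fun i _ => ?_
        simp [opK_natVec, opKinv_natVec, smul_smul, hz, -zpow_neg]
      | conj_E =>
        simp only [map_mul, FreeAlgebra.lift_ι_apply, map_smul]
        refine end_ext fun i hi => ?_
        simp only [Module.End.mul_apply, LinearMap.smul_apply, opKinv_natVec, map_smul,
          opE_natVec q n i (by omega), opK_natVec, smul_smul]
        rcases i with _ | i
        · simp [qInt_zero]
        · congr 1
          have : q ^ (-wt n (i + 1)) * q ^ wt n (i + 1 - 1) = q ^ (2 : ℤ) := by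
            rw [hz]
            congr 1
            simp only [wt, Nat.add_sub_cancel]
            push_cast
            ring
          rw [zpow_ofNat] at this
          linear_combination
            (qInt q ↑(i + 1) * qInt q (↑n + 1 - ↑(i + 1))) * this
      | conj_F =>
        simp only [map_mul, FreeAlgebra.lift_ι_apply, map_smul]
        refine end_ext fun i hi => ?_
        simp only [Module.End.mul_apply, LinearMap.smul_apply, opKinv_natVec, map_smul,
          opF_natVec, opK_natVec, smul_smul]
        congr 1
        rw [hz]
        congr 1
        simp only [wt]
        push_cast
        ring
      | comm =>
        simp only [map_mul, map_sub, FreeAlgebra.lift_ι_apply, map_smul]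
        refine end_ext fun i hi => ?_
        have hFE : opF n (opE q n (natVec n i))
            = (qInt q i * qInt q ((n : ℤ) + 1 - i)) • natVec n i := by
          rw [opE_natVec q n i (by omega), map_smul, opF_natVec]
          rcases i with _ | i
          · simp [qInt_zero]
          · rw [Nat.add_sub_cancel]
        simp only [LinearMap.sub_apply, Module.End.mul_apply, LinearMap.smul_apply, hFE,
          opF_natVec, opE_natVec q n (i + 1) (by omega), opK_natVec, opKinv_natVec,
          Nat.add_sub_cancel, ← sub_smul, smul_smul]
        congr 1
        have := qInt_comm hq0 hq2 i n
        rw [show (n : ℤ) + 1 - ((i + 1 : ℕ) : ℤ) = n - i by push_cast; ring,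
          show (((i + 1 : ℕ) : ℤ)) = (i : ℤ) + 1 by push_cast; ring, this, qInt, wt]
        field_simp⟩

theorem qInt_ne_zero {q : ℂ} (hq0 : q ≠ 0) (hq : ∀ m : ℕ, 0 < m → q ^ m ≠ 1) {m : ℕ}
    (hm : 0 < m) : qInt q m ≠ 0 := by
  refine div_ne_zero (fun h => hq (m + m) (by omega) ?_) (sub_inv_ne_zero hq0 (hq 2 two_pos))
  rw [zpow_neg, zpow_natCast] at h
  have h0 : q ^ m ≠ 0 := pow_ne_zero m hq0
  rw [pow_add]
  field_simp at h
  linear_combination h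

theorem opE_apply (q : ℂ) (n : ℕ) (w : Fin (n + 1) → ℂ) (j : ℕ) (hj : j < n) :
    opE q n w ⟨j, by omega⟩
      = qInt q ((j : ℤ) + 1) * qInt q ((n : ℤ) - j) * w ⟨j + 1, by omega⟩ := by
  have hw : w = ∑ i, w i • natVec n i := by
    conv_lhs => rw [← (Pi.basisFun ℂ (Fin (n + 1))).sum_repr w]
    simp only [natVec_fin, Pi.basisFun_repr]
  conv_lhs => rw [hw]
  simp only [map_sum, map_smul, Finset.sum_apply, Pi.smul_apply, smul_eq_mul]
  rw [Finset.sum_eq_single ⟨j + 1, by omega⟩]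
  · rw [opE_natVec q n (j + 1) (by omega), natVec, dif_pos (by omega)]
    simp only [Pi.smul_apply, Nat.add_sub_cancel, Pi.single_eq_same, smul_eq_mul, mul_one]
    rw [show (n : ℤ) + 1 - ((j + 1 : ℕ) : ℤ) = n - j by push_cast; ring,
      show (((j + 1 : ℕ) : ℤ)) = (j : ℤ) + 1 by push_cast; ring]
    ring
  · intro i _ hi
    rw [opE_natVec q n i (by omega)]
    rcases Nat.eq_zero_or_pos (i : ℕ) with h | h
    · simp [h, qInt_zero]
    · rw [natVec, dif_pos (by omega)]
      have : (⟨j, by omega⟩ : Fin (n + 1)) ≠ ⟨(i : ℕ) - 1, by omega⟩ := by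
        intro e
        apply hi
        simp only [Fin.mk.injEq] at e
        ext
        simp only
        omega
      simp [Pi.single_eq_of_ne this]
  · simp

/-- If `q` is not a root of unity, then `L(n, +1)` is simple. -/
theorem simpleRep_irreducible (q : ℂ) (hq0 : q ≠ 0) (hq : ∀ m : ℕ, 0 < m → q ^ m ≠ 1) (n : ℕ)
    (W : Submodule ℂ (Fin (n + 1) → ℂ))
    (hW : ∀ u, ∀ w ∈ W, simpleRep q hq0 (hq 2 two_pos) n u w ∈ W) : W = ⊥ ∨ W = ⊤ := by
  have hE : ∀ w ∈ W, opE q n w ∈ W := fun w hw => by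
    simpa [simpleRep] using
      hW (RingQuot.mkAlgHom ℂ (UqRel q) (FreeAlgebra.ι ℂ UqGen.E)) w hw
  have hF : ∀ w ∈ W, opF n w ∈ W := fun w hw => by
    simpa [simpleRep] using
      hW (RingQuot.mkAlgHom ℂ (UqRel q) (FreeAlgebra.ι ℂ UqGen.F)) w hw
  have step : ∀ i : ℕ, i ≤ n → ∀ w ∈ W, w ≠ 0 → (∀ j : Fin (n + 1), i < j → w j = 0) →
      natVec n 0 ∈ W := by
    intro i
    induction i with
    | zero =>
      intro _ w hw hne hz
      have hw0 : w = w 0 • natVec n 0 := by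
        ext j
        rcases Fin.eq_zero_or_eq_succ j with rfl | ⟨k, rfl⟩
        · simp [natVec]
        · rw [hz _ (by simp)]
          simp [natVec]
      have h0 : w 0 ≠ 0 := fun h => hne (by rw [hw0, h, zero_smul])
      rw [hw0] at hw
      exact (W.smul_mem_iff h0).1 hw
    | succ i ih =>
      intro hi w hw hne hz
      by_cases h : w ⟨i + 1, by omega⟩ = 0
      · refine ih (by omega) w hw hne fun j hj => ?_
        rcases Nat.lt_or_ge (i + 1) j with h' | h'
        · exact hz j h'
        · have : j = ⟨i + 1, by omega⟩ := by
            ext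
            simp only
            omega
          rw [this, h]
      · refine ih (by omega) _ (hE w hw) (fun h0 => ?_) fun j hj => ?_
        · have := opE_apply q n w i (by omega)
          rw [h0] at this
          have h1 := qInt_ne_zero hq0 hq (m := i + 1) (by omega)
          have h2 := qInt_ne_zero hq0 hq (m := n - i) (by omega)
          rw [Nat.cast_sub (by omega)] at h2
          push_cast at h1
          exact mul_ne_zero (mul_ne_zero h1 h2) h this.symm
        · rcases Nat.lt_or_ge j n with h' | h'
          · have := opE_apply q n w j h'
            rw [hz ⟨j + 1, by omega⟩ (by simp only; omega), mul_zero] at this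
            exact this
          · have hjn : (j : ℕ) = n := by omega
            have hw' : opE q n w = ∑ l : Fin (n + 1), w l • opE q n (natVec n l) := by
              conv_lhs => rw [← (Pi.basisFun ℂ (Fin (n + 1))).sum_repr w]
              simp only [map_sum, map_smul, natVec_fin, Pi.basisFun_repr]
            rw [hw', Finset.sum_apply]
            refine Finset.sum_eq_zero fun l _ => ?_
            rw [opE_natVec q n l (by omega), natVec, dif_pos (by omega)]
            rcases Nat.eq_zero_or_pos (l : ℕ) with h | h
            · simp [h, qInt_zero]
            · have : j ≠ (⟨(l : ℕ) - 1, by omega⟩ : Fin (n + 1)) := by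
                intro e
                have := congrArg Fin.val e
                simp only at this
                omega
              simp [Pi.single_eq_of_ne this]
  rcases eq_or_ne W ⊥ with h | h
  · exact Or.inl h
  · right
    obtain ⟨w, hw, hne⟩ := W.ne_bot_iff.1 h
    have h0 := step n le_rfl w hw hne fun j hj => absurd j.2 (by omega)
    have hall : ∀ i, natVec n i ∈ W := by
      intro i
      induction i with
      | zero => exact h0
      | succ i ih => rw [← opF_natVec]; exact hF _ ih
    rw [eq_top_iff, ← (Pi.basisFun ℂ (Fin (n + 1))).span_eq, Submodule.span_le]
    rintro _ ⟨i, rfl⟩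
    rw [← natVec_fin]
    exact hall i

/-- The function `f` on pairs of weights, where the integers `a`, `b` stand for the weights
`a α / 2`, `b α / 2`, whose scalar product is `a b / 2`. It is normalized by
`f (0, 0) = f (α / 2, α / 2) = q⁻²`; note that integer division rounds down. -/
def weightForm (q : ℂ) (a b : ℤ) : ℂ := q ^ (-2 - a * b / 2)

/-- `f (λ + α, μ) = q ^ (-(α, μ)) f (λ, μ)`. -/
theorem weightForm_add_left {q : ℂ} (hq0 : q ≠ 0) (a b : ℤ) :
    weightForm q (a + 2) b = q ^ (-b) * weightForm q a b := by
  unfold weightForm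
  rw [← zpow_add₀ hq0]
  congr 1
  rw [show (a + 2) * b = a * b + b * 2 by ring, Int.add_mul_ediv_right _ _ (by norm_num)]
  ring

/-- `f (λ, μ + α) = q ^ (-(λ, α)) f (λ, μ)`. -/
theorem weightForm_add_right {q : ℂ} (hq0 : q ≠ 0) (a b : ℤ) :
    weightForm q a (b + 2) = q ^ (-a) * weightForm q a b := by
  unfold weightForm
  rw [← zpow_add₀ hq0]
  congr 1
  rw [show a * (b + 2) = a * b + a * 2 by ring, Int.add_mul_ediv_right _ _ (by norm_num)]
  ring

/-- The coefficient of `F^m ⊗ E^m` in the quasi-R-matrix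
`Θ = ∑ m, (-1)^m q^(-m(m-1)/2) (q - q⁻¹)^m / [m]! · F^m ⊗ E^m`. -/
def thetaCoeff (q : ℂ) (m : ℕ) : ℂ :=
  (-1) ^ m * q ^ (-((m : ℤ) * (m - 1) / 2)) * (q - q⁻¹) ^ m / qFactorial q m

/-- The braiding of `L(n, +1)`: for weight vectors `a`, `b` of weights `μ`, `μ'`,
`a ⊗ b ↦ f (μ', μ) Θ (b ⊗ a)`. The terms with `m > n` of `Θ` vanish on `L(n, +1)`. -/
def uqBraiding (q : ℂ) (n : ℕ) :
    ((Fin (n + 1) → ℂ) ⊗[ℂ] (Fin (n + 1) → ℂ)) →ₗ[ℂ]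
      ((Fin (n + 1) → ℂ) ⊗[ℂ] (Fin (n + 1) → ℂ)) :=
  ((Pi.basisFun ℂ (Fin (n + 1))).tensorProduct (Pi.basisFun ℂ (Fin (n + 1)))).constr ℂ fun p =>
    weightForm q (wt n p.2) (wt n p.1) • ∑ m ∈ Finset.range (n + 1),
      thetaCoeff q m • ((opF n ^ m) (natVec n p.2) ⊗ₜ[ℂ] (opE q n ^ m) (natVec n p.1))

end QuantumGroup

end NicholsSl2

end

open NicholsSl2

noncomputable section

namespace NicholsSl2

/-! Two-sided ideals of the free algebra as subspaces. -/

section Ideals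

variable {k : Type*} [Field k] {ι : Type*}

/-! Let `I` be the defining ideal of the Nichols algebra and `J` the two-sided ideal generated by
the listed relations. The proof shows `J ⊆ I`, that all words reduce modulo `J` to certain normal
words, and that the normal words are linearly independent modulo `I`. These facts force `I = J` and
give everything else (`IsPresentation`): the basis, the degree-two relations, and, since reduction
keeps the length and only moves up in the order, that a word is irreducible exactly if it is normal.
The set `S` and the heights are then combinatorics of normal words.

`J ⊆ I`: a quadratic element `r` is primitive if `(1 + c) r = 0`. The relations satisfy this, and
they span a `U_q(sl_2)`-submodule of `M ⊗ M` (of dimension 1, 3, 5), so the braiding moves them past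
letters within their span. An ideal generated by such elements is a coideal
(`span_quad_le_nicholsIdeal`).

Independence modulo `I`: contracting the left factor of the comultiplication with the coefficient of
`x_t` gives a skew derivation `∂_t` that maps `I` to itself (`leftDeriv_mem_nicholsIdeal`). The
quasi-R-matrix is triangular, so on elements killed by all `∂_r` with `r < t` the derivation `∂_t`
obeys the Leibniz rule of a diagonal braiding (`leftDeriv_ι_mul_of_eq_zero`). Hence `∂_t` lowers the
exponent of a power of `x_t` standing to the right of larger letters, with a scalar `1 + f + ⋯ +
f^e`, where `f` is a nonzero power of `q`; this is nonzero because `q` is not a root of unity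
(`linearIndependent_mul_ι_pow`). For `n = 1, 2` the ordered monomials are all the normal words.

For `n = 3` the quadratic relations imply two cubic ones, which say that `z = x_1 x_2 - q x_2 x_1`
commutes with `x_1` and `x_2` up to the scalar `q^3`. The leading words of the seven relations leave
the normal words with the additional block `(x_1 x_2)^c`. The exponent of `z` is lowered by `∂_1
∂_2` (`exists_leftDeriv_one_two_mul_skewComm_pow`), so the monomials `x_3^a x_2^b z^c x_1^d x_0^e`
are independent modulo `I`; a dimension count in each degree transfers this to the normal words
(`linearIndependent_of_filtered_span`). -/

theorem mem_idealSubmodule {I : TwoSidedIdeal (FreeAlgebra k ι)} {a : FreeAlgebra k ι} :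
    a ∈ idealSubmodule I ↔ a ∈ I := by
  simp [idealSubmodule, TwoSidedIdeal.mem_asIdeal]

theorem idealSubmodule_mono {I J : TwoSidedIdeal (FreeAlgebra k ι)} (h : I ≤ J) :
    idealSubmodule I ≤ idealSubmodule J := fun _ ha =>
  mem_idealSubmodule.2 (TwoSidedIdeal.le_iff.1 h (mem_idealSubmodule.1 ha))

theorem word_nil : word k ([] : List ι) = 1 := by simp [word]

theorem word_cons (i : ι) (u : List ι) : word k (i :: u) = FreeAlgebra.ι k i * word k u := by
  simp [word]

theorem word_singleton (i : ι) : word k [i] = FreeAlgebra.ι k i := by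
  simp [word]

theorem word_append (u v : List ι) : word k (u ++ v) = word k u * word k v := by
  simp [word]

theorem span_word : Submodule.span k (Set.range (word k : List ι → FreeAlgebra k ι)) = ⊤ := by
  rw [eq_top_iff]
  rintro a -
  induction a using FreeAlgebra.induction with
  | grade0 r =>
    rw [Algebra.algebraMap_eq_smul_one, ← word_nil (k := k) (ι := ι)]
    exact Submodule.smul_mem _ _ (Submodule.subset_span ⟨_, rfl⟩)
  | grade1 i => exact Submodule.subset_span ⟨[i], word_singleton i⟩
  | mul a b ha hb =>
    have := Submodule.mul_mem_mul ha hb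
    rw [Submodule.span_mul_span] at this
    refine Submodule.span_mono ?_ this
    rintro _ ⟨_, ⟨u, rfl⟩, _, ⟨v, rfl⟩, rfl⟩
    exact ⟨u ++ v, word_append u v⟩
  | add a b ha hb => exact add_mem ha hb

theorem mul_mem_of_generators_mul_mem {W : Submodule k (FreeAlgebra k ι)}
    (h : ∀ i, ∀ a ∈ W, FreeAlgebra.ι k i * a ∈ W) (b : FreeAlgebra k ι) :
    ∀ a ∈ W, b * a ∈ W := by
  induction b using FreeAlgebra.induction with
  | grade0 r => intro a ha; rw [← Algebra.smul_def]; exact W.smul_mem r ha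
  | grade1 i => exact h i
  | mul b c hb hc => intro a ha; rw [mul_assoc]; exact hb _ (hc _ ha)
  | add b c hb hc => intro a ha; rw [add_mul]; exact add_mem (hb _ ha) (hc _ ha)

theorem mul_mem_of_mul_generators_mem {W : Submodule k (FreeAlgebra k ι)}
    (h : ∀ i, ∀ a ∈ W, a * FreeAlgebra.ι k i ∈ W) (b : FreeAlgebra k ι) :
    ∀ a ∈ W, a * b ∈ W := by
  induction b using FreeAlgebra.induction with
  | grade0 r =>
    intro a ha
    rw [← Algebra.commutes, ← Algebra.smul_def]
    exact W.smul_mem r ha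
  | grade1 i => exact h i
  | mul b c hb hc => intro a ha; rw [← mul_assoc]; exact hc _ (hb _ ha)
  | add b c hb hc => intro a ha; rw [mul_add]; exact add_mem (hb _ ha) (hc _ ha)

/-- A subspace that is closed under multiplication by the generators, as a two-sided ideal. -/
def idealOfSubmodule (W : Submodule k (FreeAlgebra k ι))
    (hl : ∀ i, ∀ a ∈ W, FreeAlgebra.ι k i * a ∈ W)
    (hr : ∀ i, ∀ a ∈ W, a * FreeAlgebra.ι k i ∈ W) : TwoSidedIdeal (FreeAlgebra k ι) :=
  TwoSidedIdeal.mk' (W : Set (FreeAlgebra k ι)) W.zero_mem W.add_mem W.neg_mem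
    (fun {x y} hy => mul_mem_of_generators_mul_mem hl x y hy)
    (fun {x y} hx => mul_mem_of_mul_generators_mem hr y x hx)

theorem mem_idealOfSubmodule {W : Submodule k (FreeAlgebra k ι)} {hl hr} {a : FreeAlgebra k ι} :
    a ∈ idealOfSubmodule W hl hr ↔ a ∈ W :=
  TwoSidedIdeal.mem_mk' _ _ _ _ _ _ _

/-- A sum of ideals taken as subspaces is already closed under multiplication by the generators, so
it is the supremum of the ideals. A property of `nicholsIdeal` that amounts to an inclusion of
subspaces can thus be checked on each homogeneous coideal separately. -/
theorem idealSubmodule_sSup (S : Set (TwoSidedIdeal (FreeAlgebra k ι))) :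
    idealSubmodule (sSup S) = ⨆ I ∈ S, idealSubmodule I := by
  refine le_antisymm (fun a ha => ?_)
    (iSup₂_le fun I hI => idealSubmodule_mono (le_sSup hI))
  have key : ∀ f : FreeAlgebra k ι →ₗ[k] FreeAlgebra k ι,
      (∀ I : TwoSidedIdeal (FreeAlgebra k ι), ∀ b ∈ I, f b ∈ I) →
      ∀ b ∈ ⨆ I ∈ S, idealSubmodule I, f b ∈ ⨆ I ∈ S, idealSubmodule I := by
    intro f hf
    change _ ≤ (⨆ I ∈ S, idealSubmodule I).comap f
    refine iSup₂_le fun I hI b hb => ?_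
    exact (le_iSup₂_of_le I hI le_rfl : idealSubmodule I ≤ ⨆ I ∈ S, idealSubmodule I)
      (mem_idealSubmodule.2 (hf I b (mem_idealSubmodule.1 hb)))
  have hle : sSup S ≤ idealOfSubmodule (⨆ I ∈ S, idealSubmodule I)
      (fun i => key (LinearMap.mulLeft k (FreeAlgebra.ι k i)) fun I b hb => I.mul_mem_left _ _ hb)
      (fun i => key (LinearMap.mulRight k (FreeAlgebra.ι k i))
        fun I b hb => I.mul_mem_right _ _ hb) := by
    refine sSup_le fun I hI => TwoSidedIdeal.le_iff.2 fun b hb => ?_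
    exact mem_idealOfSubmodule.2
      ((le_iSup₂_of_le I hI le_rfl : idealSubmodule I ≤ ⨆ I ∈ S, idealSubmodule I)
        (mem_idealSubmodule.2 hb))
  exact mem_idealOfSubmodule.1 (TwoSidedIdeal.le_iff.1 hle (mem_idealSubmodule.1 ha))

theorem idealSubmodule_span (R : Set (FreeAlgebra k ι)) :
    idealSubmodule (TwoSidedIdeal.span R) =
      Submodule.span k {a | ∃ u v : List ι, ∃ r ∈ R, a = word k u * r * word k v} := by
  set W := Submodule.span k {a | ∃ u v : List ι, ∃ r ∈ R, a = word k u * r * word k v} with hW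
  have hl : ∀ i, W ≤ W.comap (LinearMap.mulLeft k (FreeAlgebra.ι k i)) := by
    intro i
    rw [hW, Submodule.span_le]
    rintro _ ⟨u, v, r, hr, rfl⟩
    refine Submodule.subset_span ⟨i :: u, v, r, hr, ?_⟩
    simp [word_cons, mul_assoc]
  have hr : ∀ i, W ≤ W.comap (LinearMap.mulRight k (FreeAlgebra.ι k i)) := by
    intro i
    rw [hW, Submodule.span_le]
    rintro _ ⟨u, v, r, hr, rfl⟩
    refine Submodule.subset_span ⟨u, v ++ [i], r, hr, ?_⟩
    simp [word_append, word_singleton, mul_assoc]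
  apply le_antisymm
  · have hle : TwoSidedIdeal.span R ≤
        idealOfSubmodule W (fun i _ ha => hl i ha) (fun i _ ha => hr i ha) := by
      refine TwoSidedIdeal.span_le.2 fun r hr => ?_
      refine mem_idealOfSubmodule.2 (Submodule.subset_span ⟨[], [], r, hr, ?_⟩)
      simp [word_nil]
    intro a ha
    exact mem_idealOfSubmodule.1 (TwoSidedIdeal.le_iff.1 hle (mem_idealSubmodule.1 ha))
  · rw [hW, Submodule.span_le]
    rintro _ ⟨u, v, r, hr, rfl⟩
    exact mem_idealSubmodule.2 (TwoSidedIdeal.mul_mem_right _ _ _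
      (TwoSidedIdeal.mul_mem_left _ _ _ (TwoSidedIdeal.subset_span hr)))

theorem word_mem_homogeneousPart (u : List ι) : word k u ∈ homogeneousPart k ι u.length :=
  Submodule.subset_span ⟨u, rfl, rfl⟩

theorem mul_mem_homogeneousPart {m n : ℕ} {a b : FreeAlgebra k ι} (ha : a ∈ homogeneousPart k ι m)
    (hb : b ∈ homogeneousPart k ι n) : a * b ∈ homogeneousPart k ι (m + n) := by
  have := Submodule.mul_mem_mul ha hb
  rw [homogeneousPart, homogeneousPart, Submodule.span_mul_span] at this
  refine Submodule.span_mono ?_ this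
  rintro _ ⟨_, ⟨u, hu, rfl⟩, _, ⟨v, hv, rfl⟩, rfl⟩
  exact ⟨u ++ v, by simp [hu, hv], (word_append u v).symm⟩

theorem isHomogeneousIdeal_span {R : Set (FreeAlgebra k ι)}
    (hR : ∀ r ∈ R, r ∈ homogeneousPart k ι 2) : IsHomogeneousIdeal (TwoSidedIdeal.span R) := by
  refine le_antisymm ?_ (iSup_le fun m => inf_le_left)
  conv_lhs => rw [idealSubmodule_span]
  rw [Submodule.span_le]
  rintro _ ⟨u, v, r, hr, rfl⟩
  refine (le_iSup (fun m => idealSubmodule (TwoSidedIdeal.span R) ⊓ homogeneousPart k ι (m + 2))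
    (u.length + v.length)) ⟨?_, ?_⟩
  · exact mem_idealSubmodule.2 (TwoSidedIdeal.mul_mem_right _ _ _
      (TwoSidedIdeal.mul_mem_left _ _ _ (TwoSidedIdeal.subset_span hr)))
  · have := mul_mem_homogeneousPart
      (mul_mem_homogeneousPart (word_mem_homogeneousPart (k := k) u) (hR r hr))
      (word_mem_homogeneousPart v)
    rwa [show u.length + 2 + v.length = u.length + v.length + 2 by omega] at this

end Ideals

/-! Skew derivations of the free algebra defined by the comultiplication. -/

section Derivations

variable {k : Type*} [Field k] {ι : Type*}

/-- The augmentation of the free algebra. -/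
def augmentation (k : Type*) [Field k] (ι : Type*) : FreeAlgebra k ι →ₐ[k] k :=
  FreeAlgebra.lift k fun _ => 0

theorem augmentation_ι (i : ι) : augmentation k ι (FreeAlgebra.ι k i) = 0 := by
  simp [augmentation]

theorem augmentation_word_cons (i : ι) (u : List ι) : augmentation k ι (word k (i :: u)) = 0 := by
  simp [word_cons, augmentation_ι]

/-- Homogeneous ideals here live in degrees at least two, so a functional that only sees degrees
zero and one vanishes on them. It is applied to the augmentation and to the linear coefficients. -/
theorem mem_ker_of_mem_homogeneousIdeal {I : TwoSidedIdeal (FreeAlgebra k ι)}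
    (hI : IsHomogeneousIdeal I) {f : FreeAlgebra k ι →ₗ[k] k}
    (hf : ∀ i j : ι, ∀ u : List ι, f (word k (i :: j :: u)) = 0) {a : FreeAlgebra k ι}
    (ha : a ∈ idealSubmodule I) : f a = 0 := by
  rw [IsHomogeneousIdeal] at hI
  suffices h : idealSubmodule I ≤ LinearMap.ker f from h ha
  rw [hI]
  refine iSup_le fun m => inf_le_right.trans ?_
  rw [homogeneousPart, Submodule.span_le]
  rintro _ ⟨u, hu, rfl⟩
  match u, hu with
  | i :: j :: u, _ => exact hf i j u

/-- Contraction of the left tensor factor with a linear form. -/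
def contractLeft (φ : FreeAlgebra k ι →ₗ[k] k) :
    FreeAlgebra k ι ⊗[k] FreeAlgebra k ι →ₗ[k] FreeAlgebra k ι :=
  (TensorProduct.lid k _).toLinearMap.comp (φ.rTensor _)

theorem contractLeft_tmul (φ : FreeAlgebra k ι →ₗ[k] k) (a b : FreeAlgebra k ι) :
    contractLeft φ (a ⊗ₜ b) = φ a • b := by
  simp [contractLeft]

theorem contractLeft_augmentation_mulLeft (i : ι) (z : FreeAlgebra k ι ⊗[k] FreeAlgebra k ι) :
    contractLeft (augmentation k ι).toLinearMap (mulLeftFactor k i z) = 0 := by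
  induction z with
  | zero => simp
  | tmul a b => simp [mulLeftFactor, contractLeft_tmul, augmentation_ι]
  | add x y hx hy => rw [map_add, map_add, hx, hy, add_zero]

variable [DecidableEq ι]

/-- The algebra map to the dual numbers with `x_i ↦ δ_{i t} ε`. -/
def dualNumberMap (k : Type*) [Field k] {ι : Type*} [DecidableEq ι] (t : ι) :
    FreeAlgebra k ι →ₐ[k] TrivSqZeroExt k k :=
  FreeAlgebra.lift k fun i => TrivSqZeroExt.inr (if i = t then 1 else 0)

/-- The coefficient of `x_t` in an element of the free algebra. -/
def linearCoeff (k : Type*) [Field k] {ι : Type*} [DecidableEq ι] (t : ι) :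
    FreeAlgebra k ι →ₗ[k] k :=
  (TrivSqZeroExt.sndHom k k).comp (dualNumberMap k t).toLinearMap

theorem fst_dualNumberMap (t : ι) (a : FreeAlgebra k ι) :
    (dualNumberMap k t a).fst = augmentation k ι a := by
  have : (TrivSqZeroExt.fstHom k k k).comp (dualNumberMap k t) = augmentation k ι := by
    ext i
    by_cases h : i = t <;> simp [dualNumberMap, augmentation, h]
  exact DFunLike.congr_fun this a

/-- This is multiplication of dual numbers: the `ε`-part of a product obeys the Leibniz rule, with
the augmentation as the scalar part. -/
theorem linearCoeff_mul (t : ι) (a b : FreeAlgebra k ι) :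
    linearCoeff k t (a * b) =
      augmentation k ι a * linearCoeff k t b + linearCoeff k t a * augmentation k ι b := by
  simp [linearCoeff, TrivSqZeroExt.snd_mul, fst_dualNumberMap, mul_comm]

theorem linearCoeff_one (t : ι) : linearCoeff k t (1 : FreeAlgebra k ι) = 0 := by
  simp [linearCoeff]

theorem linearCoeff_algebraMap (t : ι) (r : k) :
    linearCoeff k t (algebraMap k (FreeAlgebra k ι) r) = 0 := by
  rw [Algebra.algebraMap_eq_smul_one, map_smul, linearCoeff_one, smul_zero]

theorem linearCoeff_ι (t i : ι) : linearCoeff k t (FreeAlgebra.ι k i) = if i = t then 1 else 0 := by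
  by_cases h : i = t <;> simp [linearCoeff, dualNumberMap, h]

theorem contractLeft_linearCoeff_mulLeft (t i : ι) (z : FreeAlgebra k ι ⊗[k] FreeAlgebra k ι) :
    contractLeft (linearCoeff k t) (mulLeftFactor k i z) =
      if i = t then contractLeft (augmentation k ι).toLinearMap z else 0 := by
  induction z with
  | zero => simp
  | tmul a b =>
    simp [mulLeftFactor, contractLeft_tmul, augmentation_ι, linearCoeff_mul, linearCoeff_ι,
      ite_smul]
  | add x y hx hy =>
    rw [map_add, map_add, hx, hy, map_add]
    split_ifs <;> simp

variable [Fintype ι] (c : ((ι → k) ⊗[k] (ι → k)) →ₗ[k] ((ι → k) ⊗[k] (ι → k)))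

theorem braidMatrix_ι (i j s : ι) :
    braidMatrix c (FreeAlgebra.ι k j) i s = ∑ r, braidCoeff c i j r s • FreeAlgebra.ι k r := by
  simp [braidMatrix]

theorem augmentation_braidMatrix (a : FreeAlgebra k ι) (i s : ι) :
    augmentation k ι (braidMatrix c a i s) = if i = s then augmentation k ι a else 0 := by
  have : (augmentation k ι).mapMatrix.comp (braidMatrix c) =
      (Algebra.ofId k (Matrix ι ι k)).comp (augmentation k ι) := by
    ext j i s
    simp [braidMatrix_ι, augmentation_ι]
  have h := congrFun (congrFun (DFunLike.congr_fun this a) i) s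
  simpa [Algebra.ofId_apply, Matrix.algebraMap_matrix_apply] using h

/-- The braiding preserves the degree of the element that is crossed, so the linear part of the
result comes from the linear part of `a` alone, where the braiding is `c`. -/
theorem linearCoeff_braidMatrix (a : FreeAlgebra k ι) (t i s : ι) :
    linearCoeff k t (braidMatrix c a i s) = ∑ r, linearCoeff k r a * braidCoeff c i r t s := by
  induction a using FreeAlgebra.induction generalizing i s with
  | grade0 r =>
    simp only [AlgHom.commutes, Matrix.algebraMap_matrix_apply, linearCoeff_algebraMap, zero_mul,
      Finset.sum_const_zero]
    split_ifs <;> simp [linearCoeff_algebraMap]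
  | grade1 j => simp [braidMatrix_ι, linearCoeff_ι]
  | mul a b ha hb =>
    simp only [map_mul, Matrix.mul_apply, map_sum, linearCoeff_mul, augmentation_braidMatrix,
      ite_mul, zero_mul, mul_ite, mul_zero, Finset.sum_add_distrib, Finset.sum_ite_eq,
      Finset.sum_ite_eq', Finset.mem_univ, if_true, add_mul]
    simp only [ha, hb, Finset.mul_sum, mul_comm, mul_left_comm]
  | add a b ha hb => simp [ha, hb, add_mul, Finset.sum_add_distrib]

theorem contractLeft_augmentation_mulRight (i : ι) (z : FreeAlgebra k ι ⊗[k] FreeAlgebra k ι) :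
    contractLeft (augmentation k ι).toLinearMap (mulRightFactor c i z) =
      FreeAlgebra.ι k i * contractLeft (augmentation k ι).toLinearMap z := by
  induction z with
  | zero => simp
  | tmul a b =>
    simp [mulRightFactor, contractLeft_tmul, augmentation_braidMatrix, LinearMap.sum_apply,
      ite_smul]
  | add x y hx hy => rw [map_add, map_add, hx, hy, map_add, mul_add]

theorem contractLeft_linearCoeff_mulRight (t i : ι) (z : FreeAlgebra k ι ⊗[k] FreeAlgebra k ι) :
    contractLeft (linearCoeff k t) (mulRightFactor c i z) =
      ∑ s, ∑ r, braidCoeff c i r t s • (FreeAlgebra.ι k s * contractLeft (linearCoeff k r) z) := by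
  induction z with
  | zero => simp
  | tmul a b =>
    simp only [mulRightFactor, LinearMap.sum_apply, TensorProduct.map_tmul, map_sum,
      contractLeft_tmul, LinearMap.comp_apply, Matrix.entryLinearMap_apply,
      AlgHom.toLinearMap_apply, LinearMap.mulLeft_apply, linearCoeff_braidMatrix, Finset.sum_smul,
      mul_smul_comm, smul_smul, mul_comm]
  | add x y hx hy =>
    simp only [map_add, hx, hy, mul_add, smul_add, Finset.sum_add_distrib]

theorem comul_one : comul c 1 = 1 ⊗ₜ 1 := by
  simp [comul]

theorem comul_ι_mul (i : ι) (a : FreeAlgebra k ι) :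
    comul c (FreeAlgebra.ι k i * a) =
      mulLeftFactor k i (comul c a) + mulRightFactor c i (comul c a) := by
  simp [comul]

/-- The counit axiom. It produces the term `a` in the Leibniz rule when the letter `x_t` itself is
picked out on the left. -/
theorem contractLeft_augmentation_comul (a : FreeAlgebra k ι) :
    contractLeft (augmentation k ι).toLinearMap (comul c a) = a := by
  have ha : a ∈ Submodule.span k (Set.range (word k : List ι → FreeAlgebra k ι)) := by
    rw [span_word]; trivial
  induction ha using Submodule.span_induction with
  | mem x hx =>
    obtain ⟨u, rfl⟩ := hx
    induction u with
    | nil => simp [word_nil, comul_one, contractLeft_tmul]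
    | cons i u ih =>
      rw [word_cons, comul_ι_mul, map_add, contractLeft_augmentation_mulLeft,
        contractLeft_augmentation_mulRight, ih, zero_add]
  | zero => simp
  | add x y _ _ hx hy => rw [map_add, map_add, hx, hy]
  | smul r x _ hx => rw [map_smul, map_smul, hx]

/-- The skew derivation of the free algebra that contracts the left tensor factor of the
comultiplication with the coefficient of `x_t`. -/
def leftDeriv (t : ι) : FreeAlgebra k ι →ₗ[k] FreeAlgebra k ι :=
  (contractLeft (linearCoeff k t)).comp (comul c)

theorem leftDeriv_one (t : ι) : leftDeriv c t 1 = 0 := by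
  simp [leftDeriv, comul_one, contractLeft_tmul, linearCoeff_one]

theorem leftDeriv_ι_mul (t i : ι) (a : FreeAlgebra k ι) :
    leftDeriv c t (FreeAlgebra.ι k i * a) = (if i = t then a else 0) +
      ∑ s, ∑ r, braidCoeff c i r t s • (FreeAlgebra.ι k s * leftDeriv c r a) := by
  simp only [leftDeriv, LinearMap.comp_apply, comul_ι_mul, map_add,
    contractLeft_linearCoeff_mulLeft, contractLeft_linearCoeff_mulRight,
    contractLeft_augmentation_comul]

/-- The comultiplication maps `I` to `I ⊗ T + T ⊗ I`. Contraction with a linear coefficient kills `I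
⊗ T`, as `I` has no linear part, and sends `T ⊗ I` into `I`. -/
theorem leftDeriv_mem_of_isCoideal {I : TwoSidedIdeal (FreeAlgebra k ι)}
    (hI : IsHomogeneousIdeal I) (hc : IsCoideal c I) (t : ι) {a : FreeAlgebra k ι}
    (ha : a ∈ idealSubmodule I) : leftDeriv c t a ∈ idealSubmodule I := by
  suffices h : (idealSubmodule I).map (comul c) ≤
      (idealSubmodule I).comap (contractLeft (linearCoeff k t)) from
    h (Submodule.mem_map_of_mem ha)
  refine hc.trans (sup_le ?_ ?_)
  · rintro _ ⟨z, rfl⟩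
    induction z with
    | zero => simp
    | tmul a b =>
      have : linearCoeff k t (a : FreeAlgebra k ι) = 0 :=
        mem_ker_of_mem_homogeneousIdeal hI
          (fun i j u => by
            rw [word_cons, linearCoeff_mul, augmentation_ι, augmentation_word_cons]; simp) a.2
      simp [contractLeft_tmul, this]
    | add x y hx hy => rw [map_add]; exact add_mem hx hy
  · rintro _ ⟨z, rfl⟩
    induction z with
    | zero => simp
    | tmul a b =>
      simp only [TensorProduct.map_tmul, Submodule.mem_comap, contractLeft_tmul]
      exact Submodule.smul_mem _ _ b.2
    | add x y hx hy => rw [map_add]; exact add_mem hx hy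

theorem leftDeriv_mem_nicholsIdeal (t : ι) :
    idealSubmodule (nicholsIdeal c) ≤ (idealSubmodule (nicholsIdeal c)).comap (leftDeriv c t) := by
  conv_lhs => rw [nicholsIdeal, idealSubmodule_sSup]
  refine iSup₂_le fun I hI a ha => ?_
  exact idealSubmodule_mono (le_sSup hI) (leftDeriv_mem_of_isCoideal c hI.1 hI.2 t ha)

theorem one_notMem_nicholsIdeal : (1 : FreeAlgebra k ι) ∉ idealSubmodule (nicholsIdeal c) := by
  have h : idealSubmodule (nicholsIdeal c) ≤ LinearMap.ker (augmentation k ι).toLinearMap := by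
    rw [nicholsIdeal, idealSubmodule_sSup]
    refine iSup₂_le fun I hI a ha => ?_
    exact mem_ker_of_mem_homogeneousIdeal hI.1
      (fun i j u => augmentation_word_cons i (j :: u)) ha
  intro h1
  have := h h1
  simp at this

end Derivations

/-! Ideals generated by primitive quadratic elements. -/

section Quadratic

variable {k : Type*} [Field k] {ι : Type*} {J : TwoSidedIdeal (FreeAlgebra k ι)}

/-- The subspace `J ⊗ T` of `T ⊗ T`. -/
def idealTensor (J : TwoSidedIdeal (FreeAlgebra k ι)) :
    Submodule k (FreeAlgebra k ι ⊗[k] FreeAlgebra k ι) :=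
  LinearMap.range (TensorProduct.map (idealSubmodule J).subtype
      (LinearMap.id : FreeAlgebra k ι →ₗ[k] FreeAlgebra k ι))

/-- The subspace `T ⊗ J` of `T ⊗ T`. -/
def tensorIdeal (J : TwoSidedIdeal (FreeAlgebra k ι)) :
    Submodule k (FreeAlgebra k ι ⊗[k] FreeAlgebra k ι) :=
  LinearMap.range (TensorProduct.map
      (LinearMap.id : FreeAlgebra k ι →ₗ[k] FreeAlgebra k ι) (idealSubmodule J).subtype)

theorem tmul_mem_idealTensor {a : FreeAlgebra k ι} (ha : a ∈ J) (b : FreeAlgebra k ι) :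
    a ⊗ₜ[k] b ∈ idealTensor J :=
  ⟨(⟨a, mem_idealSubmodule.2 ha⟩ : idealSubmodule J) ⊗ₜ b, by simp⟩

theorem tmul_mem_tensorIdeal (a : FreeAlgebra k ι) {b : FreeAlgebra k ι} (hb : b ∈ J) :
    a ⊗ₜ[k] b ∈ tensorIdeal J :=
  ⟨a ⊗ₜ (⟨b, mem_idealSubmodule.2 hb⟩ : idealSubmodule J), by simp⟩

theorem idealTensor_le {W : Submodule k (FreeAlgebra k ι ⊗[k] FreeAlgebra k ι)}
    (h : ∀ a ∈ J, ∀ b, a ⊗ₜ[k] b ∈ W) : idealTensor J ≤ W := by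
  rintro _ ⟨z, rfl⟩
  induction z with
  | zero => simp
  | tmul a b => exact h a (mem_idealSubmodule.1 a.2) b
  | add x y hx hy => rw [map_add]; exact add_mem hx hy

theorem tensorIdeal_le {W : Submodule k (FreeAlgebra k ι ⊗[k] FreeAlgebra k ι)}
    (h : ∀ a, ∀ b ∈ J, a ⊗ₜ[k] b ∈ W) : tensorIdeal J ≤ W := by
  rintro _ ⟨z, rfl⟩
  induction z with
  | zero => simp
  | tmul a b => exact h a b (mem_idealSubmodule.1 b.2)
  | add x y hx hy => rw [map_add]; exact add_mem hx hy

theorem tensorIdeal_le_comap_mulLeftFactor (i : ι) :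
    tensorIdeal J ≤ (tensorIdeal J).comap (mulLeftFactor k i) :=
  tensorIdeal_le fun a b hb => by
    simpa [mulLeftFactor] using tmul_mem_tensorIdeal _ hb

variable [Fintype ι]

/-- The quadratic element of the free algebra with coefficient matrix `ρ`. -/
def quad (ρ : Matrix ι ι k) : FreeAlgebra k ι :=
  ∑ i, ∑ j, ρ i j • (FreeAlgebra.ι k i * FreeAlgebra.ι k j)

theorem quad_mem_homogeneousPart (ρ : Matrix ι ι k) : quad ρ ∈ homogeneousPart k ι 2 := by
  refine sum_mem fun i _ => sum_mem fun j _ => Submodule.smul_mem _ _ (Submodule.subset_span ?_)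
  exact ⟨[i, j], rfl, by simp [word]⟩

variable [DecidableEq ι] (c : ((ι → k) ⊗[k] (ι → k)) →ₗ[k] ((ι → k) ⊗[k] (ι → k)))

/-- The braiding `T ⊗ V → V ⊗ T` in coordinates:
`a ⊗ x_p ↦ ∑ r, x_r ⊗ rightBraidMatrix c a r p`. -/
def rightBraidMatrix : FreeAlgebra k ι →ₐ[k] Matrix ι ι (FreeAlgebra k ι) :=
  FreeAlgebra.lift k fun i =>
    Matrix.of fun r p => ∑ s, braidCoeff c i p r s • FreeAlgebra.ι k s

theorem rightBraidMatrix_ι (i r p : ι) :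
    rightBraidMatrix c (FreeAlgebra.ι k i) r p = ∑ s, braidCoeff c i p r s • FreeAlgebra.ι k s := by
  simp [rightBraidMatrix]

/-- Left multiplication by `1 ⊗ a` in the braided tensor product algebra. -/
def mulRightHom : FreeAlgebra k ι →ₐ[k] Module.End k (FreeAlgebra k ι ⊗[k] FreeAlgebra k ι) :=
  FreeAlgebra.lift k (mulRightFactor c)

/-- Left multiplication by the comultiplication of `a` in the braided tensor product algebra. -/
def comulHom : FreeAlgebra k ι →ₐ[k] Module.End k (FreeAlgebra k ι ⊗[k] FreeAlgebra k ι) :=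
  FreeAlgebra.lift k fun i => mulLeftFactor k i + mulRightFactor c i

theorem comul_eq_comulHom (a : FreeAlgebra k ι) : comul c a = comulHom c a (1 ⊗ₜ 1) := by
  simp [comul, comulHom]

theorem mulRightHom_ι (i : ι) : mulRightHom c (FreeAlgebra.ι k i) = mulRightFactor c i := by
  simp [mulRightHom]

theorem comulHom_ι (i : ι) :
    comulHom c (FreeAlgebra.ι k i) = mulLeftFactor k i + mulRightFactor c i := by
  simp [comulHom]

theorem mulRightFactor_tmul (i : ι) (a b : FreeAlgebra k ι) :
    mulRightFactor c i (a ⊗ₜ b) = ∑ s, braidMatrix c a i s ⊗ₜ (FreeAlgebra.ι k s * b) := by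
  simp [mulRightFactor, LinearMap.sum_apply]

/-- The defining rule `(1 ⊗ x_i)(x_j ⊗ 1) = c (x_i ⊗ x_j)` of the braided tensor product algebra, as
an identity of operators. -/
theorem mulRightFactor_mul_mulLeftFactor (i j : ι) :
    mulRightFactor c i * mulLeftFactor k j =
      ∑ r, ∑ p, braidCoeff c i j r p • (mulLeftFactor k r * mulRightFactor c p) := by
  refine TensorProduct.ext' fun a b => ?_
  simp only [Module.End.mul_apply, mulLeftFactor, TensorProduct.map_tmul, LinearMap.mulLeft_apply,
    LinearMap.id_apply, LinearMap.sum_apply, LinearMap.smul_apply, mulRightFactor_tmul, map_sum,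
    map_mul, Matrix.mul_apply, braidMatrix_ι, Finset.sum_mul, TensorProduct.sum_tmul,
    smul_mul_assoc, TensorProduct.smul_tmul', Finset.smul_sum]
  rw [Finset.sum_comm]
  conv_lhs => enter [2, p]; rw [Finset.sum_comm]
  rw [Finset.sum_comm]

theorem mulRightHom_mul_mulLeftFactor (a : FreeAlgebra k ι) (p : ι) :
    mulRightHom c a * mulLeftFactor k p =
      ∑ r, mulLeftFactor k r * mulRightHom c (rightBraidMatrix c a r p) := by
  induction a using FreeAlgebra.induction generalizing p with
  | grade0 t =>
    simp only [AlgHom.commutes, Matrix.algebraMap_matrix_apply, apply_ite (mulRightHom c), map_zero,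
      mul_ite, mul_zero, Finset.sum_ite_eq', Finset.mem_univ, if_true]
    exact Algebra.commutes t (mulLeftFactor k p)
  | grade1 i =>
    simp only [mulRightHom_ι, mulRightFactor_mul_mulLeftFactor, rightBraidMatrix_ι, map_sum,
      map_smul, Finset.mul_sum, mul_smul_comm]
  | mul a b ha hb =>
    simp only [map_mul, mul_assoc, hb, Finset.mul_sum, Matrix.mul_apply, map_sum]
    simp only [← mul_assoc, ha, Finset.sum_mul]
    rw [Finset.sum_comm]
  | add a b ha hb => simp [ha, hb, add_mul, mul_add, Finset.sum_add_distrib]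

variable {c}

theorem mulRightHom_one_tmul (a b : FreeAlgebra k ι) :
    mulRightHom c a (1 ⊗ₜ b) = 1 ⊗ₜ (a * b) := by
  induction a using FreeAlgebra.induction generalizing b with
  | grade0 t => simp [← Algebra.smul_def]
  | grade1 i =>
    rw [mulRightHom_ι, mulRightFactor_tmul]
    rw [Finset.sum_eq_single i]
    · simp
    · intro s _ hs
      simp [hs.symm]
    · simp
  | mul a a' ha ha' => rw [map_mul, Module.End.mul_apply, ha', ha, mul_assoc]
  | add a a' ha ha' => rw [map_add, LinearMap.add_apply, ha, ha', add_mul, TensorProduct.tmul_add]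

/-- Moving `1 ⊗ a` past the letters of the left factor replaces `a` by entries of its braid matrix,
which stay in `J`. When the left factor is used up, the result is `1 ⊗ a v`. -/
theorem mulRightHom_mem (hR : ∀ a ∈ J, ∀ r p, rightBraidMatrix c a r p ∈ J)
    {a : FreeAlgebra k ι} (ha : a ∈ J) (z : FreeAlgebra k ι ⊗[k] FreeAlgebra k ι) :
    mulRightHom c a z ∈ tensorIdeal J := by
  induction z with
  | zero => simp
  | tmul u v =>
    have hu : u ∈ Submodule.span k (Set.range (word k : List ι → FreeAlgebra k ι)) := by
      rw [span_word]; trivial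
    induction hu using Submodule.span_induction with
    | mem x hx =>
      obtain ⟨u, rfl⟩ := hx
      induction u generalizing a with
      | nil =>
        rw [word_nil, mulRightHom_one_tmul]
        exact tmul_mem_tensorIdeal _ (J.mul_mem_right _ _ ha)
      | cons p u ih =>
        have h1 : word k (p :: u) ⊗ₜ[k] v = mulLeftFactor k p (word k u ⊗ₜ v) := by
          simp [mulLeftFactor, word_cons]
        rw [h1, ← Module.End.mul_apply, mulRightHom_mul_mulLeftFactor, LinearMap.sum_apply]
        exact sum_mem fun r _ => tensorIdeal_le_comap_mulLeftFactor r (ih (hR a ha r p))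
    | zero => simp
    | add x y _ _ hx hy => rw [TensorProduct.add_tmul, map_add]; exact add_mem hx hy
    | smul t x _ hx => rw [← TensorProduct.smul_tmul', map_smul]; exact Submodule.smul_mem _ t hx
  | add x y hx hy => rw [map_add]; exact add_mem hx hy

theorem comulHom_mem (hL : ∀ a ∈ J, ∀ i s, braidMatrix c a i s ∈ J) (a : FreeAlgebra k ι) :
    ∀ z ∈ idealTensor J ⊔ tensorIdeal J, comulHom c a z ∈ idealTensor J ⊔ tensorIdeal J := by
  induction a using FreeAlgebra.induction with
  | grade0 t =>
    intro z hz
    rw [AlgHom.commutes, Module.algebraMap_end_apply]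
    exact Submodule.smul_mem _ t hz
  | grade1 i =>
    suffices h : idealTensor J ⊔ tensorIdeal J ≤
        (idealTensor J ⊔ tensorIdeal J).comap (comulHom c (FreeAlgebra.ι k i)) from h
    refine sup_le (idealTensor_le fun a ha b => ?_) (tensorIdeal_le fun a b hb => ?_)
    · rw [Submodule.mem_comap, comulHom_ι, LinearMap.add_apply, mulRightFactor_tmul]
      refine Submodule.mem_sup_left (add_mem ?_ (sum_mem fun s _ => ?_))
      · simpa [mulLeftFactor] using tmul_mem_idealTensor (J.mul_mem_left _ _ ha) b
      · exact tmul_mem_idealTensor (hL a ha i s) _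
    · rw [Submodule.mem_comap, comulHom_ι, LinearMap.add_apply, mulRightFactor_tmul]
      refine Submodule.mem_sup_right (add_mem ?_ (sum_mem fun s _ => ?_))
      · simpa [mulLeftFactor] using tmul_mem_tensorIdeal _ hb
      · exact tmul_mem_tensorIdeal _ (J.mul_mem_left _ _ hb)
  | mul a b ha hb => intro z hz; rw [map_mul]; exact ha _ (hb z hz)
  | add a b ha hb => intro z hz; rw [map_add]; exact add_mem (ha z hz) (hb z hz)

/-- Expanding `(x_i ⊗ 1 + 1 ⊗ x_i)(x_j ⊗ 1 + 1 ⊗ x_j)`, the mixed terms have the coefficients of `(1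
+ c)` applied to the quadratic tensor, and these vanish by `hρ`. -/
theorem comulHom_quad {ρ : Matrix ι ι k}
    (hρ : ∀ r p, ρ r p + ∑ i, ∑ j, ρ i j * braidCoeff c i j r p = 0) :
    comulHom c (quad ρ) =
      (∑ i, ∑ j, ρ i j • (mulLeftFactor k i * mulLeftFactor k j)) + mulRightHom c (quad ρ) := by
  have hcross : ∑ i, ∑ j, ρ i j • (mulLeftFactor k i * mulRightFactor c j) +
      ∑ i, ∑ j, ρ i j • (mulRightFactor c i * mulLeftFactor k j) = 0 := by
    have h2 : ∑ i, ∑ j, ρ i j • (mulRightFactor c i * mulLeftFactor k j) =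
        ∑ r, ∑ p, (∑ i, ∑ j, ρ i j * braidCoeff c i j r p) •
          (mulLeftFactor k r * mulRightFactor c p) := by
      simp only [mulRightFactor_mul_mulLeftFactor, Finset.smul_sum, smul_smul, Finset.sum_smul]
      conv_lhs => enter [2, i]; rw [Finset.sum_comm]
      rw [Finset.sum_comm]
      refine Finset.sum_congr rfl fun r _ => ?_
      conv_lhs => enter [2, i]; rw [Finset.sum_comm]
      rw [Finset.sum_comm]
    rw [h2, ← Finset.sum_add_distrib]
    refine Finset.sum_eq_zero fun r _ => ?_
    rw [← Finset.sum_add_distrib]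
    refine Finset.sum_eq_zero fun p _ => ?_
    rw [← add_smul, hρ, zero_smul]
  simp only [quad, map_sum, map_smul, map_mul, comulHom_ι, mulRightHom_ι, add_mul, mul_add,
    smul_add, Finset.sum_add_distrib]
  refine LinearMap.ext fun z => ?_
  have e := LinearMap.congr_fun hcross z
  simp only [LinearMap.add_apply, LinearMap.zero_apply] at e ⊢
  rw [eq_neg_of_add_eq_zero_left e]
  abel

/-- An ideal that is generated by primitive quadratic elements and is compatible with the braiding
is contained in the defining ideal of the Nichols algebra. -/
theorem span_quad_le_nicholsIdeal {κ : Type*} {ρ : κ → Matrix ι ι k}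
    (hρ : ∀ a r p, ρ a r p + ∑ i, ∑ j, ρ a i j * braidCoeff c i j r p = 0)
    (hL : ∀ a i s, braidMatrix c (quad (ρ a)) i s ∈
      TwoSidedIdeal.span (Set.range fun a => quad (ρ a)))
    (hR : ∀ a r p, rightBraidMatrix c (quad (ρ a)) r p ∈
      TwoSidedIdeal.span (Set.range fun a => quad (ρ a))) :
    TwoSidedIdeal.span (Set.range fun a => quad (ρ a)) ≤ nicholsIdeal c := by
  set J := TwoSidedIdeal.span (Set.range fun a => quad (ρ a)) with hJ
  -- An algebra map to matrices sends the ideal into matrices over the ideal as soon as it does so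
  -- on generators. This serves for both directions of the braiding.
  have hmat : ∀ f : FreeAlgebra k ι →ₐ[k] Matrix ι ι (FreeAlgebra k ι),
      (∀ a r p, f (quad (ρ a)) r p ∈ J) → ∀ a ∈ J, ∀ r p, f a r p ∈ J := by
    intro f hf a ha r p
    have ha' := mem_idealSubmodule.2 ha
    rw [hJ, idealSubmodule_span] at ha'
    induction ha' using Submodule.span_induction with
    | mem x hx =>
      obtain ⟨u, v, _, ⟨b, rfl⟩, rfl⟩ := hx
      rw [map_mul, map_mul, Matrix.mul_apply]
      refine sum_mem fun x _ => J.mul_mem_right _ _ ?_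
      rw [Matrix.mul_apply]
      exact sum_mem fun y _ => J.mul_mem_left _ _ (hf b y x)
    | zero => rw [map_zero]; exact J.zero_mem
    | add x y hx hy ihx ihy =>
      rw [← idealSubmodule_span, mem_idealSubmodule] at hx hy
      rw [map_add]
      exact J.add_mem (ihx hx) (ihy hy)
    | smul t x hx ihx =>
      rw [← idealSubmodule_span, mem_idealSubmodule] at hx
      rw [map_smul]
      exact mem_idealSubmodule.1 ((idealSubmodule J).smul_mem t (mem_idealSubmodule.2 (ihx hx)))
  refine le_sSup ⟨isHomogeneousIdeal_span ?_, ?_⟩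
  · rintro _ ⟨a, rfl⟩
    exact quad_mem_homogeneousPart _
  · rw [IsCoideal, Submodule.map_le_iff_le_comap]
    conv_lhs => rw [idealSubmodule_span]
    rw [Submodule.span_le]
    rintro _ ⟨u, v, _, ⟨b, rfl⟩, rfl⟩
    change comul c _ ∈ idealTensor J ⊔ tensorIdeal J
    rw [comul_eq_comulHom, mul_assoc, map_mul, Module.End.mul_apply]
    refine comulHom_mem (hmat _ hL) _ _ ?_
    have hb : quad (ρ b) ∈ J := TwoSidedIdeal.subset_span ⟨b, rfl⟩
    rw [map_mul, Module.End.mul_apply, comulHom_quad (hρ b), LinearMap.add_apply]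
    refine add_mem (Submodule.mem_sup_left ?_)
      (Submodule.mem_sup_right (mulRightHom_mem (hmat _ hR) hb _))
    induction comulHom c (word k v) (1 ⊗ₜ 1) with
    | zero => simp
    | tmul x y =>
      -- The remaining operator is left multiplication by `r ⊗ 1` for the relation `r`.
      have : (∑ i, ∑ j, ρ b i j • (mulLeftFactor k i * mulLeftFactor k j)) (x ⊗ₜ[k] y) =
          (quad (ρ b) * x) ⊗ₜ[k] y := by
        simp [mulLeftFactor, quad, LinearMap.sum_apply, Finset.sum_mul, TensorProduct.sum_tmul,
          TensorProduct.smul_tmul', mul_assoc]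
      rw [this]
      exact tmul_mem_idealTensor (J.mul_mem_right _ _ hb) _
    | add x y hx hy => rw [map_add]; exact add_mem hx hy

theorem span_range_le_nicholsIdeal {κ : Type*} {ρ : κ → Matrix ι ι k} {r : κ → FreeAlgebra k ι}
    (hr : ∀ a, quad (ρ a) = r a)
    (hρ : ∀ a r p, ρ a r p + ∑ i, ∑ j, ρ a i j * braidCoeff c i j r p = 0)
    (hL : ∀ a i s, braidMatrix c (r a) i s ∈ TwoSidedIdeal.span (Set.range r))
    (hR : ∀ a i s, rightBraidMatrix c (r a) i s ∈ TwoSidedIdeal.span (Set.range r)) :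
    TwoSidedIdeal.span (Set.range r) ≤ nicholsIdeal c := by
  obtain rfl : (fun a => quad (ρ a)) = r := funext hr
  exact span_quad_le_nicholsIdeal hρ hL hR

end Quadratic

/-! ### Linear independence via lowering operators and via filtrations. -/

section LinearAlgebra

variable {k : Type*} [Field k] {M κ : Type*} [AddCommGroup M] [Module k M]

/-- A family that is lowered by an operator is linearly independent if its lowest part is. -/
theorem linearIndependent_of_lowering (D : Module.End k M) (y : ℕ → κ → M)
    (h0 : ∀ x, D (y 0 x) = 0) (hs : ∀ e x, ∃ t : k, t ≠ 0 ∧ D (y (e + 1) x) = t • y e x)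
    (hy : LinearIndependent k (y 0)) : LinearIndependent k fun p : ℕ × κ => y p.1 p.2 := by
  have hlt : ∀ N e x, e < N → (D ^ N) (y e x) = 0 := by
    intro N
    induction N with
    | zero => intro e x h; omega
    | succ N ih =>
      intro e x h
      rw [pow_succ, Module.End.mul_apply]
      cases e with
      | zero => rw [h0, map_zero]
      | succ e =>
        obtain ⟨t, -, ht⟩ := hs e x
        rw [ht, map_smul, ih e x (by omega), smul_zero]
  have heq : ∀ N x, ∃ t : k, t ≠ 0 ∧ (D ^ N) (y N x) = t • y 0 x := by
    intro N
    induction N with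
    | zero => intro x; exact ⟨1, one_ne_zero, by simp⟩
    | succ N ih =>
      intro x
      obtain ⟨t, ht0, ht⟩ := hs N x
      obtain ⟨t', ht0', ht'⟩ := ih x
      refine ⟨t * t', mul_ne_zero ht0 ht0', ?_⟩
      rw [pow_succ, Module.End.mul_apply, ht, map_smul, ht', smul_smul]
  choose t ht0 ht using heq
  classical
  rw [linearIndependent_iff']
  intro s g hg
  by_contra! hne
  obtain ⟨p, hp⟩ := hne
  have hsne : (s.filter fun p => g p ≠ 0).Nonempty := ⟨p, by simpa using hp⟩
  -- Take the largest level `m.1` that occurs with a nonzero coefficient. The power `D ^ m.1` kills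
  -- all lower levels and sends level `m.1` to nonzero multiples of the lowest part.
  obtain ⟨m, hm, hmax⟩ := Finset.exists_max_image _ Prod.fst hsne
  rw [Finset.mem_filter] at hm
  have hD := congrArg (D ^ m.1) hg
  rw [map_zero, map_sum] at hD
  have hterm : ∀ p ∈ s, (D ^ m.1) (g p • y p.1 p.2) =
      if p.1 = m.1 then (g p * t m.1 p.2) • y 0 p.2 else 0 := by
    intro p hp
    rw [map_smul]
    rcases eq_or_ne (g p) 0 with h | h
    · simp [h]
    · have hle := hmax p (by simp [hp, h])
      split_ifs with he
      · rw [he, ht, smul_smul]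
      · rw [hlt _ _ _ (lt_of_le_of_ne hle he), smul_zero]
  rw [Finset.sum_congr rfl hterm, ← Finset.sum_filter] at hD
  have hinj : Set.InjOn Prod.snd (s.filter fun p => p.1 = m.1 : Set (ℕ × κ)) := by
    intro a ha b hb hab
    simp only [Set.mem_ofPred_eq, Finset.coe_filter] at ha hb
    exact Prod.ext (ha.2.trans hb.2.symm) hab
  have hsum : ∑ x ∈ (s.filter fun p => p.1 = m.1).image Prod.snd,
      (g (m.1, x) * t m.1 x) • y 0 x = 0 := by
    rw [Finset.sum_image (by simpa using hinj), ← hD]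
    refine Finset.sum_congr rfl fun p hp => ?_
    rw [Finset.mem_filter] at hp
    rw [show (m.1, p.2) = p from Prod.ext hp.2.symm rfl]
  have := linearIndependent_iff'.1 hy _ _ hsum m.2
    (Finset.mem_image.2 ⟨m, by simp [hm.1], rfl⟩)
  exact mul_ne_zero hm.2 (ht0 _ _) this

/-- The version of `linearIndependent_of_lowering` modulo a subspace. -/
theorem linearIndependent_mkQ_of_lowering {W : Submodule k M} (D : Module.End k M)
    (hD : W ≤ W.comap D) (y : ℕ → κ → M) (h0 : ∀ x, D (y 0 x) ∈ W)
    (hs : ∀ e x, ∃ t : k, t ≠ 0 ∧ D (y (e + 1) x) - t • y e x ∈ W)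
    (hy : LinearIndependent k fun x => W.mkQ (y 0 x)) :
    LinearIndependent k fun p : ℕ × κ => W.mkQ (y p.1 p.2) := by
  refine linearIndependent_of_lowering (W.mapQ W D hD) (fun e x => W.mkQ (y e x)) ?_ ?_ hy
  · intro x
    simpa using h0 x
  · intro e x
    obtain ⟨t, ht, h⟩ := hs e x
    refine ⟨t, ht, ?_⟩
    rw [← map_smul]
    exact (Submodule.Quotient.eq W).2 h

/-- Let `y` and `w` be families indexed by a set that is filtered by finite sets. If `y` is linearly
independent and lies in the span of `w`, compatibly with the filtrations, then also `w` is linearly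
independent. -/
theorem linearIndependent_of_filtered_span {y w : κ → M} (deg : κ → ℕ)
    (hfin : ∀ m, {x | deg x ≤ m}.Finite) (hy : LinearIndependent k y)
    (hyw : ∀ x, y x ∈ Submodule.span k (w '' {x' | deg x' ≤ deg x})) : LinearIndependent k w := by
  have key : ∀ m, LinearIndependent k fun x : {x | deg x ≤ m} => w x := by
    intro m
    have := (hfin m).fintype
    rw [linearIndependent_iff_card_le_finrank_span]
    -- The elements `y x` of degree at most `m` are independent and lie in the span of equally many
    -- elements `w x`, so this span has full dimension.
    have hym : LinearIndependent k fun x : {x | deg x ≤ m} => y x :=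
      hy.comp _ Subtype.val_injective
    rw [← finrank_span_eq_card hym, Set.finrank]
    have : FiniteDimensional k (Submodule.span k (Set.range fun x : {x | deg x ≤ m} => w x)) :=
      FiniteDimensional.span_of_finite k (Set.finite_range _)
    refine Submodule.finrank_mono (Submodule.span_le.2 ?_)
    rintro _ ⟨x, rfl⟩
    refine Submodule.span_mono ?_ (hyw x)
    rintro _ ⟨x', hx', rfl⟩
    exact ⟨⟨x', le_trans (show deg x' ≤ deg x from hx') x.2⟩, rfl⟩
  rw [linearIndependent_iff']
  intro s g hg x hx
  have hsub : ∀ x ∈ s, x ∈ {x | deg x ≤ s.sup deg} := fun x hx => Finset.le_sup (f := deg) hx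
  classical
  refine linearIndependent_iff'.1 (key (s.sup deg)) (s.subtype (· ∈ {x | deg x ≤ s.sup deg}))
    (fun x => g x) ?_ ⟨x, hsub x hx⟩ (by simpa using hx)
  rw [Finset.sum_subtype_of_mem (fun x => g x • w x) hsub, hg]

theorem mem_span_sup_of_subset {s t : Set M} {W W' : Submodule k M} (hst : s ⊆ t) (hW : W ≤ W')
    {a : M} (ha : a ∈ Submodule.span k s ⊔ W) : a ∈ Submodule.span k t ⊔ W' :=
  (sup_le_sup (Submodule.span_mono hst) hW) ha

theorem eq_zero_of_mem_span_of_mem {W : Submodule k M} {y : κ → M}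
    (hind : LinearIndependent k fun e => W.mkQ (y e)) {a : M}
    (ha : a ∈ Submodule.span k (Set.range y)) (haW : a ∈ W) : a = 0 := by
  obtain ⟨f, rfl⟩ := Finsupp.mem_span_range_iff_exists_finsupp.1 ha
  have h0 : W.mkQ (f.sum fun e r => r • y e) = 0 := by simpa using haW
  have hf : f = 0 := by
    refine linearIndependent_iff.1 hind f ?_
    rw [← h0, Finsupp.linearCombination_apply, map_finsuppSum]
    simp
  simp [hf]

end LinearAlgebra

/-! ### Reduction of words to normal words, and its consequences for the quotient. -/

section Rewriting

variable {k : Type*} [Field k] {ι : Type*} [LinearOrder ι]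

/-- Equal lengths exclude the case that `u` is a proper beginning of `v`, where the appended word
`b` could reverse the order. -/
theorem append_lt_append {u v : List ι} (h : u < v) (hl : u.length = v.length) (a b : List ι) :
    a ++ u ++ b < a ++ v ++ b := by
  rw [List.append_assoc, List.append_assoc]
  apply List.append_left_lt
  induction u generalizing v with
  | nil => cases v with
    | nil => exact absurd h (lt_irrefl _)
    | cons y v => simp at hl
  | cons x u ih => cases v with
    | nil => simp at hl
    | cons y v =>
      rw [List.cons_append, List.cons_append]
      rw [List.cons_lt_cons_iff] at h ⊢
      rcases h with h | ⟨rfl, h⟩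
      · exact Or.inl h
      · exact Or.inr ⟨rfl, ih h (by simpa using hl)⟩

/-- The span of the words of the same length as `u` that are lexicographically bigger. -/
def biggerSpan (k : Type*) [Field k] {ι : Type*} [LinearOrder ι] (u : List ι) :
    Submodule k (FreeAlgebra k ι) :=
  Submodule.span k {a | ∃ v : List ι, v.length = u.length ∧ u < v ∧ a = word k v}

theorem word_mem_biggerSpan {u v : List ι} (hl : v.length = u.length) (h : u < v) :
    word k v ∈ biggerSpan k u :=
  Submodule.subset_span ⟨v, hl, h, rfl⟩

theorem word_append_mem_biggerSpan_sup {J : TwoSidedIdeal (FreeAlgebra k ι)} {u : List ι}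
    (h : word k u ∈ biggerSpan k u ⊔ idealSubmodule J) (a b : List ι) :
    word k (a ++ u ++ b) ∈ biggerSpan k (a ++ u ++ b) ⊔ idealSubmodule J := by
  let f : FreeAlgebra k ι →ₗ[k] FreeAlgebra k ι :=
    (LinearMap.mulRight k (word k b)).comp (LinearMap.mulLeft k (word k a))
  have hf : ∀ v, f (word k v) = word k (a ++ v ++ b) := fun v => by simp [f, word_append, mul_assoc]
  rw [← hf]
  suffices h' : biggerSpan k u ⊔ idealSubmodule J ≤
    (biggerSpan k (a ++ u ++ b) ⊔ idealSubmodule J).comap f from h' h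
  refine sup_le ?_ fun x hx => Submodule.mem_sup_right (mem_idealSubmodule.2 ?_)
  · rw [biggerSpan, Submodule.span_le]
    rintro _ ⟨v, hl, hv, rfl⟩
    refine Submodule.mem_sup_left ?_
    rw [hf]
    exact word_mem_biggerSpan (by simp [hl]) (append_lt_append hv hl.symm a b)
  · exact J.mul_mem_right _ _ (J.mul_mem_left _ _ (mem_idealSubmodule.1 hx))

/-- Reduction terminates because there are only finitely many words of length `m` and each step
produces larger ones: the induction is on the number of larger words. -/
theorem word_mem_span_normal_sup [Finite ι] {W : Submodule k (FreeAlgebra k ι)}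
    {S : Set (List ι)} {m : ℕ}
    (hred : ∀ u : List ι, u.length = m → u ∉ S → word k u ∈ biggerSpan k u ⊔ W) (u : List ι)
    (hu : u.length = m) :
    word k u ∈ Submodule.span k {a | ∃ v ∈ S, v.length = m ∧ u ≤ v ∧ a = word k v} ⊔ W := by
  have hfin : ∀ u : List ι, {v : List ι | v.length = m ∧ u < v}.Finite := fun u =>
    (List.finite_length_eq ι m).subset fun v hv => hv.1
  induction hn : {v : List ι | v.length = m ∧ u < v}.ncard using Nat.strong_induction_on
    generalizing u with
  | _ n ih =>
    by_cases hS : u ∈ S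
    · exact Submodule.mem_sup_left (Submodule.subset_span ⟨u, hS, hu, le_rfl, rfl⟩)
    · refine (sup_le ?_ le_sup_right : biggerSpan k u ⊔ W ≤ _) (hred u hu hS)
      rw [biggerSpan, Submodule.span_le]
      rintro _ ⟨v, hvl, huv, rfl⟩
      have hlt : {w : List ι | w.length = m ∧ v < w}.ncard < n := by
        rw [← hn]
        refine Set.ncard_lt_ncard ⟨fun w hw => ⟨hw.1, huv.trans hw.2⟩, fun h => ?_⟩ (hfin u)
        exact lt_irrefl v (h (show v ∈ {w : List ι | w.length = m ∧ u < w} from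
          ⟨hvl.trans hu, huv⟩)).2
      refine mem_span_sup_of_subset ?_ le_rfl (ih _ hlt v (hvl.trans hu) rfl)
      rintro _ ⟨w, hwS, hwl, hvw, rfl⟩
      exact ⟨w, hwS, hwl, huv.le.trans hvw, rfl⟩

variable {κ : Type*} {nf : κ → List ι} {I : TwoSidedIdeal (FreeAlgebra k ι)}

/-- The data from which the structure of the quotient of the free algebra by an ideal `I` is read
off: quadratic relations `R` in `I` that reduce all words to the words `nf e`, which are linearly
independent modulo `I`. -/
structure IsPresentation (I : TwoSidedIdeal (FreeAlgebra k ι)) (R : Set (FreeAlgebra k ι))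
    (nf : κ → List ι) : Prop where
  rel_mem : ∀ r ∈ R, r ∈ I
  rel_homogeneous : ∀ r ∈ R, r ∈ homogeneousPart k ι 2
  reduce : ∀ u ∉ Set.range nf,
    word k u ∈ biggerSpan k u ⊔ idealSubmodule (TwoSidedIdeal.span R)
  reduce_two : ∀ u : List ι, u.length = 2 → u ∉ Set.range nf →
    word k u ∈ biggerSpan k u ⊔ Submodule.span k R
  linearIndependent : LinearIndependent k fun e => (idealSubmodule I).mkQ (word k (nf e))

namespace IsPresentation

variable {R : Set (FreeAlgebra k ι)}

theorem word_mem_span_sup [Finite ι] (h : IsPresentation I R nf) (u : List ι) :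
    word k u ∈ Submodule.span k {a | ∃ e, (nf e).length = u.length ∧ u ≤ nf e ∧ a = word k (nf e)} ⊔
      idealSubmodule (TwoSidedIdeal.span R) := by
  refine mem_span_sup_of_subset ?_ le_rfl
    (word_mem_span_normal_sup (fun u _ => h.reduce u) u rfl)
  rintro _ ⟨_, ⟨e, rfl⟩, hl, hu, rfl⟩
  exact ⟨e, hl, hu, rfl⟩

theorem top_le [Finite ι] (h : IsPresentation I R nf) :
    ⊤ ≤ Submodule.span k (Set.range fun e => word k (nf e)) ⊔
      idealSubmodule (TwoSidedIdeal.span R) := by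
  rw [← span_word, Submodule.span_le]
  rintro _ ⟨u, rfl⟩
  refine mem_span_sup_of_subset ?_ le_rfl (h.word_mem_span_sup u)
  rintro _ ⟨e, -, -, rfl⟩
  exact ⟨e, rfl⟩

theorem span_le (h : IsPresentation I R nf) : TwoSidedIdeal.span R ≤ I :=
  TwoSidedIdeal.span_le.2 h.rel_mem

/-- By reduction, an element of `I` is a normal combination plus an element of the ideal generated
by `R`. The normal combination then also lies in `I`, and independence makes it zero. -/
theorem eq_span [Finite ι] (h : IsPresentation I R nf) : I = TwoSidedIdeal.span R := by
  refine le_antisymm (TwoSidedIdeal.le_iff.2 fun a ha => ?_) h.span_le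
  obtain ⟨n, hn, j, hj, rfl⟩ := Submodule.mem_sup.1 (h.top_le (Submodule.mem_top (x := a)))
  have hnI : n ∈ idealSubmodule I := by
    have := sub_mem (mem_idealSubmodule.2 ha) (idealSubmodule_mono h.span_le hj)
    rwa [add_sub_cancel_right] at this
  rw [eq_zero_of_mem_span_of_mem h.linearIndependent hn hnI, zero_add]
  exact mem_idealSubmodule.1 hj

theorem isQuadratic [Finite ι] (h : IsPresentation I R nf) : IsQuadratic I := by
  refine le_antisymm ?_ (TwoSidedIdeal.span_le.2 fun a ha => ha.1)
  conv_lhs => rw [h.eq_span]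
  exact TwoSidedIdeal.span_mono fun r hr => ⟨h.rel_mem r hr, h.rel_homogeneous r hr⟩

/-- The argument of `eq_span` in degree two. Reduction has to use the span of `R` itself here and
not the ideal; this is what `reduce_two` provides. -/
theorem quadraticRelations_eq [Finite ι] (h : IsPresentation I R nf) :
    quadraticRelations I = Submodule.span k R := by
  have hR : Submodule.span k R ≤ quadraticRelations I := Submodule.span_le.2 fun r hr =>
    ⟨mem_idealSubmodule.2 (h.rel_mem r hr), h.rel_homogeneous r hr⟩
  refine le_antisymm (fun a ha => ?_) hR
  have hle : homogeneousPart k ι 2 ≤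
      Submodule.span k (Set.range fun e => word k (nf e)) ⊔ Submodule.span k R := by
    rw [homogeneousPart, Submodule.span_le]
    rintro _ ⟨u, hu, rfl⟩
    refine mem_span_sup_of_subset ?_ le_rfl
      (word_mem_span_normal_sup h.reduce_two u hu)
    rintro _ ⟨_, ⟨e, rfl⟩, -, -, rfl⟩
    exact ⟨e, rfl⟩
  obtain ⟨n, hn, r, hr, rfl⟩ := Submodule.mem_sup.1 (hle ha.2)
  have hnI : n ∈ idealSubmodule I := by
    have := sub_mem ha.1 (hR hr).1
    rwa [add_sub_cancel_right] at this
  rwa [eq_zero_of_mem_span_of_mem h.linearIndependent hn hnI, zero_add]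

theorem not_isReducible [Finite ι] (h : IsPresentation I R nf) (e : κ) :
    ¬ IsReducible I (nf e) := by
  intro hr
  let S : Set κ := {e' | StdLT (nf e) (nf e')}
  have hle : Submodule.span k {a | ∃ v : List ι, StdLT (nf e) v ∧ a = word k v} ⊔
      idealSubmodule I ≤
      (Submodule.span k ((fun e => (idealSubmodule I).mkQ (word k (nf e))) '' S)).comap
        (idealSubmodule I).mkQ := by
    have hI : idealSubmodule I ≤
        (Submodule.span k ((fun e => (idealSubmodule I).mkQ (word k (nf e))) '' S)).comap
          (idealSubmodule I).mkQ := fun a ha => by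
      rw [Submodule.mem_comap, Submodule.mkQ_apply, (Submodule.Quotient.mk_eq_zero _).2 ha]
      exact zero_mem _
    refine sup_le ?_ hI
    rw [Submodule.span_le]
    rintro _ ⟨v, hv, rfl⟩
    -- A word bigger than `nf e` reduces to normal words that have its length and are at least as
    -- large, hence again bigger than `nf e`. So a reduction of `nf e` would be a linear relation
    -- among distinct normal words.
    refine (sup_le ?_ ((idealSubmodule_mono h.span_le).trans hI) : _ ≤ _) (h.word_mem_span_sup v)
    rw [Submodule.span_le]
    rintro _ ⟨e', hl, hle, rfl⟩
    refine Submodule.subset_span ⟨e', ?_, rfl⟩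
    rcases hv with hv | ⟨hv, hlt⟩
    · exact Or.inl (hl.trans_lt hv)
    · exact Or.inr ⟨hl.trans hv, hlt.trans_le hle⟩
  refine h.linearIndependent.notMem_span_image (s := S) (x := e) ?_ (hle hr)
  rintro (hlt | ⟨-, hlt⟩)
  · exact lt_irrefl _ hlt
  · exact lt_irrefl _ hlt

theorem isReducible_iff [Finite ι] (h : IsPresentation I R nf) (u : List ι) :
    IsReducible I u ↔ u ∉ Set.range nf := by
  refine ⟨?_, fun hu => ?_⟩
  · rintro hr ⟨e, rfl⟩
    exact h.not_isReducible e hr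
  · refine mem_span_sup_of_subset ?_ (idealSubmodule_mono h.span_le)
      (h.reduce u hu)
    rintro _ ⟨v, hl, hv, rfl⟩
    exact ⟨v, Or.inr ⟨hl, hv⟩, rfl⟩

theorem pbwHeight_eq_top [Finite ι] (h : IsPresentation I R nf) {u : List ι}
    (hu : ∀ m, (List.replicate m u).flatten ∈ Set.range nf) : pbwHeight I u = ⊤ := by
  rw [pbwHeight, sInf_eq_top]
  rintro _ ⟨m, -, hm⟩
  exact absurd (hu m) ((h.isReducible_iff _).1 hm)

theorem isBasisFamily [Finite ι] (h : IsPresentation I R nf) :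
    IsBasisFamily k fun e => RingCon.mkₐ k I.ringCon (word k (nf e)) := by
  let π : FreeAlgebra k ι →ₗ[k] I.ringCon.Quotient := (RingCon.mkₐ k I.ringCon).toLinearMap
  have hker : ∀ a, π a = 0 ↔ a ∈ idealSubmodule I := fun a => by
    rw [mem_idealSubmodule, TwoSidedIdeal.mem_iff]
    exact RingCon.eq _
  have hsurj : Function.Surjective π := fun a => Quotient.inductionOn' a fun b => ⟨b, rfl⟩
  constructor
  · rw [linearIndependent_iff]
    intro f hf
    refine linearIndependent_iff.1 h.linearIndependent f ?_
    have e1 : π (Finsupp.linearCombination k (fun e => word k (nf e)) f) = 0 := by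
      rw [← hf, Finsupp.apply_linearCombination]
      rfl
    have e2 := (Submodule.Quotient.mk_eq_zero _).2 ((hker _).1 e1)
    rw [← Submodule.mkQ_apply, Finsupp.apply_linearCombination] at e2
    exact e2
  · rw [eq_top_iff]
    intro a _
    obtain ⟨b, rfl⟩ := hsurj a
    obtain ⟨n, hn, j, hj, rfl⟩ := Submodule.mem_sup.1 (h.top_le (Submodule.mem_top (x := b)))
    rw [map_add, (hker j).2 (idealSubmodule_mono h.span_le hj), add_zero]
    have := Submodule.mem_map_of_mem (f := π) hn
    rw [Submodule.map_span, ← Set.range_comp] at this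
    exact this

end IsPresentation

end Rewriting

/-! ### Structure constants of the braiding and triangularity of the skew derivations. -/

section Coefficients

variable (q : ℂ) (n : ℕ)

/-- The coefficient of `x_{i-m}` in `E^m x_i`. -/
def powECoeff (i m : ℕ) : ℂ :=
  ∏ l ∈ Finset.range m, qInt q ((i : ℤ) - l) * qInt q ((n : ℤ) + 1 - i + l)

/-- The coefficient of `x_{j+m} ⊗ x_{i-m}` in `Θ (x_j ⊗ x_i)`. -/
def quasiRCoeff (i m : ℕ) : ℂ := thetaCoeff q m * powECoeff q n i m

theorem opF_pow_natVec (j m : ℕ) : (opF n ^ m) (natVec n j) = natVec n (j + m) := by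
  induction m with
  | zero => simp
  | succ m ih => rw [pow_succ', Module.End.mul_apply, ih, opF_natVec, add_assoc]

theorem opE_pow_natVec {i m : ℕ} (hi : i ≤ n) (hm : m ≤ i) :
    (opE q n ^ m) (natVec n i) = powECoeff q n i m • natVec n (i - m) := by
  induction m with
  | zero => simp [powECoeff]
  | succ m ih =>
    rw [pow_succ', Module.End.mul_apply, ih (by omega), map_smul, opE_natVec q n _ (by omega),
      smul_smul, powECoeff, powECoeff, Finset.prod_range_succ, Nat.sub_sub,
      Nat.cast_sub (by omega), show (n : ℤ) + 1 - (i - m) = n + 1 - i + m by ring]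

theorem opE_pow_natVec_of_lt {i m : ℕ} (hi : i ≤ n) (hm : i < m) :
    (opE q n ^ m) (natVec n i) = 0 := by
  obtain ⟨l, rfl⟩ := Nat.exists_eq_add_of_lt hm
  rw [show i + l + 1 = l + (1 + i) by ring, pow_add, pow_add, Module.End.mul_apply,
    Module.End.mul_apply, opE_pow_natVec q n hi le_rfl, pow_one, map_smul, Nat.sub_self,
    opE_natVec q n 0 (by omega)]
  simp [qInt_zero]

/-- Since `F` raises an index and `E` lowers one, only the term `m = r - j` of `Θ` can contribute to
`x_r ⊗ x_s`. In particular the coefficient vanishes for `r < j`. -/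
theorem braidCoeff_uqBraiding (i j r s : Fin (n + 1)) :
    braidCoeff (uqBraiding q n) i j r s =
      if (j : ℕ) ≤ r ∧ (s : ℕ) + (r - j) = i then
        weightForm q (wt n j) (wt n i) * quasiRCoeff q n i (r - j) else 0 := by
  have hbasis : (Pi.single i 1 : Fin (n + 1) → ℂ) ⊗ₜ[ℂ] (Pi.single j 1 : Fin (n + 1) → ℂ) =
      ((Pi.basisFun ℂ (Fin (n + 1))).tensorProduct (Pi.basisFun ℂ (Fin (n + 1)))) (i, j) := by
    simp
  rw [braidCoeff, hbasis, uqBraiding, Module.Basis.constr_basis]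
  simp only [map_smul, map_sum, Finsupp.smul_apply, Finsupp.finsetSum_apply, smul_eq_mul,
    Module.Basis.tensorProduct_repr_tmul_apply, Pi.basisFun_repr, opF_pow_natVec]
  have hterm : ∀ m ∈ Finset.range (n + 1),
      thetaCoeff q m * (((opE q n ^ m) (natVec n i)) s * (natVec n (j + m)) r) =
      if (j : ℕ) + m = r ∧ (s : ℕ) + m = i then quasiRCoeff q n i m else 0 := by
    intro m _
    rcases Nat.lt_or_ge i m with him | him
    · rw [opE_pow_natVec_of_lt q n (by omega) him, if_neg (by omega)]
      simp
    · rw [opE_pow_natVec q n (by omega) him, quasiRCoeff]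
      have h1 : natVec n (j + m) r = if (j : ℕ) + m = r then 1 else 0 := by
        unfold natVec
        split_ifs with ha hb hb
        · rw [Pi.single_apply, if_pos (by ext; exact hb.symm)]
        · rw [Pi.single_apply, if_neg (fun h => hb (by rw [h]))]
        · omega
        · rfl
      have h2 : natVec n (i - m) s = if (s : ℕ) + m = i then 1 else 0 := by
        unfold natVec
        rw [dif_pos (by omega), Pi.single_apply]
        refine if_congr ?_ rfl rfl
        rw [Fin.ext_iff]
        simp only
        omega
      rw [h1, Pi.smul_apply, h2, smul_eq_mul]
      split_ifs <;> simp_all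
  rw [Finset.sum_congr rfl hterm]
  by_cases h : (j : ℕ) ≤ r ∧ (s : ℕ) + (r - j) = i
  · rw [if_pos h, Finset.sum_eq_single ((r : ℕ) - j), if_pos (by omega)]
    · intro m _ hm
      rw [if_neg (by omega)]
    · intro hm
      simp only [Finset.mem_range] at hm
      omega
  · rw [if_neg h, Finset.sum_eq_zero, mul_zero]
    intro m _
    rw [if_neg (by omega)]

theorem quasiRCoeff_zero (i : ℕ) : quasiRCoeff q n i 0 = 1 := by
  simp [quasiRCoeff, powECoeff, thetaCoeff, qFactorial]

/-- On elements that are killed by the skew derivations with smaller index, a skew derivation is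
given by a diagonal braiding. -/
theorem leftDeriv_ι_mul_of_eq_zero {t : Fin (n + 1)} {a : FreeAlgebra ℂ (Fin (n + 1))}
    (ha : ∀ r < t, leftDeriv (uqBraiding q n) r a = 0) (i : Fin (n + 1)) :
    leftDeriv (uqBraiding q n) t (FreeAlgebra.ι ℂ i * a) = (if i = t then a else 0) +
      weightForm q (wt n t) (wt n i) •
        (FreeAlgebra.ι ℂ i * leftDeriv (uqBraiding q n) t a) := by
  rw [leftDeriv_ι_mul]
  congr 1
  rw [Finset.sum_eq_single i]
  · rw [Finset.sum_eq_single t]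
    · rw [braidCoeff_uqBraiding, if_pos (by omega), Nat.sub_self, quasiRCoeff_zero, mul_one]
    · intro r _ hr
      rcases lt_or_gt_of_ne hr with h | h
      · rw [ha r h, mul_zero, smul_zero]
      -- For `r > t`, no power of `F` takes `x_r` to `x_t`.
      · rw [braidCoeff_uqBraiding, if_neg (by omega), zero_smul]
    · simp
  · intro s _ hs
    refine Finset.sum_eq_zero fun r _ => ?_
    rcases lt_or_ge r t with h | h
    · rw [ha r h, mul_zero, smul_zero]
    -- If `r = t`, then only `m = 0` is possible, which would force `s = i`.
    · rw [braidCoeff_uqBraiding, if_neg (by omega), zero_smul]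
  · simp

end Coefficients

/-! ### Nonvanishing of cyclotomic factors, and explicit quantum integers and coefficients of `Θ`.
-/

section Values

variable {q : ℂ}

theorem pow_sub_one_ne_zero (hq : ∀ m : ℕ, 0 < m → q ^ m ≠ 1) {m : ℕ} (hm : 0 < m) :
    q ^ m - 1 ≠ 0 := sub_ne_zero.2 (hq m hm)

theorem sq_add_one_ne_zero (hq : ∀ m : ℕ, 0 < m → q ^ m ≠ 1) : q ^ 2 + 1 ≠ 0 := fun h =>
  pow_sub_one_ne_zero hq (m := 4) (by norm_num) (by linear_combination (q ^ 2 - 1) * h)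

theorem quartic_ne_zero (hq : ∀ m : ℕ, 0 < m → q ^ m ≠ 1) : q ^ 4 + q ^ 2 + 1 ≠ 0 := fun h =>
  pow_sub_one_ne_zero hq (m := 6) (by norm_num) (by linear_combination (q ^ 2 - 1) * h)

/-- This is the twelfth cyclotomic polynomial at `q`; it becomes a denominator when the cubic
relations for `n = 3` are derived. -/
theorem cyclotomic_twelve_ne_zero (hq : ∀ m : ℕ, 0 < m → q ^ m ≠ 1) : q ^ 4 - q ^ 2 + 1 ≠ 0 :=
  fun h => pow_sub_one_ne_zero hq (m := 12) (by norm_num)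
    (by linear_combination (q ^ 2 + 1) * (q ^ 6 - 1) * h)

theorem qInt_one (hq0 : q ≠ 0) (hq : ∀ m : ℕ, 0 < m → q ^ m ≠ 1) : qInt q 1 = 1 := by
  have := sub_inv_ne_zero hq0 (hq 2 two_pos)
  simp [qInt, this]

theorem qInt_two (hq0 : q ≠ 0) (hq : ∀ m : ℕ, 0 < m → q ^ m ≠ 1) :
    qInt q 2 = (q ^ 2 + 1) / q := by
  have := sub_inv_ne_zero hq0 (hq 2 two_pos)
  rw [qInt, div_eq_div_iff this hq0, zpow_neg, zpow_ofNat]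
  field_simp
  ring

theorem qInt_three (hq0 : q ≠ 0) (hq : ∀ m : ℕ, 0 < m → q ^ m ≠ 1) :
    qInt q 3 = (q ^ 4 + q ^ 2 + 1) / q ^ 2 := by
  have := sub_inv_ne_zero hq0 (hq 2 two_pos)
  rw [qInt, div_eq_div_iff this (pow_ne_zero 2 hq0), zpow_neg, zpow_ofNat]
  field_simp
  ring

theorem thetaCoeff_zero : thetaCoeff q 0 = 1 := by
  simp [thetaCoeff, qFactorial]

theorem thetaCoeff_one (hq0 : q ≠ 0) (hq : ∀ m : ℕ, 0 < m → q ^ m ≠ 1) :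
    thetaCoeff q 1 = -(q ^ 2 - 1) / q := by
  simp [thetaCoeff, qFactorial, qInt_one hq0 hq]
  field_simp

theorem thetaCoeff_two (hq0 : q ≠ 0) (hq : ∀ m : ℕ, 0 < m → q ^ m ≠ 1) :
    thetaCoeff q 2 = (q ^ 2 - 1) ^ 2 / (q ^ 2 * (q ^ 2 + 1)) := by
  have := sq_add_one_ne_zero hq
  norm_num [thetaCoeff, qFactorial, Finset.prod_range_succ, qInt_one hq0 hq, qInt_two hq0 hq]
  field_simp

theorem thetaCoeff_three (hq0 : q ≠ 0) (hq : ∀ m : ℕ, 0 < m → q ^ m ≠ 1) :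
    thetaCoeff q 3 =
      -(q ^ 2 - 1) ^ 3 / (q ^ 3 * (q ^ 2 + 1) * (q ^ 4 + q ^ 2 + 1)) := by
  have := sq_add_one_ne_zero hq
  have := quartic_ne_zero hq
  norm_num [thetaCoeff, qFactorial, Finset.prod_range_succ, qInt_one hq0 hq, qInt_two hq0 hq,
    qInt_three hq0 hq]
  field_simp

end Values

/-! ### The quadratic relations are primitive and span a submodule compatible with the braiding. -/

section BraidMatrices

theorem braidMatrix_uqBraiding_ι (q : ℂ) (n : ℕ) (i j s : Fin (n + 1)) :
    braidMatrix (uqBraiding q n) (FreeAlgebra.ι ℂ j) i s =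
      if h : (s : ℕ) ≤ i ∧ (j : ℕ) + (i - s) < n + 1 then
        (weightForm q (wt n j) (wt n i) * quasiRCoeff q n i (i - s)) •
          FreeAlgebra.ι ℂ (⟨j + (i - s), h.2⟩ : Fin (n + 1)) else 0 := by
  rw [braidMatrix_ι]
  split_ifs with h
  · rw [Finset.sum_eq_single ⟨j + (i - s), h.2⟩]
    · rw [braidCoeff_uqBraiding, if_pos (by simp only; omega)]
      simp only [Nat.add_sub_cancel_left]
    · intro r _ hr
      rw [braidCoeff_uqBraiding, if_neg, zero_smul]
      rw [ne_eq, Fin.ext_iff] at hr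
      simp only at hr
      omega
    · simp
  · refine Finset.sum_eq_zero fun r _ => ?_
    rw [braidCoeff_uqBraiding, if_neg, zero_smul]
    omega

theorem rightBraidMatrix_uqBraiding_ι (q : ℂ) (n : ℕ) (i r p : Fin (n + 1)) :
    rightBraidMatrix (uqBraiding q n) (FreeAlgebra.ι ℂ i) r p =
      if (p : ℕ) ≤ r ∧ (r : ℕ) - p ≤ i then
        (weightForm q (wt n p) (wt n i) * quasiRCoeff q n i (r - p)) •
          FreeAlgebra.ι ℂ (⟨i - (r - p), by omega⟩ : Fin (n + 1)) else 0 := by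
  rw [rightBraidMatrix_ι]
  split_ifs with h
  · rw [Finset.sum_eq_single ⟨i - (r - p), by omega⟩]
    · rw [braidCoeff_uqBraiding, if_pos (by simp only; omega)]
    · intro s _ hs
      rw [braidCoeff_uqBraiding, if_neg, zero_smul]
      rw [ne_eq, Fin.ext_iff] at hs
      simp only at hs
      omega
    · simp
  · refine Finset.sum_eq_zero fun s _ => ?_
    rw [braidCoeff_uqBraiding, if_neg, zero_smul]
    omega

/-- The condition `(1 + c) ρ = 0`, sorted by the right tensor factor `x_p`: the hypothesis is an
identity of linear elements, and the conclusion is its coefficient at `x_r`. In this form the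
explicit braid matrices of the letters can be inserted. -/
theorem add_sum_braidCoeff_eq_zero {k ι : Type*} [Field k] [Fintype ι] [DecidableEq ι]
    {c : ((ι → k) ⊗[k] (ι → k)) →ₗ[k] ((ι → k) ⊗[k] (ι → k))} {ρ : Matrix ι ι k} {p : ι}
    (h : ∑ i, ρ i p • FreeAlgebra.ι k i +
      ∑ i, ∑ j, ρ i j • braidMatrix c (FreeAlgebra.ι k j) i p = 0) (r : ι) :
    ρ r p + ∑ i, ∑ j, ρ i j * braidCoeff c i j r p = 0 := by
  simpa [linearCoeff_ι, linearCoeff_braidMatrix] using congrArg (linearCoeff k r) h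

variable {q : ℂ}

theorem quasiRCoeff_values1 (hq0 : q ≠ 0) (hq : ∀ m : ℕ, 0 < m → q ^ m ≠ 1) :
    quasiRCoeff q 1 1 1 = (1 - q ^ 2) / q := by
  norm_num [quasiRCoeff, powECoeff, thetaCoeff_one hq0 hq, qInt_one hq0 hq]

theorem quasiRCoeff_values2 (hq0 : q ≠ 0) (hq : ∀ m : ℕ, 0 < m → q ^ m ≠ 1) :
    quasiRCoeff q 2 1 1 = (1 - q ^ 4) / q ^ 2 ∧
    quasiRCoeff q 2 2 1 = (1 - q ^ 4) / q ^ 2 ∧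
    quasiRCoeff q 2 2 2 = (1 - q ^ 2) * (1 - q ^ 4) / q ^ 4 := by
  have := sq_add_one_ne_zero hq
  have := quartic_ne_zero hq
  refine ⟨?_, ?_, ?_⟩ <;>
  norm_num [quasiRCoeff, powECoeff, Finset.prod_range_succ, thetaCoeff_one hq0 hq,
    thetaCoeff_two hq0 hq, thetaCoeff_three hq0 hq, qInt_one hq0 hq, qInt_two hq0 hq,
    qInt_three hq0 hq] <;>
  field_simp <;> ring

theorem quasiRCoeff_values3 (hq0 : q ≠ 0) (hq : ∀ m : ℕ, 0 < m → q ^ m ≠ 1) :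
    quasiRCoeff q 3 1 1 = (1 - q ^ 6) / q ^ 3 ∧
    quasiRCoeff q 3 2 1 = (1 - q ^ 4) * (1 + q ^ 2) / q ^ 3 ∧
    quasiRCoeff q 3 2 2 = (1 - q ^ 4) * (1 - q ^ 6) / q ^ 6 ∧
    quasiRCoeff q 3 3 1 = (1 - q ^ 6) / q ^ 3 ∧
    quasiRCoeff q 3 3 2 = (1 - q ^ 4) * (1 - q ^ 6) / q ^ 6 ∧
    quasiRCoeff q 3 3 3 = (1 - q ^ 2) * (1 - q ^ 4) * (1 - q ^ 6) / q ^ 9 := by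
  have := sq_add_one_ne_zero hq
  have := quartic_ne_zero hq
  refine ⟨?_, ?_, ?_, ?_, ?_, ?_⟩ <;>
  norm_num [quasiRCoeff, powECoeff, Finset.prod_range_succ, thetaCoeff_one hq0 hq,
    thetaCoeff_two hq0 hq, thetaCoeff_three hq0 hq, qInt_one hq0 hq, qInt_two hq0 hq,
    qInt_three hq0 hq] <;>
  field_simp <;> ring

/-- The coefficient matrices of the quadratic relations of the module of dimension 2. -/
def relationMatrix1 (q : ℂ) : Fin 1 → Matrix (Fin 2) (Fin 2) ℂ :=
  ![!![0, 1; -q, 0]]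

/-- The quadratic relations of the module of dimension 2, ordered by their weights. -/
def relation1 (q : ℂ) : Fin 1 → FreeAlgebra ℂ (Fin 2) :=
  let x := FreeAlgebra.ι ℂ
  ![x 0 * x 1 - q • (x 1 * x 0)]

theorem quad_relationMatrix1 (q : ℂ) (a : Fin 1) :
    quad (relationMatrix1 q a) = relation1 q a := by
  fin_cases a
  simp [quad, relationMatrix1, relation1, Fin.sum_univ_two]
  module

theorem relationMatrix1_add (hq0 : q ≠ 0) (hq : ∀ m : ℕ, 0 < m → q ^ m ≠ 1)
    (a : Fin 1) (r p : Fin 2) :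
    relationMatrix1 q a r p +
      ∑ i, ∑ j, relationMatrix1 q a i j * braidCoeff (uqBraiding q 1) i j r p = 0 := by
  refine add_sum_braidCoeff_eq_zero ?_ r
  have g11 := quasiRCoeff_values1 hq0 hq
  fin_cases a
  fin_cases p <;>
  simp [relationMatrix1, Fin.sum_univ_two, braidMatrix_uqBraiding_ι, weightForm, wt,
    quasiRCoeff_zero, g11] <;>
  match_scalars <;> field_simp <;> ring

/-- The single relation spans a trivial submodule: `E` and `F` kill it, so only the term `m = 0` of
`Θ` remains, and the matrix is diagonal. -/
theorem braidMatrix_relation1 (hq0 : q ≠ 0) (hq : ∀ m : ℕ, 0 < m → q ^ m ≠ 1)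
    (a : Fin 1) (i s : Fin 2) :
    braidMatrix (uqBraiding q 1) (relation1 q a) i s = (if s = i then
      weightForm q (wt 1 ((a + 1) / 2 : ℕ)) (wt 1 i) *
        weightForm q (wt 1 ((a + 2) / 2 : ℕ)) (wt 1 i) *
        quasiRCoeff q 1 i (i - s)
      else 0) • relation1 q (Fin.ofNat 1 (a + (i - s))) := by
  have g11 := quasiRCoeff_values1 hq0 hq
  fin_cases a
  fin_cases i <;> fin_cases s <;>
  simp [-Fin.ofNat_eq_cast, relation1, braidMatrix_uqBraiding_ι, Matrix.mul_apply, Fin.sum_univ_two,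
    weightForm, wt, quasiRCoeff_zero, g11] <;>
  match_scalars <;> field_simp
  ring

theorem rightBraidMatrix_relation1 (hq0 : q ≠ 0) (hq : ∀ m : ℕ, 0 < m → q ^ m ≠ 1)
    (a : Fin 1) (i s : Fin 2) :
    rightBraidMatrix (uqBraiding q 1) (relation1 q a) i s = (if s = i then
      weightForm q (wt 1 s) (wt 1 ((a + 1) / 2 : ℕ)) *
        weightForm q (wt 1 s) (wt 1 ((a + 2) / 2 : ℕ)) *
        thetaCoeff q (i - s)
      else 0) • relation1 q (Fin.ofNat 1 (a - (i - s))) := by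
  have g11 := quasiRCoeff_values1 hq0 hq
  fin_cases a
  fin_cases i <;> fin_cases s <;>
  simp [-Fin.ofNat_eq_cast, relation1, rightBraidMatrix_uqBraiding_ι, Matrix.mul_apply,
    Fin.sum_univ_two,
    weightForm, wt, quasiRCoeff_zero, thetaCoeff_zero, g11] <;>
  match_scalars <;> field_simp
  ring

theorem span_relation1_le (hq0 : q ≠ 0) (hq : ∀ m : ℕ, 0 < m → q ^ m ≠ 1) :
    TwoSidedIdeal.span (Set.range (relation1 q)) ≤ nicholsIdeal (uqBraiding q 1) := by
  have h : ∀ (t : ℂ) b, t • relation1 q b ∈ TwoSidedIdeal.span (Set.range (relation1 q)) :=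
    fun t b => mem_idealSubmodule.1
      (Submodule.smul_mem _ t (mem_idealSubmodule.2 (TwoSidedIdeal.subset_span ⟨b, rfl⟩)))
  refine span_range_le_nicholsIdeal (quad_relationMatrix1 q) (relationMatrix1_add hq0 hq)
    (fun a i s => ?_) (fun a i s => ?_)
  · rw [braidMatrix_relation1 hq0 hq]
    exact h _ _
  · rw [rightBraidMatrix_relation1 hq0 hq]
    exact h _ _

/-- The coefficient matrices of the quadratic relations of the module of dimension 3. -/
def relationMatrix2 (q : ℂ) : Fin 3 → Matrix (Fin 3) (Fin 3) ℂ :=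
  ![!![0, 1, 0; -q ^ 2, 0, 0; 0, 0, 0],
    !![0, 0, 1; 0, -(q ^ 2 - 1), 0; -1, 0, 0],
    !![0, 0, 0; 0, 0, 1; 0, -q ^ 2, 0]]

/-- The quadratic relations of the module of dimension 3, ordered by their weights. -/
def relation2 (q : ℂ) : Fin 3 → FreeAlgebra ℂ (Fin 3) :=
  let x := FreeAlgebra.ι ℂ
  ![x 0 * x 1 - q ^ 2 • (x 1 * x 0),
    x 0 * x 2 - (q ^ 2 - 1) • (x 1 * x 1) - x 2 * x 0,
    x 1 * x 2 - q ^ 2 • (x 2 * x 1)]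

/-- The coefficients of the action of `F` on the quadratic relations. -/
def lowerCoeff2 : ℕ → ℂ
  | 0 => 1
  | 1 => 1
  | _ => 0

/-- The coefficients of the action of `E` on the quadratic relations. -/
def raiseCoeff2 (q : ℂ) : ℕ → ℂ
  | 1 => (q ^ 2 + 1) / q
  | 2 => (q ^ 2 + 1) / q
  | _ => 0

theorem quad_relationMatrix2 (q : ℂ) (a : Fin 3) :
    quad (relationMatrix2 q a) = relation2 q a := by
  fin_cases a <;> simp [quad, relationMatrix2, relation2, Fin.sum_univ_three] <;> module

theorem relationMatrix2_add (hq0 : q ≠ 0) (hq : ∀ m : ℕ, 0 < m → q ^ m ≠ 1)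
    (a : Fin 3) (r p : Fin 3) :
    relationMatrix2 q a r p +
      ∑ i, ∑ j, relationMatrix2 q a i j * braidCoeff (uqBraiding q 2) i j r p = 0 := by
  refine add_sum_braidCoeff_eq_zero ?_ r
  have := sq_add_one_ne_zero hq
  obtain ⟨g11, g21, g22⟩ := quasiRCoeff_values2 hq0 hq
  fin_cases a <;> fin_cases p <;>
  simp [relationMatrix2, Fin.sum_univ_three, braidMatrix_uqBraiding_ι, weightForm, wt,
    quasiRCoeff_zero, g11, g21, g22] <;>
  match_scalars <;> field_simp <;> ring

set_option maxHeartbeats 3200000 in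
-- The three relations `r_a` form a copy of `L(2)`, and the braiding takes `x_i ⊗ r_a` to a multiple
-- of the sum of the `F^m r_a ⊗ E^m x_i` with the coefficients of `Θ`; here `m = i - s`. The weight
-- factor is the product of those for two letters whose indices add up to `a + 1`; the choice of the
-- pair is immaterial because all weights of the module have the same parity. If `a + m` exceeds the
-- last index, the product contains the value `0` of `lowerCoeff2`.
theorem braidMatrix_relation2 (hq0 : q ≠ 0) (hq : ∀ m : ℕ, 0 < m → q ^ m ≠ 1)
    (a : Fin 3) (i s : Fin 3) :
    braidMatrix (uqBraiding q 2) (relation2 q a) i s = (if (s : ℕ) ≤ i then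
      weightForm q (wt 2 ((a + 1) / 2 : ℕ)) (wt 2 i) *
        weightForm q (wt 2 ((a + 2) / 2 : ℕ)) (wt 2 i) *
        quasiRCoeff q 2 i (i - s) *
        ∏ l ∈ Finset.range (i - s), lowerCoeff2 (a + l)
      else 0) • relation2 q (Fin.ofNat 3 (a + (i - s))) := by
  have := sq_add_one_ne_zero hq
  have := quartic_ne_zero hq
  obtain ⟨g11, g21, g22⟩ := quasiRCoeff_values2 hq0 hq
  have hsum : ∀ f : Fin (2 + 1) → FreeAlgebra ℂ (Fin (2 + 1)), ∑ l, f l = f 0 + f 1 + f 2 :=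
    Fin.sum_univ_three
  fin_cases a <;>
  simp only [relation2, Fin.reduceFinMk, Fin.isValue, Matrix.cons_val, map_sub, map_smul,
    map_mul, Matrix.sub_apply, Matrix.smul_apply, Matrix.mul_apply, hsum] <;>
  fin_cases i <;> fin_cases s <;>
  simp [-Fin.ofNat_eq_cast, braidMatrix_uqBraiding_ι, weightForm, wt,
    quasiRCoeff_zero, g11, g21, g22, lowerCoeff2, Finset.prod_range_succ] <;>
  match_scalars <;> field_simp <;> ring

set_option maxHeartbeats 3200000 in
-- The mirror image: `r_a ⊗ x_s` goes to a multiple of the sum of the `F^m x_s ⊗ E^m r_a`. As `F`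
-- acts on the natural basis without coefficients, `thetaCoeff` takes the place of `quasiRCoeff`.
-- The truncated subtraction is harmless: for `m > a` the product contains `raiseCoeff2 q 0 = 0`.
theorem rightBraidMatrix_relation2 (hq0 : q ≠ 0) (hq : ∀ m : ℕ, 0 < m → q ^ m ≠ 1)
    (a : Fin 3) (i s : Fin 3) :
    rightBraidMatrix (uqBraiding q 2) (relation2 q a) i s = (if (s : ℕ) ≤ i then
      weightForm q (wt 2 s) (wt 2 ((a + 1) / 2 : ℕ)) *
        weightForm q (wt 2 s) (wt 2 ((a + 2) / 2 : ℕ)) *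
        thetaCoeff q (i - s) *
        ∏ l ∈ Finset.range (i - s), raiseCoeff2 q (a - l)
      else 0) • relation2 q (Fin.ofNat 3 (a - (i - s))) := by
  have := sq_add_one_ne_zero hq
  have := quartic_ne_zero hq
  obtain ⟨g11, g21, g22⟩ := quasiRCoeff_values2 hq0 hq
  have hsum : ∀ f : Fin (2 + 1) → FreeAlgebra ℂ (Fin (2 + 1)), ∑ l, f l = f 0 + f 1 + f 2 :=
    Fin.sum_univ_three
  fin_cases a <;>
  simp only [relation2, Fin.reduceFinMk, Fin.isValue, Matrix.cons_val, map_sub, map_smul,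
    map_mul, Matrix.sub_apply, Matrix.smul_apply, Matrix.mul_apply, hsum] <;>
  fin_cases i <;> fin_cases s <;>
  simp [-Fin.ofNat_eq_cast, rightBraidMatrix_uqBraiding_ι, weightForm, wt, quasiRCoeff_zero, thetaCoeff_zero, thetaCoeff_one hq0 hq, thetaCoeff_two hq0 hq,
    g11, g21, g22, raiseCoeff2,
    Finset.prod_range_succ] <;>
  match_scalars <;> field_simp <;> ring

theorem span_relation2_le (hq0 : q ≠ 0) (hq : ∀ m : ℕ, 0 < m → q ^ m ≠ 1) :
    TwoSidedIdeal.span (Set.range (relation2 q)) ≤ nicholsIdeal (uqBraiding q 2) := by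
  have h : ∀ (t : ℂ) b, t • relation2 q b ∈ TwoSidedIdeal.span (Set.range (relation2 q)) :=
    fun t b => mem_idealSubmodule.1
      (Submodule.smul_mem _ t (mem_idealSubmodule.2 (TwoSidedIdeal.subset_span ⟨b, rfl⟩)))
  refine span_range_le_nicholsIdeal (quad_relationMatrix2 q) (relationMatrix2_add hq0 hq)
    (fun a i s => ?_) (fun a i s => ?_)
  · rw [braidMatrix_relation2 hq0 hq]
    exact h _ _
  · rw [rightBraidMatrix_relation2 hq0 hq]
    exact h _ _

/-- The coefficient matrices of the quadratic relations of the module of dimension 4. -/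
def relationMatrix3 (q : ℂ) : Fin 5 → Matrix (Fin 4) (Fin 4) ℂ :=
  ![!![0, 1, 0, 0; -q ^ 3, 0, 0, 0; 0, 0, 0, 0; 0, 0, 0, 0],
    !![0, 0, 1, 0; 0, (1 - q ^ 4) / q, 0, 0; -1, 0, 0, 0; 0, 0, 0, 0],
    !![0, 0, 0, q ^ 3; 0, 0, q ^ 2 * (q ^ 2 + 1 - q ^ 4), 0; 0, q - q ^ 3 - q ^ 5, 0, 0; -1, 0, 0,
      0],
    !![0, 0, 0, 0; 0, 0, 0, 1; 0, 0, (1 - q ^ 6) / (q * (q ^ 2 + 1)), 0; 0, -1, 0, 0],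
    !![0, 0, 0, 0; 0, 0, 0, 0; 0, 0, 0, 1; 0, 0, -q ^ 3, 0]]

/-- The quadratic relations of the module of dimension 4, ordered by their weights. -/
def relation3 (q : ℂ) : Fin 5 → FreeAlgebra ℂ (Fin 4) :=
  let x := FreeAlgebra.ι ℂ
  ![x 0 * x 1 - q ^ 3 • (x 1 * x 0),
    x 0 * x 2 + ((1 - q ^ 4) / q) • (x 1 * x 1) - x 2 * x 0,
    q ^ 3 • (x 0 * x 3) + (q ^ 2 * (q ^ 2 + 1 - q ^ 4)) • (x 1 * x 2) +
      (q - q ^ 3 - q ^ 5) • (x 2 * x 1) - x 3 * x 0,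
    x 1 * x 3 + ((1 - q ^ 6) / (q * (q ^ 2 + 1))) • (x 2 * x 2) - x 3 * x 1,
    x 2 * x 3 - q ^ 3 • (x 3 * x 2)]

/-- The coefficients of the action of `F` on the quadratic relations. -/
def lowerCoeff3 (q : ℂ) : ℕ → ℂ
  | 0 => 1
  | 1 => 1 / q ^ 3
  | 2 => q ^ 2 * (q ^ 2 + 1)
  | 3 => (q ^ 4 + 1) / (q * (q ^ 2 + 1))
  | _ => 0

/-- The coefficients of the action of `E` on the quadratic relations. -/
def raiseCoeff3 (q : ℂ) : ℕ → ℂ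
  | 1 => (q ^ 2 + 1) * (q ^ 4 + 1) / q ^ 3
  | 2 => (q ^ 2 + 1) * (q ^ 4 + q ^ 2 + 1)
  | 3 => (q ^ 4 + q ^ 2 + 1) / q ^ 5
  | 4 => (q ^ 2 + 1) ^ 2 / q ^ 2
  | _ => 0

theorem quad_relationMatrix3 (q : ℂ) (a : Fin 5) :
    quad (relationMatrix3 q a) = relation3 q a := by
  fin_cases a <;> simp [quad, relationMatrix3, relation3, Fin.sum_univ_four] <;> module

theorem relationMatrix3_add (hq0 : q ≠ 0) (hq : ∀ m : ℕ, 0 < m → q ^ m ≠ 1)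
    (a : Fin 5) (r p : Fin 4) :
    relationMatrix3 q a r p +
      ∑ i, ∑ j, relationMatrix3 q a i j * braidCoeff (uqBraiding q 3) i j r p = 0 := by
  refine add_sum_braidCoeff_eq_zero ?_ r
  have := sq_add_one_ne_zero hq
  obtain ⟨g11, g21, g22, g31, g32, g33⟩ := quasiRCoeff_values3 hq0 hq
  fin_cases a <;> fin_cases p <;>
  simp [relationMatrix3, Fin.sum_univ_four, braidMatrix_uqBraiding_ι, weightForm, wt,
    quasiRCoeff_zero, g11, g21, g22, g31, g32, g33] <;>
  match_scalars <;> field_simp <;> ring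

set_option maxHeartbeats 3200000 in
-- As for dimension 3, but the five relations form a copy of `L(4)` with a rescaled basis:
-- `lowerCoeff3 q (a - 1) * raiseCoeff3 q a` is the product `[a] [5 - a]` for `1 ≤ a ≤ 4`.
theorem braidMatrix_relation3 (hq0 : q ≠ 0) (hq : ∀ m : ℕ, 0 < m → q ^ m ≠ 1)
    (a : Fin 5) (i s : Fin 4) :
    braidMatrix (uqBraiding q 3) (relation3 q a) i s = (if (s : ℕ) ≤ i then
      weightForm q (wt 3 ((a + 1) / 2 : ℕ)) (wt 3 i) *
        weightForm q (wt 3 ((a + 2) / 2 : ℕ)) (wt 3 i) *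
        quasiRCoeff q 3 i (i - s) *
        ∏ l ∈ Finset.range (i - s), lowerCoeff3 q (a + l)
      else 0) • relation3 q (Fin.ofNat 5 (a + (i - s))) := by
  have := sq_add_one_ne_zero hq
  have := quartic_ne_zero hq
  obtain ⟨g11, g21, g22, g31, g32, g33⟩ := quasiRCoeff_values3 hq0 hq
  have hsum : ∀ f : Fin (3 + 1) → FreeAlgebra ℂ (Fin (3 + 1)), ∑ l, f l = f 0 + f 1 + f 2 + f 3 :=
    Fin.sum_univ_four
  fin_cases a <;>
  simp only [relation3, Fin.reduceFinMk, Fin.isValue, Matrix.cons_val, map_add, map_sub, map_smul,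
    map_mul, Matrix.add_apply, Matrix.sub_apply, Matrix.smul_apply, Matrix.mul_apply, hsum] <;>
  fin_cases i <;> fin_cases s <;>
  simp [-Fin.ofNat_eq_cast, braidMatrix_uqBraiding_ι, weightForm, wt,
    quasiRCoeff_zero, g11, g21, g22, g31, g32, g33, lowerCoeff3, Finset.prod_range_succ] <;>
  match_scalars <;> field_simp <;> ring

set_option maxHeartbeats 3200000 in
theorem rightBraidMatrix_relation3 (hq0 : q ≠ 0) (hq : ∀ m : ℕ, 0 < m → q ^ m ≠ 1)
    (a : Fin 5) (i s : Fin 4) :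
    rightBraidMatrix (uqBraiding q 3) (relation3 q a) i s = (if (s : ℕ) ≤ i then
      weightForm q (wt 3 s) (wt 3 ((a + 1) / 2 : ℕ)) *
        weightForm q (wt 3 s) (wt 3 ((a + 2) / 2 : ℕ)) *
        thetaCoeff q (i - s) *
        ∏ l ∈ Finset.range (i - s), raiseCoeff3 q (a - l)
      else 0) • relation3 q (Fin.ofNat 5 (a - (i - s))) := by
  have := sq_add_one_ne_zero hq
  have := quartic_ne_zero hq
  obtain ⟨g11, g21, g22, g31, g32, g33⟩ := quasiRCoeff_values3 hq0 hq
  have hsum : ∀ f : Fin (3 + 1) → FreeAlgebra ℂ (Fin (3 + 1)), ∑ l, f l = f 0 + f 1 + f 2 + f 3 :=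
    Fin.sum_univ_four
  fin_cases a <;>
  simp only [relation3, Fin.reduceFinMk, Fin.isValue, Matrix.cons_val, map_add, map_sub, map_smul,
    map_mul, Matrix.add_apply, Matrix.sub_apply, Matrix.smul_apply, Matrix.mul_apply, hsum] <;>
  fin_cases i <;> fin_cases s <;>
  simp [-Fin.ofNat_eq_cast, rightBraidMatrix_uqBraiding_ι, weightForm, wt, quasiRCoeff_zero, thetaCoeff_zero, thetaCoeff_one hq0 hq, thetaCoeff_two hq0 hq,
    thetaCoeff_three hq0 hq, g11, g21, g22, g31, g32, g33, raiseCoeff3,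
    Finset.prod_range_succ] <;>
  match_scalars <;> field_simp <;> ring

theorem span_relation3_le (hq0 : q ≠ 0) (hq : ∀ m : ℕ, 0 < m → q ^ m ≠ 1) :
    TwoSidedIdeal.span (Set.range (relation3 q)) ≤ nicholsIdeal (uqBraiding q 3) := by
  have h : ∀ (t : ℂ) b, t • relation3 q b ∈ TwoSidedIdeal.span (Set.range (relation3 q)) :=
    fun t b => mem_idealSubmodule.1
      (Submodule.smul_mem _ t (mem_idealSubmodule.2 (TwoSidedIdeal.subset_span ⟨b, rfl⟩)))
  refine span_range_le_nicholsIdeal (quad_relationMatrix3 q) (relationMatrix3_add hq0 hq)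
    (fun a i s => ?_) (fun a i s => ?_)
  · rw [braidMatrix_relation3 hq0 hq]
    exact h _ _
  · rw [rightBraidMatrix_relation3 hq0 hq]
    exact h _ _

end BraidMatrices

/-! ### Skew derivations of ordered products, and independence of ordered monomials. -/

section SkewDerivations

variable (q : ℂ) {n : ℕ}

/-- The element `a` is killed by the skew derivations with index less than `t`. -/
def KilledBelow (t : Fin (n + 1)) (a : FreeAlgebra ℂ (Fin (n + 1))) : Prop :=
  ∀ r < t, leftDeriv (uqBraiding q n) r a = 0

/-- Left multiplication by `a` commutes up to nonzero scalars with the skew derivations with index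
at most `t`. -/
def Passes (t : Fin (n + 1)) (a : FreeAlgebra ℂ (Fin (n + 1))) : Prop :=
  ∀ r ≤ t, ∃ s : ℂ, s ≠ 0 ∧ ∀ b, KilledBelow q r b →
    leftDeriv (uqBraiding q n) r (a * b) = s • (a * leftDeriv (uqBraiding q n) r b)

variable {q} {t : Fin (n + 1)} {a b : FreeAlgebra ℂ (Fin (n + 1))}

theorem killedBelow_one : KilledBelow q t (1 : FreeAlgebra ℂ (Fin (n + 1))) :=
  fun r _ => leftDeriv_one _ r

theorem KilledBelow.mono {r : Fin (n + 1)} (h : KilledBelow q t a) (hr : r ≤ t) :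
    KilledBelow q r a :=
  fun s hs => h s (hs.trans_le hr)

theorem Passes.mono {r : Fin (n + 1)} (h : Passes q t a) (hr : r ≤ t) : Passes q r a :=
  fun s hs => h s (hs.trans hr)

theorem Passes.leftDeriv_eq_zero {r : Fin (n + 1)} (h : Passes q t a) (hr : r ≤ t)
    (hk : KilledBelow q r b) (hb : leftDeriv (uqBraiding q n) r b = 0) :
    leftDeriv (uqBraiding q n) r (a * b) = 0 := by
  obtain ⟨s, -, hs⟩ := h r hr
  rw [hs b hk, hb, mul_zero, smul_zero]

theorem Passes.killedBelow_mul (h : Passes q t a) (hb : KilledBelow q t b) :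
    KilledBelow q t (a * b) :=
  fun r hr => h.leftDeriv_eq_zero hr.le (hb.mono hr.le) (hb r hr)

theorem Passes.leftDeriv_self (h : Passes q t a) : leftDeriv (uqBraiding q n) t a = 0 := by
  simpa using h.leftDeriv_eq_zero le_rfl killedBelow_one (leftDeriv_one _ t)

theorem passes_one : Passes q t (1 : FreeAlgebra ℂ (Fin (n + 1))) :=
  fun r _ => ⟨1, one_ne_zero, fun b _ => by simp⟩

theorem Passes.mul (ha : Passes q t a) (hb : Passes q t b) : Passes q t (a * b) := by
  intro r hr
  obtain ⟨s, hs0, hs⟩ := ha r hr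
  obtain ⟨s', hs0', hs'⟩ := hb r hr
  refine ⟨s * s', mul_ne_zero hs0 hs0', fun c hc => ?_⟩
  rw [mul_assoc, hs _ ((hb.mono hr).killedBelow_mul hc), hs' c hc, mul_smul_comm, smul_smul,
    mul_assoc]

theorem Passes.pow (ha : Passes q t a) (m : ℕ) : Passes q t (a ^ m) := by
  induction m with
  | zero => rw [pow_zero]; exact passes_one
  | succ m ih => rw [pow_succ]; exact ih.mul ha

theorem weightForm_ne_zero (hq0 : q ≠ 0) (a b : ℤ) : weightForm q a b ≠ 0 :=
  zpow_ne_zero _ hq0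

/-- A letter larger than `t` is not picked out by any `∂_r` with `r ≤ t`; only the weight factor of
the diagonal Leibniz rule remains. -/
theorem passes_ι (hq0 : q ≠ 0) {i : Fin (n + 1)} (hi : t < i) :
    Passes q t (FreeAlgebra.ι ℂ i) := by
  intro r hr
  refine ⟨_, weightForm_ne_zero hq0 (wt n r) (wt n i), fun b hb => ?_⟩
  rw [leftDeriv_ι_mul_of_eq_zero q n hb, if_neg (hr.trans_lt hi).ne', zero_add]

theorem killedBelow_ι_pow (hq0 : q ≠ 0) (t : Fin (n + 1)) (m : ℕ) :
    KilledBelow q t (FreeAlgebra.ι ℂ t ^ m) :=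
  fun _ hr => ((passes_ι hq0 hr).pow m).leftDeriv_self

/-- Each of the `m + 1` letters `x_t` is picked out once, and crossing the `l` letters before it
costs the factor `f^l`, where `f` is the self-braiding scalar of `x_t`. -/
theorem leftDeriv_ι_pow_mul (hq0 : q ≠ 0) (hb : KilledBelow q t b) (m : ℕ) :
    leftDeriv (uqBraiding q n) t (FreeAlgebra.ι ℂ t ^ (m + 1) * b) =
      (∑ l ∈ Finset.range (m + 1), weightForm q (wt n t) (wt n t) ^ l) •
        (FreeAlgebra.ι ℂ t ^ m * b) +
      weightForm q (wt n t) (wt n t) ^ (m + 1) •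
        (FreeAlgebra.ι ℂ t ^ (m + 1) * leftDeriv (uqBraiding q n) t b) := by
  induction m with
  | zero =>
    rw [pow_one, leftDeriv_ι_mul_of_eq_zero q n hb]
    simp
  | succ m ih =>
    have hk : KilledBelow q t (FreeAlgebra.ι ℂ t ^ (m + 1) * b) := fun r hr =>
      ((passes_ι hq0 hr).pow _).leftDeriv_eq_zero le_rfl (hb.mono hr.le) (hb r hr)
    rw [pow_succ', mul_assoc, leftDeriv_ι_mul_of_eq_zero q n hk, ih, if_pos rfl,
      geom_sum_succ (n := m + 1)]
    simp only [mul_add, mul_smul_comm, ← mul_assoc, ← pow_succ']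
    module

theorem leftDeriv_ι_pow (hq0 : q ≠ 0) (t : Fin (n + 1)) (m : ℕ) :
    leftDeriv (uqBraiding q n) t (FreeAlgebra.ι ℂ t ^ (m + 1)) =
      (∑ l ∈ Finset.range (m + 1), weightForm q (wt n t) (wt n t) ^ l) •
        FreeAlgebra.ι ℂ t ^ m := by
  simpa [leftDeriv_one] using leftDeriv_ι_pow_mul hq0 (killedBelow_one (q := q) (t := t)) m

theorem geom_sum_ne_zero_of_pow_ne_one {f : ℂ} (hf : ∀ m : ℕ, 0 < m → f ^ m ≠ 1) (m : ℕ) :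
    ∑ l ∈ Finset.range (m + 1), f ^ l ≠ 0 := by
  intro h
  have := geom_sum_mul f (m + 1)
  rw [h, zero_mul] at this
  exact hf (m + 1) m.succ_pos (sub_eq_zero.1 this.symm)

theorem zpow_pow_ne_one (hq : ∀ m : ℕ, 0 < m → q ^ m ≠ 1) {e : ℤ} (he : e ≠ 0)
    (m : ℕ) (hm : 0 < m) : (q ^ e) ^ m ≠ 1 := by
  intro h
  rw [← zpow_natCast, ← zpow_mul] at h
  rcases Int.natAbs_eq (e * m) with h' | h'
  · rw [h', zpow_natCast] at h
    exact hq _ (Int.natAbs_pos.2 (mul_ne_zero he (by omega))) h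
  · rw [h', zpow_neg, zpow_natCast, inv_eq_one] at h
    exact hq _ (Int.natAbs_pos.2 (mul_ne_zero he (by omega))) h

/-- Powers of a letter may be appended to a linearly independent family on the right, if the skew
derivation for this letter kills the family. -/
theorem linearIndependent_mul_ι_pow (hq0 : q ≠ 0) (hq : ∀ m : ℕ, 0 < m → q ^ m ≠ 1)
    (ht : -2 - wt n t * wt n t / 2 ≠ 0) {κ : Type*} {y : κ → FreeAlgebra ℂ (Fin (n + 1))}
    (hp : ∀ x, Passes q t (y x))
    (hy : LinearIndependent ℂ fun x => (idealSubmodule (nicholsIdeal (uqBraiding q n))).mkQ (y x)) :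
    LinearIndependent ℂ fun p : ℕ × κ =>
      (idealSubmodule (nicholsIdeal (uqBraiding q n))).mkQ (y p.2 * FreeAlgebra.ι ℂ t ^ p.1) := by
  refine linearIndependent_mkQ_of_lowering (leftDeriv (uqBraiding q n) t)
    (leftDeriv_mem_nicholsIdeal _ t) (fun e x => y x * FreeAlgebra.ι ℂ t ^ e) ?_ ?_ (by simpa)
  · intro x
    rw [pow_zero, mul_one, (hp x).leftDeriv_self]
    exact zero_mem _
  · intro e x
    obtain ⟨s, hs0, hs⟩ := hp x t le_rfl
    -- The scalar is a geometric sum in a power of `q` whose exponent is nonzero by `ht`, so it does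
    -- not vanish.
    refine ⟨s * _, mul_ne_zero hs0 (geom_sum_ne_zero_of_pow_ne_one
      (zpow_pow_ne_one hq ht) e), ?_⟩
    rw [hs _ (killedBelow_ι_pow hq0 t _), leftDeriv_ι_pow hq0, mul_smul_comm, smul_smul, weightForm,
      sub_self]
    exact zero_mem _

theorem linearIndependent_one_mkQ :
    LinearIndependent ℂ fun _ : Unit => (idealSubmodule (nicholsIdeal (uqBraiding q n))).mkQ 1 := by
  rw [linearIndependent_unique_iff]
  rw [Submodule.mkQ_apply, ne_eq, Submodule.Quotient.mk_eq_zero]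
  exact one_notMem_nicholsIdeal _

end SkewDerivations

/-! ### Normal words described by forbidden factors, and Lyndon words. -/

section Words

variable {k : Type*} [Field k] {ι : Type*}

theorem word_replicate (m : ℕ) (i : ι) :
    word k (List.replicate m i) = FreeAlgebra.ι k i ^ m := by
  simp [word]

theorem word_flatten_replicate (m : ℕ) (u : List ι) :
    word k (List.replicate m u).flatten = word k u ^ m := by
  induction m with
  | zero => simp [word_nil]
  | succ m ih => rw [List.replicate_succ, List.flatten_cons, word_append, ih, pow_succ']

variable [LinearOrder ι]

theorem mem_biggerSpan_sup_of_eq {W : Submodule k (FreeAlgebra k ι)} {u : List ι}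
    {a b : FreeAlgebra k ι} (ha : a ∈ biggerSpan k u) (hb : b ∈ W) (h : word k u = a + b) :
    word k u ∈ biggerSpan k u ⊔ W :=
  h ▸ Submodule.add_mem_sup ha hb

variable {κ : Type*} {nf : κ → List ι} {I : TwoSidedIdeal (FreeAlgebra k ι)}
  {R : Set (FreeAlgebra k ι)}

theorem word_mem_biggerSpan_sup_of_infix {J : TwoSidedIdeal (FreeAlgebra k ι)} {u b : List ι}
    (hb : word k b ∈ biggerSpan k b ⊔ idealSubmodule J) (h : b <:+: u) :
    word k u ∈ biggerSpan k u ⊔ idealSubmodule J := by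
  obtain ⟨v, w, rfl⟩ := h
  exact word_append_mem_biggerSpan_sup hb v w

/-- Reduction is compatible with multiplication from both sides, so it suffices to reduce the
forbidden factors. A non-normal word of length two is itself forbidden, since forbidden words have
length at least two. -/
theorem IsPresentation.of_infix (B : Set (List ι)) (hRI : ∀ r ∈ R, r ∈ I)
    (hR : ∀ r ∈ R, r ∈ homogeneousPart k ι 2)
    (hB : ∀ b ∈ B, 2 ≤ b.length ∧ word k b ∈ biggerSpan k b ⊔ idealSubmodule (TwoSidedIdeal.span R))
    (hB2 : ∀ b ∈ B, b.length = 2 → word k b ∈ biggerSpan k b ⊔ Submodule.span k R)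
    (hnf : ∀ u, u ∈ Set.range nf ∨ ∃ b ∈ B, b <:+: u)
    (hind : LinearIndependent k fun e => (idealSubmodule I).mkQ (word k (nf e))) :
    IsPresentation I R nf where
  rel_mem := hRI
  rel_homogeneous := hR
  reduce u hu := by
    obtain ⟨b, hb, h⟩ := (hnf u).resolve_left hu
    exact word_mem_biggerSpan_sup_of_infix (hB b hb).2 h
  reduce_two u hl hu := by
    obtain ⟨b, hb, h⟩ := (hnf u).resolve_left hu
    have := h.eq_of_length (le_antisymm h.length_le (hl.trans_le (hB b hb).1))
    subst this
    exact hB2 b hb hl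
  linearIndependent := hind

theorem isLyndon_singleton (i : ι) : IsLyndon [i] := by
  refine ⟨by simp, fun v w hv hw h => ?_⟩
  have := congrArg List.length h
  have h1 := List.length_pos_iff.2 hv
  have h2 := List.length_pos_iff.2 hw
  simp at this
  omega

theorem IsLyndon.eq_nil {v w : List ι} (h : IsLyndon (v ++ w)) (hw : w ≠ [])
    (hle : w ≤ v ++ w) : v = [] := by
  by_contra hv
  exact hle.not_gt (h.2 v w hv hw rfl)

/-- A Lyndon word with at least two letters is smaller than its last letter, so its first letter is
smaller than the last. This excludes weakly decreasing words of length at least two. -/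
theorem IsLyndon.eq_nil_of_last {v : List ι} {j : ι} (h : IsLyndon (v ++ [j]))
    (hv : ∀ x ∈ v, j ≤ x) : v = [] := by
  refine h.eq_nil (by simp) ?_
  rcases v with _ | ⟨x, v⟩
  · exact le_rfl
  · rw [List.cons_append, ← not_lt, List.cons_lt_cons_iff]
    rintro (h | ⟨-, h⟩)
    · exact (hv x (by simp)).not_gt h
    · exact absurd h (List.not_lt_nil _)

end Words

/-! ### The modules of dimension 2 and 3. -/

section Relations

variable {q : ℂ}

theorem relation_mem_homogeneousPart {n : ℕ} {κ : Type*} {r : κ → FreeAlgebra ℂ (Fin (n + 1))}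
    {ρ : κ → Matrix (Fin (n + 1)) (Fin (n + 1)) ℂ} (h : ∀ a, quad (ρ a) = r a) :
    ∀ a ∈ Set.range r, a ∈ homogeneousPart ℂ (Fin (n + 1)) 2 := by
  rintro _ ⟨a, rfl⟩
  rw [← h]
  exact quad_mem_homogeneousPart _

theorem mem_of_span_range_le {k ι κ : Type*} [Field k] {r : κ → FreeAlgebra k ι}
    {I : TwoSidedIdeal (FreeAlgebra k ι)} (h : TwoSidedIdeal.span (Set.range r) ≤ I) :
    ∀ a ∈ Set.range r, a ∈ I :=
  fun _ ha => h (TwoSidedIdeal.subset_span ha)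

theorem span_le_idealSubmodule_span {k ι : Type*} [Field k] (R : Set (FreeAlgebra k ι)) :
    Submodule.span k R ≤ idealSubmodule (TwoSidedIdeal.span R) :=
  Submodule.span_le.2 fun _ hr => mem_idealSubmodule.2 (TwoSidedIdeal.subset_span hr)

theorem IsPresentation.pbwGenerators_eq {k ι κ : Type*} [Field k] [LinearOrder ι] [Finite ι]
    {I : TwoSidedIdeal (FreeAlgebra k ι)} {R : Set (FreeAlgebra k ι)} {nf : κ → List ι}
    (h : IsPresentation I R nf) : pbwGenerators I = {u | IsLyndon u ∧ u ∈ Set.range nf} := by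
  ext u
  simp only [pbwGenerators, Set.mem_ofPred_eq, h.isReducible_iff, not_not]

/-- The normal words of the module of dimension 2. -/
def normalWord1 (e : ℕ × ℕ) : List (Fin 2) :=
  List.replicate e.1 1 ++ List.replicate e.2 0

theorem normalWord1_or_infix (u : List (Fin 2)) :
    u ∈ Set.range normalWord1 ∨ ∃ b ∈ ({[0, 1]} : Set (List (Fin 2))), b <:+: u := by
  induction u with
  | nil => exact Or.inl ⟨(0, 0), rfl⟩
  | cons a u ih =>
    rcases ih with ⟨⟨i, j⟩, rfl⟩ | ⟨b, hb, h⟩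
    · fin_cases a
      · rcases i with _ | i
        · exact Or.inl ⟨(0, j + 1), rfl⟩
        · exact Or.inr ⟨[0, 1], rfl, [], _, rfl⟩
      · exact Or.inl ⟨(i + 1, j), rfl⟩
    · exact Or.inr ⟨b, hb, List.infix_cons h⟩

/-- The monomials are built by appending powers of smaller and smaller letters, so that the letters
already present pass the next skew derivation. -/
theorem linearIndependent_normalWord1 (hq0 : q ≠ 0) (hq : ∀ m : ℕ, 0 < m → q ^ m ≠ 1) :
    LinearIndependent ℂ fun e : ℕ × ℕ =>
      (idealSubmodule (nicholsIdeal (uqBraiding q 1))).mkQ (word ℂ (normalWord1 e)) := by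
  have h1 := linearIndependent_mul_ι_pow (t := (1 : Fin 2)) hq0 hq (by norm_num [wt])
    (fun _ : Unit => passes_one) linearIndependent_one_mkQ
  have h0 := linearIndependent_mul_ι_pow (t := (0 : Fin 2)) hq0 hq (by norm_num [wt])
    (fun p => passes_one.mul ((passes_ι hq0 (by decide)).pow _)) h1
  -- The exponents were collected with the last letter first; this restores the order of the word.
  have := h0.comp (fun e : ℕ × ℕ => (e.2, e.1, ())) fun e e' h => by
    simpa [Prod.ext_iff, and_comm] using h
  simpa [Function.comp_def, normalWord1, word_append, word_replicate] using this

theorem isPresentation1 (hq0 : q ≠ 0) (hq : ∀ m : ℕ, 0 < m → q ^ m ≠ 1) :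
    IsPresentation (nicholsIdeal (uqBraiding q 1)) (Set.range (relation1 q)) normalWord1 := by
  have hB : ∀ b ∈ ({[0, 1]} : Set (List (Fin 2))),
      word ℂ b ∈ biggerSpan ℂ b ⊔ Submodule.span ℂ (Set.range (relation1 q)) := by
    rintro _ rfl
    refine mem_biggerSpan_sup_of_eq (a := q • word ℂ [1, 0]) (b := relation1 q 0)
      (Submodule.smul_mem _ _ (word_mem_biggerSpan rfl (by decide)))
      (Submodule.subset_span ⟨0, rfl⟩) ?_
    simp [word, relation1]
  refine IsPresentation.of_infix {[0, 1]} (mem_of_span_range_le (span_relation1_le hq0 hq))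
    (relation_mem_homogeneousPart (quad_relationMatrix1 q))
    (fun b hb => ⟨?_, sup_le_sup_left (span_le_idealSubmodule_span _) _ (hB b hb)⟩)
    (fun b hb _ => hB b hb) normalWord1_or_infix (linearIndependent_normalWord1 hq0 hq)
  rw [hb.out]
  simp

theorem pbwGenerators1 (hq0 : q ≠ 0) (hq : ∀ m : ℕ, 0 < m → q ^ m ≠ 1) :
    pbwGenerators (nicholsIdeal (uqBraiding q 1)) = {[0], [1]} := by
  rw [(isPresentation1 hq0 hq).pbwGenerators_eq]
  ext u
  simp only [Set.mem_ofPred_eq, Set.mem_insert_iff, Set.mem_singleton_iff]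
  constructor
  · rintro ⟨hL, ⟨i, j⟩, rfl⟩
    rcases j with _ | j
    · rcases i with _ | i
      · exact absurd rfl hL.1
      · simp only [normalWord1, List.replicate_succ', List.replicate_zero, List.append_nil] at hL ⊢
        rw [hL.eq_nil_of_last (by simp)]
        simp
    · simp only [normalWord1, List.replicate_succ', ← List.append_assoc] at hL ⊢
      rw [hL.eq_nil_of_last (by simp)]
      simp
  · rintro (rfl | rfl)
    · exact ⟨isLyndon_singleton _, (0, 1), rfl⟩
    · exact ⟨isLyndon_singleton _, (1, 0), rfl⟩

theorem pbwHeight1 (hq0 : q ≠ 0) (hq : ∀ m : ℕ, 0 < m → q ^ m ≠ 1) :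
    ∀ u ∈ pbwGenerators (nicholsIdeal (uqBraiding q 1)),
      pbwHeight (nicholsIdeal (uqBraiding q 1)) u = ⊤ := by
  rw [pbwGenerators1 hq0 hq]
  rintro _ (rfl | rfl) <;> refine (isPresentation1 hq0 hq).pbwHeight_eq_top fun m => ?_
  · exact ⟨(0, m), by simp [normalWord1]⟩
  · exact ⟨(m, 0), by simp [normalWord1]⟩

theorem range_relation1 : Set.range (relation1 q) =
    {FreeAlgebra.ι ℂ 0 * FreeAlgebra.ι ℂ 1 - q • (FreeAlgebra.ι ℂ 1 * FreeAlgebra.ι ℂ 0)} := by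
  simp [relation1, Matrix.range_cons]

theorem isBasisFamily1 (hq0 : q ≠ 0) (hq : ∀ m : ℕ, 0 < m → q ^ m ≠ 1) :
    IsBasisFamily ℂ fun e : ℕ × ℕ =>
      nicholsGen (uqBraiding q 1) 1 ^ e.1 * nicholsGen (uqBraiding q 1) 0 ^ e.2 := by
  simpa [normalWord1, word_append, word_replicate, nicholsGen] using
    (isPresentation1 hq0 hq).isBasisFamily

/-- The normal words of the module of dimension 3. -/
def normalWord2 (e : ℕ × ℕ × ℕ) : List (Fin 3) :=
  List.replicate e.1 2 ++ List.replicate e.2.1 1 ++ List.replicate e.2.2 0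

theorem normalWord2_or_infix (u : List (Fin 3)) :
    u ∈ Set.range normalWord2 ∨
      ∃ b ∈ ({[0, 1], [1, 2], [0, 2]} : Set (List (Fin 3))), b <:+: u := by
  induction u with
  | nil => exact Or.inl ⟨(0, 0, 0), rfl⟩
  | cons a u ih =>
    rcases ih with ⟨⟨i, j, l⟩, rfl⟩ | ⟨b, hb, h⟩
    · fin_cases a
      · rcases i with _ | i
        · rcases j with _ | j
          · exact Or.inl ⟨(0, 0, l + 1), rfl⟩
          · exact Or.inr ⟨[0, 1], by simp, [], _, rfl⟩
        · exact Or.inr ⟨[0, 2], by simp, [], _, rfl⟩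
      · rcases i with _ | i
        · exact Or.inl ⟨(0, j + 1, l), rfl⟩
        · exact Or.inr ⟨[1, 2], by simp, [], _, rfl⟩
      · exact Or.inl ⟨(i + 1, j, l), rfl⟩
    · exact Or.inr ⟨b, hb, List.infix_cons h⟩

theorem linearIndependent_normalWord2 (hq0 : q ≠ 0) (hq : ∀ m : ℕ, 0 < m → q ^ m ≠ 1) :
    LinearIndependent ℂ fun e : ℕ × ℕ × ℕ =>
      (idealSubmodule (nicholsIdeal (uqBraiding q 2))).mkQ (word ℂ (normalWord2 e)) := by
  have h2 := linearIndependent_mul_ι_pow (t := (2 : Fin 3)) hq0 hq (by norm_num [wt])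
    (fun _ : Unit => passes_one) linearIndependent_one_mkQ
  have h1 := linearIndependent_mul_ι_pow (t := (1 : Fin 3)) hq0 hq (by norm_num [wt])
    (fun p => passes_one.mul ((passes_ι hq0 (by decide)).pow _)) h2
  have h0 := linearIndependent_mul_ι_pow (t := (0 : Fin 3)) hq0 hq (by norm_num [wt])
    (fun p => (passes_one.mul ((passes_ι hq0 (by decide)).pow _)).mul
      ((passes_ι hq0 (by decide)).pow _)) h1
  have := h0.comp (fun e : ℕ × ℕ × ℕ => (e.2.2, e.2.1, e.1, ())) fun e e' h => by
    simp only [Prod.ext_iff] at h ⊢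
    tauto
  simpa [Function.comp_def, normalWord2, word_append, word_replicate, mul_assoc] using this

theorem isPresentation2 (hq0 : q ≠ 0) (hq : ∀ m : ℕ, 0 < m → q ^ m ≠ 1) :
    IsPresentation (nicholsIdeal (uqBraiding q 2)) (Set.range (relation2 q)) normalWord2 := by
  have hB : ∀ b ∈ ({[0, 1], [1, 2], [0, 2]} : Set (List (Fin 3))), b.length = 2 ∧
      word ℂ b ∈ biggerSpan ℂ b ⊔ Submodule.span ℂ (Set.range (relation2 q)) := by
    rintro _ (rfl | rfl | rfl) <;> refine ⟨rfl, ?_⟩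
    · refine mem_biggerSpan_sup_of_eq (a := q ^ 2 • word ℂ [1, 0]) (b := relation2 q 0)
        (Submodule.smul_mem _ _ (word_mem_biggerSpan rfl (by decide)))
        (Submodule.subset_span ⟨0, rfl⟩) ?_
      simp [word, relation2]
    · refine mem_biggerSpan_sup_of_eq (a := q ^ 2 • word ℂ [2, 1]) (b := relation2 q 2)
        (Submodule.smul_mem _ _ (word_mem_biggerSpan rfl (by decide)))
        (Submodule.subset_span ⟨2, rfl⟩) ?_
      simp [word, relation2]
    · refine mem_biggerSpan_sup_of_eq (a := (q ^ 2 - 1) • word ℂ [1, 1] + word ℂ [2, 0])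
        (b := relation2 q 1)
        (add_mem (Submodule.smul_mem _ _ (word_mem_biggerSpan rfl (by decide)))
          (word_mem_biggerSpan rfl (by decide))) (Submodule.subset_span ⟨1, rfl⟩) ?_
      simp only [word, relation2, List.map_cons, List.map_nil, List.prod_cons, List.prod_nil,
        mul_one, Matrix.cons_val_one, Matrix.cons_val_zero]
      abel
  exact IsPresentation.of_infix {[0, 1], [1, 2], [0, 2]}
    (mem_of_span_range_le (span_relation2_le hq0 hq))
    (relation_mem_homogeneousPart (quad_relationMatrix2 q))
    (fun b hb => ⟨(hB b hb).1.ge, sup_le_sup_left (span_le_idealSubmodule_span _) _ (hB b hb).2⟩)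
    (fun b hb _ => (hB b hb).2) normalWord2_or_infix (linearIndependent_normalWord2 hq0 hq)

theorem pbwGenerators2 (hq0 : q ≠ 0) (hq : ∀ m : ℕ, 0 < m → q ^ m ≠ 1) :
    pbwGenerators (nicholsIdeal (uqBraiding q 2)) = {[0], [1], [2]} := by
  rw [(isPresentation2 hq0 hq).pbwGenerators_eq]
  ext u
  simp only [Set.mem_ofPred_eq, Set.mem_insert_iff, Set.mem_singleton_iff]
  constructor
  · rintro ⟨hL, ⟨i, j, l⟩, rfl⟩
    rcases l with _ | l
    · rcases j with _ | j
      · rcases i with _ | i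
        · exact absurd rfl hL.1
        · simp only [normalWord2, List.replicate_succ', List.replicate_zero,
            List.append_nil] at hL ⊢
          rw [hL.eq_nil_of_last (by simp)]
          simp
      · simp only [normalWord2, List.replicate_succ', List.replicate_zero, List.append_nil,
          ← List.append_assoc] at hL ⊢
        rw [hL.eq_nil_of_last (by simp; grind)]
        simp
    · simp only [normalWord2, List.replicate_succ', ← List.append_assoc] at hL ⊢
      rw [hL.eq_nil_of_last (by simp)]
      simp
  · rintro (rfl | rfl | rfl)
    · exact ⟨isLyndon_singleton _, (0, 0, 1), rfl⟩
    · exact ⟨isLyndon_singleton _, (0, 1, 0), rfl⟩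
    · exact ⟨isLyndon_singleton _, (1, 0, 0), rfl⟩

theorem pbwHeight2 (hq0 : q ≠ 0) (hq : ∀ m : ℕ, 0 < m → q ^ m ≠ 1) :
    ∀ u ∈ pbwGenerators (nicholsIdeal (uqBraiding q 2)),
      pbwHeight (nicholsIdeal (uqBraiding q 2)) u = ⊤ := by
  rw [pbwGenerators2 hq0 hq]
  rintro _ (rfl | rfl | rfl) <;> refine (isPresentation2 hq0 hq).pbwHeight_eq_top fun m => ?_
  · exact ⟨(0, 0, m), by simp [normalWord2]⟩
  · exact ⟨(0, m, 0), by simp [normalWord2]⟩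
  · exact ⟨(m, 0, 0), by simp [normalWord2]⟩

theorem range_relation2 : Set.range (relation2 q) =
    {FreeAlgebra.ι ℂ 0 * FreeAlgebra.ι ℂ 1 - q ^ 2 • (FreeAlgebra.ι ℂ 1 * FreeAlgebra.ι ℂ 0),
      FreeAlgebra.ι ℂ 1 * FreeAlgebra.ι ℂ 2 - q ^ 2 • (FreeAlgebra.ι ℂ 2 * FreeAlgebra.ι ℂ 1),
      FreeAlgebra.ι ℂ 0 * FreeAlgebra.ι ℂ 2 - (q ^ 2 - 1) • (FreeAlgebra.ι ℂ 1 * FreeAlgebra.ι ℂ 1)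
        - FreeAlgebra.ι ℂ 2 * FreeAlgebra.ι ℂ 0} := by
  simp only [relation2, Matrix.range_cons, Matrix.range_empty, Set.union_empty,
    Set.singleton_union]
  rw [Set.pair_comm]

theorem isBasisFamily2 (hq0 : q ≠ 0) (hq : ∀ m : ℕ, 0 < m → q ^ m ≠ 1) :
    IsBasisFamily ℂ fun e : ℕ × ℕ × ℕ =>
      nicholsGen (uqBraiding q 2) 2 ^ e.1 * nicholsGen (uqBraiding q 2) 1 ^ e.2.1 *
        nicholsGen (uqBraiding q 2) 0 ^ e.2.2 := by
  simpa [normalWord2, word_append, word_replicate, nicholsGen, mul_assoc] using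
    (isPresentation2 hq0 hq).isBasisFamily

end Relations

/-! ### Dimension 4: the skew commutator of `x_1` and `x_2`, and independent monomials. -/

section DimensionFour

variable {q : ℂ}

/-- The element `x_1 x_2 - q x_2 x_1`, which commutes up to scalars with `x_1` and `x_2` modulo the
quadratic relations of the module of dimension 4. -/
def skewComm (q : ℂ) : FreeAlgebra ℂ (Fin 4) :=
  FreeAlgebra.ι ℂ 1 * FreeAlgebra.ι ℂ 2 - q • (FreeAlgebra.ι ℂ 2 * FreeAlgebra.ι ℂ 1)

/-- This cubic relation, with leading word `x_1 x_1 x_2`, is a consequence of the quadratic ones.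
Its indices sum to 4, and the products of a letter and a relation with this index sum are exactly
the eight that occur in `key`; their coefficients solve a linear system with denominator `p`. -/
theorem ι_one_mul_skewComm (hq0 : q ≠ 0) (hq : ∀ m : ℕ, 0 < m → q ^ m ≠ 1) :
    FreeAlgebra.ι ℂ 1 * skewComm q - q ^ 3 • (skewComm q * FreeAlgebra.ι ℂ 1) ∈
      TwoSidedIdeal.span (Set.range (relation3 q)) := by
  set J := TwoSidedIdeal.span (Set.range (relation3 q))
  have hL : ∀ (t : ℂ) i a, t • (FreeAlgebra.ι ℂ i * relation3 q a) ∈ idealSubmodule J :=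
    fun t i a => Submodule.smul_mem _ t (mem_idealSubmodule.2
      (J.mul_mem_left _ _ (TwoSidedIdeal.subset_span ⟨a, rfl⟩)))
  have hR : ∀ (t : ℂ) i a, t • (relation3 q a * FreeAlgebra.ι ℂ i) ∈ idealSubmodule J :=
    fun t i a => Submodule.smul_mem _ t (mem_idealSubmodule.2
      (J.mul_mem_right _ _ (TwoSidedIdeal.subset_span ⟨a, rfl⟩)))
  have h1 := sq_add_one_ne_zero hq
  have h2 := cyclotomic_twelve_ne_zero hq
  set p := q ^ 4 - q ^ 2 + 1 with hp
  have key : FreeAlgebra.ι ℂ 1 * skewComm q - q ^ 3 • (skewComm q * FreeAlgebra.ι ℂ 1) =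
      (-1 / (q * p)) • (FreeAlgebra.ι ℂ 3 * relation3 q 0) +
      (-1 / (q * p)) • (relation3 q 2 * FreeAlgebra.ι ℂ 1) +
      (q * (1 - q ^ 6) / ((q ^ 2 + 1) * p)) • (FreeAlgebra.ι ℂ 2 * relation3 q 1) +
      (q * (1 - q ^ 6) / ((q ^ 2 + 1) * p)) • (relation3 q 1 * FreeAlgebra.ι ℂ 2) +
      (q ^ 2 / p) • (FreeAlgebra.ι ℂ 1 * relation3 q 2) +
      (q ^ 2 / p) • (relation3 q 0 * FreeAlgebra.ι ℂ 3) +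
      (-q ^ 2 / p) • (FreeAlgebra.ι ℂ 0 * relation3 q 3) +
      (q ^ 2 / p) • (relation3 q 3 * FreeAlgebra.ι ℂ 0) := by
    simp only [skewComm, relation3, Matrix.cons_val, mul_add, mul_sub, add_mul, sub_mul,
      mul_smul_comm, smul_mul_assoc, mul_assoc]
    match_scalars <;> field_simp <;> rw [hp] <;> ring
  rw [← mem_idealSubmodule, key]
  exact add_mem (add_mem (add_mem (add_mem (add_mem (add_mem (add_mem (hL _ _ _) (hR _ _ _))
    (hL _ _ _)) (hR _ _ _)) (hL _ _ _)) (hR _ _ _)) (hL _ _ _)) (hR _ _ _)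

/-- The analogue for index sum 5, with leading word `x_1 x_2 x_2`. -/
theorem skewComm_mul_ι_two (hq0 : q ≠ 0) (hq : ∀ m : ℕ, 0 < m → q ^ m ≠ 1) :
    skewComm q * FreeAlgebra.ι ℂ 2 - q ^ 3 • (FreeAlgebra.ι ℂ 2 * skewComm q) ∈
      TwoSidedIdeal.span (Set.range (relation3 q)) := by
  set J := TwoSidedIdeal.span (Set.range (relation3 q))
  have hL : ∀ (t : ℂ) i a, t • (FreeAlgebra.ι ℂ i * relation3 q a) ∈ idealSubmodule J :=
    fun t i a => Submodule.smul_mem _ t (mem_idealSubmodule.2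
      (J.mul_mem_left _ _ (TwoSidedIdeal.subset_span ⟨a, rfl⟩)))
  have hR : ∀ (t : ℂ) i a, t • (relation3 q a * FreeAlgebra.ι ℂ i) ∈ idealSubmodule J :=
    fun t i a => Submodule.smul_mem _ t (mem_idealSubmodule.2
      (J.mul_mem_right _ _ (TwoSidedIdeal.subset_span ⟨a, rfl⟩)))
  have h1 := sq_add_one_ne_zero hq
  have h2 := cyclotomic_twelve_ne_zero hq
  set p := q ^ 4 - q ^ 2 + 1 with hp
  have key : skewComm q * FreeAlgebra.ι ℂ 2 - q ^ 3 • (FreeAlgebra.ι ℂ 2 * skewComm q) =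
      (q ^ 2 / p) • (FreeAlgebra.ι ℂ 3 * relation3 q 1) +
      (-q ^ 2 / p) • (relation3 q 1 * FreeAlgebra.ι ℂ 3) +
      (-1 / (q * p)) • (FreeAlgebra.ι ℂ 2 * relation3 q 2) +
      (q ^ 2 / p) • (relation3 q 2 * FreeAlgebra.ι ℂ 2) +
      ((q - q ^ 5) / p) • (FreeAlgebra.ι ℂ 1 * relation3 q 3) +
      ((q - q ^ 5) / p) • (relation3 q 3 * FreeAlgebra.ι ℂ 1) +
      (q ^ 2 / p) • (FreeAlgebra.ι ℂ 0 * relation3 q 4) +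
      (-1 / (q * p)) • (relation3 q 4 * FreeAlgebra.ι ℂ 0) := by
    simp only [skewComm, relation3, Matrix.cons_val, mul_add, mul_sub, add_mul, sub_mul,
      mul_smul_comm, smul_mul_assoc, mul_assoc]
    match_scalars <;> field_simp <;> rw [hp] <;> ring
  rw [← mem_idealSubmodule, key]
  exact add_mem (add_mem (add_mem (add_mem (add_mem (add_mem (add_mem (hL _ _ _) (hR _ _ _))
    (hL _ _ _)) (hR _ _ _)) (hL _ _ _)) (hR _ _ _)) (hL _ _ _)) (hR _ _ _)

/-- The factor `q` in `skewComm` makes it invisible to `∂_1`: one has `∂_1 (x_1 x_2) = x_2` and `∂_1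
(x_2 x_1) = q⁻¹ x_2`. -/
theorem passes_skewComm (hq0 : q ≠ 0) : Passes q (1 : Fin 4) (skewComm q) := by
  have h2 : Passes q (1 : Fin 4) (FreeAlgebra.ι ℂ 2) := passes_ι hq0 (by decide)
  have h1 : Passes q (0 : Fin 4) (FreeAlgebra.ι ℂ 1) := passes_ι hq0 (by decide)
  intro r hr
  obtain rfl | rfl : r = 0 ∨ r = 1 := by revert r; decide
  · refine ⟨weightForm q (wt 3 0) (wt 3 1) * weightForm q (wt 3 0) (wt 3 2),
      mul_ne_zero (weightForm_ne_zero hq0 _ _) (weightForm_ne_zero hq0 _ _), fun b hb => ?_⟩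
    -- There is no index below 0, so `∂_0` obeys the diagonal rule on all elements.
    have h0 : ∀ a : FreeAlgebra ℂ (Fin 4), KilledBelow q 0 a := fun a r hr => absurd hr (by simp)
    simp only [skewComm, sub_mul, smul_mul_assoc, mul_assoc, map_sub, map_smul]
    simp only [leftDeriv_ι_mul_of_eq_zero q 3 (h0 _)]
    simp
    module
  · refine ⟨weightForm q (wt 3 1) (wt 3 1) * weightForm q (wt 3 1) (wt 3 2),
      mul_ne_zero (weightForm_ne_zero hq0 _ _) (weightForm_ne_zero hq0 _ _), fun b hb => ?_⟩
    have hk1 : KilledBelow q 1 (FreeAlgebra.ι ℂ 1 * b) := fun r hr => by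
      obtain rfl : r = 0 := by revert r; decide
      exact h1.leftDeriv_eq_zero le_rfl (hb.mono (by decide)) (hb 0 hr)
    simp only [skewComm, sub_mul, smul_mul_assoc, mul_assoc, map_sub, map_smul]
    rw [leftDeriv_ι_mul_of_eq_zero q 3 (h2.killedBelow_mul hb), leftDeriv_ι_mul_of_eq_zero q 3 hk1,
      leftDeriv_ι_mul_of_eq_zero q 3 hb, leftDeriv_ι_mul_of_eq_zero q 3 hb]
    simp [weightForm, wt]
    simp only [mul_add, mul_smul_comm]
    match_scalars <;> field_simp
    ring

/-- The diagonal rule does not apply to `x_2 (x_1 b)`, because `∂_1 (x_1 b) = b` is not zero. The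
term of `Θ` with `m = 1` contributes a further multiple of `x_1 b`, and together the coefficient is
`q^3 - q^(-3)`. -/
theorem leftDeriv_two_skewComm_mul (hq0 : q ≠ 0) (hq : ∀ m : ℕ, 0 < m → q ^ m ≠ 1)
    {b : FreeAlgebra ℂ (Fin 4)} (hb : KilledBelow q 2 b) :
    leftDeriv (uqBraiding q 3) 2 (skewComm q * b) =
      (q ^ 3 - (q ^ 3)⁻¹) • (FreeAlgebra.ι ℂ 1 * b) +
      (q ^ 3)⁻¹ • (skewComm q * leftDeriv (uqBraiding q 3) 2 b) := by
  have h2 : Passes q (1 : Fin 4) (FreeAlgebra.ι ℂ 2) := passes_ι hq0 (by decide)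
  have hk2 : KilledBelow q 2 (FreeAlgebra.ι ℂ 2 * b) := fun r hr =>
    h2.leftDeriv_eq_zero (by revert r; decide) (hb.mono hr.le) (hb r hr)
  have e0 : leftDeriv (uqBraiding q 3) 0 (FreeAlgebra.ι ℂ 1 * b) = 0 := by
    rw [leftDeriv_ι_mul_of_eq_zero q 3 (hb.mono (by decide)), hb 0 (by decide)]
    simp
  have e1 : leftDeriv (uqBraiding q 3) 1 (FreeAlgebra.ι ℂ 1 * b) = b := by
    rw [leftDeriv_ι_mul_of_eq_zero q 3 (hb.mono (by decide)), hb 1 (by decide)]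
    simp
  obtain ⟨-, g21, -⟩ := quasiRCoeff_values3 hq0 hq
  simp only [skewComm, sub_mul, smul_mul_assoc, mul_assoc, map_sub, map_smul]
  rw [leftDeriv_ι_mul_of_eq_zero q 3 hk2, leftDeriv_ι_mul_of_eq_zero q 3 hb, leftDeriv_ι_mul]
  simp [Fin.sum_univ_four, braidCoeff_uqBraiding, e0, e1, leftDeriv_ι_mul_of_eq_zero q 3 hb,
    quasiRCoeff_zero, weightForm, wt, g21]
  simp only [mul_add, mul_smul_comm]
  match_scalars <;> field_simp
  ring

theorem ι_one_mul_skewComm_pow (hq0 : q ≠ 0) (hq : ∀ m : ℕ, 0 < m → q ^ m ≠ 1) (m : ℕ) :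
    FreeAlgebra.ι ℂ 1 * skewComm q ^ m - q ^ (3 * m) • (skewComm q ^ m * FreeAlgebra.ι ℂ 1) ∈
      idealSubmodule (nicholsIdeal (uqBraiding q 3)) := by
  induction m with
  | zero => simp
  | succ m ih =>
    have h1 := (nicholsIdeal (uqBraiding q 3)).mul_mem_right _ (skewComm q)
      (mem_idealSubmodule.1 ih)
    have h2 := (nicholsIdeal (uqBraiding q 3)).mul_mem_left (skewComm q ^ m) _
      (span_relation3_le hq0 hq (ι_one_mul_skewComm hq0 hq))
    have := add_mem (mem_idealSubmodule.2 h1) (Submodule.smul_mem _ (q ^ (3 * m))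
      (mem_idealSubmodule.2 h2))
    convert this using 1
    simp only [sub_mul, mul_sub, smul_mul_assoc, mul_smul_comm, pow_succ, mul_assoc]
    module

theorem killedBelow_two_skewComm_pow (hq0 : q ≠ 0) (m : ℕ) :
    KilledBelow q (2 : Fin 4) (skewComm q ^ m) := fun r hr =>
  (((passes_skewComm hq0).pow m).mono (show r ≤ 1 by revert r; decide)).leftDeriv_self

/-- Each factor `z = skewComm q` in turn becomes a multiple of `x_1`. Crossing the factors before it
gives powers of `q^(-3)`, and moving `x_1` to the right through those after it gives powers of
`q^3`, modulo the ideal. -/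
theorem leftDeriv_two_skewComm_pow (hq0 : q ≠ 0) (hq : ∀ m : ℕ, 0 < m → q ^ m ≠ 1) (m : ℕ) :
    leftDeriv (uqBraiding q 3) 2 (skewComm q ^ (m + 1)) -
      ((q ^ 3 - (q ^ 3)⁻¹) * q ^ (3 * m) * ∑ l ∈ Finset.range (m + 1), (q ^ (-6 : ℤ)) ^ l) •
        (skewComm q ^ m * FreeAlgebra.ι ℂ 1) ∈
      idealSubmodule (nicholsIdeal (uqBraiding q 3)) := by
  induction m with
  | zero =>
    rw [pow_succ', leftDeriv_two_skewComm_mul hq0 hq (killedBelow_two_skewComm_pow hq0 0)]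
    simp [leftDeriv_one]
  | succ m ih =>
    rw [pow_succ', leftDeriv_two_skewComm_mul hq0 hq (killedBelow_two_skewComm_pow hq0 _)]
    have h1 := Submodule.smul_mem _ (q ^ 3 - (q ^ 3)⁻¹) (ι_one_mul_skewComm_pow hq0 hq (m + 1))
    have h2 := Submodule.smul_mem _ (q ^ 3)⁻¹ (mem_idealSubmodule.2
      ((nicholsIdeal (uqBraiding q 3)).mul_mem_left (skewComm q) _ (mem_idealSubmodule.1 ih)))
    convert add_mem h1 h2 using 1
    rw [geom_sum_succ (n := m + 1)]
    simp only [mul_sub, mul_smul_comm, ← mul_assoc, ← pow_succ']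
    rw [show q ^ (-6 : ℤ) = (q ^ 6)⁻¹ by rw [zpow_neg]; rfl]
    match_scalars <;> field_simp
    ring

/-- The ordered monomials in the letters and `skewComm q`. -/
def skewMonomial (q : ℂ) (e : ℕ × ℕ × ℕ × ℕ × ℕ) : FreeAlgebra ℂ (Fin 4) :=
  FreeAlgebra.ι ℂ 3 ^ e.1 * FreeAlgebra.ι ℂ 2 ^ e.2.1 * skewComm q ^ e.2.2.1 *
    FreeAlgebra.ι ℂ 1 ^ e.2.2.2.1 * FreeAlgebra.ι ℂ 0 ^ e.2.2.2.2

/-- The term `v` collects what arises when `∂_2` picks a letter out of the power of `x_2`. It is a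
multiple of `x_3^i x_2^(j-1) b` (zero for `j = 0`), which `∂_1` kills; hence `∂_1 ∂_2` only sees
`∂_2 b`. -/
theorem leftDeriv_two_pow_mul (hq0 : q ≠ 0) (i j : ℕ) {b : FreeAlgebra ℂ (Fin 4)}
    (hb : KilledBelow q 2 b) :
    ∃ s : ℂ, ∃ v, s ≠ 0 ∧ leftDeriv (uqBraiding q 3) 1 v = 0 ∧
      leftDeriv (uqBraiding q 3) 2 (FreeAlgebra.ι ℂ 3 ^ i * FreeAlgebra.ι ℂ 2 ^ j * b) =
        v + s • (FreeAlgebra.ι ℂ 3 ^ i * FreeAlgebra.ι ℂ 2 ^ j *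
          leftDeriv (uqBraiding q 3) 2 b) := by
  have h3 : Passes q (2 : Fin 4) (FreeAlgebra.ι ℂ 3 ^ i) := (passes_ι hq0 (by decide)).pow i
  have h2 : ∀ j, Passes q (1 : Fin 4) (FreeAlgebra.ι ℂ 2 ^ j) :=
    fun j => (passes_ι hq0 (by decide)).pow j
  obtain ⟨s, hs0, hs⟩ := h3 2 le_rfl
  have hk : KilledBelow q 2 (FreeAlgebra.ι ℂ 2 ^ j * b) := fun r hr =>
    (h2 j).leftDeriv_eq_zero (by revert r; decide) (hb.mono hr.le) (hb r hr)
  rw [mul_assoc, hs _ hk]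
  rcases j with _ | j
  · exact ⟨s, 0, hs0, map_zero _, by simp⟩
  · rw [leftDeriv_ι_pow_mul hq0 hb]
    refine ⟨s * weightForm q (wt 3 (2 : Fin 4)) (wt 3 (2 : Fin 4)) ^ (j + 1), _,
      mul_ne_zero hs0 (pow_ne_zero _ (weightForm_ne_zero hq0 _ _)), ?_, by
      rw [mul_add, smul_add, mul_smul_comm, mul_smul_comm, smul_smul s (_ ^ _), mul_assoc]⟩
    rw [map_smul, map_smul, ← mul_assoc, ((h3.mono (by decide)).mul (h2 j)).leftDeriv_eq_zero le_rfl
      (hb.mono (by decide)) (hb 1 (by decide)), smul_zero, smul_zero]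

theorem exists_leftDeriv_two_skewComm_pow (hq0 : q ≠ 0) (hq : ∀ m : ℕ, 0 < m → q ^ m ≠ 1) (e : ℕ) :
    ∃ κ : ℂ, κ ≠ 0 ∧ leftDeriv (uqBraiding q 3) 2 (skewComm q ^ (e + 1)) -
      κ • (skewComm q ^ e * FreeAlgebra.ι ℂ 1) ∈
        idealSubmodule (nicholsIdeal (uqBraiding q 3)) := by
  refine ⟨_, mul_ne_zero (mul_ne_zero ?_ (pow_ne_zero _ hq0))
    (geom_sum_ne_zero_of_pow_ne_one (zpow_pow_ne_one hq (by norm_num)) e),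
    leftDeriv_two_skewComm_pow hq0 hq e⟩
  rw [show q ^ 3 - (q ^ 3)⁻¹ = (q ^ 6 - 1) / q ^ 3 by field_simp]
  exact div_ne_zero (pow_sub_one_ne_zero hq (by norm_num)) (pow_ne_zero _ hq0)

/-- Modulo the ideal, `∂_2` turns one factor `skewComm q` into `x_1` at the right end, and `∂_1`
then removes this `x_1`. So `∂_1 ∂_2` is a lowering operator for the exponent of `skewComm q`. -/
theorem exists_leftDeriv_one_two_mul_skewComm_pow (hq0 : q ≠ 0)
    (hq : ∀ m : ℕ, 0 < m → q ^ m ≠ 1) (i j e : ℕ) :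
    ∃ t : ℂ, t ≠ 0 ∧ leftDeriv (uqBraiding q 3) 1 (leftDeriv (uqBraiding q 3) 2
        (FreeAlgebra.ι ℂ 3 ^ i * FreeAlgebra.ι ℂ 2 ^ j * skewComm q ^ (e + 1))) -
      t • (FreeAlgebra.ι ℂ 3 ^ i * FreeAlgebra.ι ℂ 2 ^ j * skewComm q ^ e) ∈
        idealSubmodule (nicholsIdeal (uqBraiding q 3)) := by
  obtain ⟨s, v, hs0, hv, h⟩ := leftDeriv_two_pow_mul hq0 i j
    (killedBelow_two_skewComm_pow hq0 (e + 1))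
  obtain ⟨κ, hκ0, hκ⟩ := exists_leftDeriv_two_skewComm_pow hq0 hq e
  have hp : Passes q (1 : Fin 4)
      (FreeAlgebra.ι ℂ 3 ^ i * FreeAlgebra.ι ℂ 2 ^ j * skewComm q ^ e) :=
    (((passes_ι hq0 (by decide)).pow _).mul ((passes_ι hq0 (by decide)).pow _)).mul
      ((passes_skewComm hq0).pow _)
  rw [h]
  clear h
  generalize (FreeAlgebra.ι ℂ 3 ^ i * FreeAlgebra.ι ℂ 2 ^ j : FreeAlgebra ℂ (Fin 4)) = y at hp ⊢
  generalize leftDeriv (uqBraiding q 3) 2 (skewComm q ^ (e + 1)) = w at hκ ⊢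
  obtain ⟨s', hs0', hs'⟩ := hp 1 le_rfl
  have hk : KilledBelow q (1 : Fin 4) (FreeAlgebra.ι ℂ 1) := by
    simpa using killedBelow_ι_pow hq0 (1 : Fin 4) 1
  have hd1 : leftDeriv (uqBraiding q 3) 1 (FreeAlgebra.ι ℂ 1) = 1 := by
    simpa using leftDeriv_ι_pow hq0 (1 : Fin 4) 0
  have hx := hs' _ hk
  rw [hd1, mul_one] at hx
  refine ⟨s * κ * s', mul_ne_zero (mul_ne_zero hs0 hκ0) hs0', ?_⟩
  have hm : y * (w - κ • (skewComm q ^ e * FreeAlgebra.ι ℂ 1)) ∈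
      idealSubmodule (nicholsIdeal (uqBraiding q 3)) := mem_idealSubmodule.2
    ((nicholsIdeal (uqBraiding q 3)).mul_mem_left y _ (mem_idealSubmodule.1 hκ))
  -- Left multiplication by `y` and `∂_1` preserve the ideal, so the congruence for `∂_2` of the
  -- power may be inserted.
  have hm' := leftDeriv_mem_nicholsIdeal (uqBraiding q 3) 1 (Submodule.smul_mem _ s hm)
  rw [Submodule.mem_comap, mul_sub, mul_smul_comm, ← mul_assoc, map_smul, map_sub,
    map_smul, hx] at hm'
  rw [map_add, hv, zero_add, map_smul, mul_smul, mul_smul, ← smul_sub]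
  exact hm'

theorem linearIndependent_mul_skewComm_pow (hq0 : q ≠ 0) (hq : ∀ m : ℕ, 0 < m → q ^ m ≠ 1)
    (hy : LinearIndependent ℂ fun x : ℕ × ℕ × Unit =>
      (idealSubmodule (nicholsIdeal (uqBraiding q 3))).mkQ
        (FreeAlgebra.ι ℂ 3 ^ x.2.1 * FreeAlgebra.ι ℂ 2 ^ x.1)) :
    LinearIndependent ℂ fun p : ℕ × ℕ × ℕ × Unit =>
      (idealSubmodule (nicholsIdeal (uqBraiding q 3))).mkQ
        (FreeAlgebra.ι ℂ 3 ^ p.2.2.1 * FreeAlgebra.ι ℂ 2 ^ p.2.1 * skewComm q ^ p.1) := by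
  have hd := leftDeriv_mem_nicholsIdeal (uqBraiding q 3)
  refine linearIndependent_mkQ_of_lowering
    (leftDeriv (uqBraiding q 3) 1 ∘ₗ leftDeriv (uqBraiding q 3) 2)
    ((hd 2).trans (Submodule.comap_mono (hd 1)))
    (fun e (x : ℕ × ℕ × Unit) =>
      FreeAlgebra.ι ℂ 3 ^ x.2.1 * FreeAlgebra.ι ℂ 2 ^ x.1 * skewComm q ^ e)
    (fun x => ?_)
    (fun e x => exists_leftDeriv_one_two_mul_skewComm_pow hq0 hq x.2.1 x.1 e) ?_
  · obtain ⟨s, v, -, hv, h⟩ := leftDeriv_two_pow_mul hq0 x.2.1 x.1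
      (killedBelow_one (q := q) (t := (2 : Fin 4)))
    rw [pow_zero, LinearMap.comp_apply, h, leftDeriv_one, mul_zero, smul_zero, add_zero, hv]
    exact zero_mem _
  · simp only [pow_zero, mul_one]
    exact hy

theorem linearIndependent_skewMonomial (hq0 : q ≠ 0) (hq : ∀ m : ℕ, 0 < m → q ^ m ≠ 1) :
    LinearIndependent ℂ fun e =>
      (idealSubmodule (nicholsIdeal (uqBraiding q 3))).mkQ (skewMonomial q e) := by
  have h3 := linearIndependent_mul_ι_pow (t := (3 : Fin 4)) hq0 hq (by norm_num [wt])
    (fun _ : Unit => passes_one) linearIndependent_one_mkQ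
  have h2 := linearIndependent_mul_ι_pow (t := (2 : Fin 4)) hq0 hq (by norm_num [wt])
    (fun p => passes_one.mul ((passes_ι hq0 (by decide)).pow _)) h3
  have hz := linearIndependent_mul_skewComm_pow hq0 hq (by simpa using h2)
  have h1 := linearIndependent_mul_ι_pow (t := (1 : Fin 4)) hq0 hq (by norm_num [wt])
    (fun p => (((passes_ι hq0 (by decide)).pow _).mul ((passes_ι hq0 (by decide)).pow _)).mul
      ((passes_skewComm hq0).pow _)) hz
  have h0 := linearIndependent_mul_ι_pow (t := (0 : Fin 4)) hq0 hq (by norm_num [wt])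
    (fun p => ((((passes_ι hq0 (by decide)).pow _).mul ((passes_ι hq0 (by decide)).pow _)).mul
      (((passes_skewComm hq0).mono (by decide)).pow _)).mul ((passes_ι hq0 (by decide)).pow _)) h1
  exact h0.comp (fun e : ℕ × ℕ × ℕ × ℕ × ℕ => (e.2.2.2.2, e.2.2.2.1, e.2.2.1, e.2.1, e.1, ()))
    fun e e' h => by
      simp only [Prod.ext_iff] at h ⊢
      tauto

end DimensionFour

/-! ### Dimension 4: normal words, transfer of independence, and PBW generators. -/

section DimensionFour

variable {q : ℂ}

/-- The normal words of the module of dimension 4. -/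
def normalWord3 (e : ℕ × ℕ × ℕ × ℕ × ℕ) : List (Fin 4) :=
  List.replicate e.1 3 ++ List.replicate e.2.1 2 ++ (List.replicate e.2.2.1 [1, 2]).flatten ++
    List.replicate e.2.2.2.1 1 ++ List.replicate e.2.2.2.2 0

/-- The words that are minimal among those that are not normal. -/
def leadingWord3 : Set (List (Fin 4)) :=
  {[0, 1], [0, 2], [0, 3], [1, 3], [2, 3], [1, 1, 2], [1, 2, 2]}

theorem normalWord3_or_infix (u : List (Fin 4)) :
    u ∈ Set.range normalWord3 ∨ ∃ b ∈ leadingWord3, b <:+: u := by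
  induction u with
  | nil => exact Or.inl ⟨(0, 0, 0, 0, 0), rfl⟩
  | cons a u ih =>
    rcases ih with ⟨⟨i, j, c, d, e⟩, rfl⟩ | ⟨b, hb, h⟩
    · fin_cases a
      · rcases i with _ | i
        · rcases j with _ | j
          · rcases c with _ | c
            · rcases d with _ | d
              · exact Or.inl ⟨(0, 0, 0, 0, e + 1), rfl⟩
              · exact Or.inr ⟨[0, 1], by simp [leadingWord3], [], _, rfl⟩
            · exact Or.inr ⟨[0, 1], by simp [leadingWord3], [], _, rfl⟩
          · exact Or.inr ⟨[0, 2], by simp [leadingWord3], [], _, rfl⟩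
        · exact Or.inr ⟨[0, 3], by simp [leadingWord3], [], _, rfl⟩
      · rcases i with _ | i
        · rcases j with _ | _ | j
          · rcases c with _ | c
            · exact Or.inl ⟨(0, 0, 0, d + 1, e), rfl⟩
            · exact Or.inr ⟨[1, 1, 2], by simp [leadingWord3], [], _, rfl⟩
          -- A letter 1 before a single 2 creates a new first block `[1, 2]`.
          · exact Or.inl ⟨(0, 0, c + 1, d, e), rfl⟩
          · exact Or.inr ⟨[1, 2, 2], by simp [leadingWord3], [], _, rfl⟩
        · exact Or.inr ⟨[1, 3], by simp [leadingWord3], [], _, rfl⟩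
      · rcases i with _ | i
        · exact Or.inl ⟨(0, j + 1, c, d, e), rfl⟩
        · exact Or.inr ⟨[2, 3], by simp [leadingWord3], [], _, rfl⟩
      · exact Or.inl ⟨(i + 1, j, c, d, e), rfl⟩
    · exact Or.inr ⟨b, hb, List.infix_cons h⟩

theorem word_two_mem_biggerSpan_sup (hq0 : q ≠ 0) {b : List (Fin 4)}
    (hb : b ∈ leadingWord3) (h2 : b.length = 2) :
    word ℂ b ∈ biggerSpan ℂ b ⊔ Submodule.span ℂ (Set.range (relation3 q)) := by
  rcases hb with rfl | rfl | rfl | rfl | rfl | rfl | rfl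
  · refine mem_biggerSpan_sup_of_eq (a := q ^ 3 • word ℂ [1, 0]) (b := relation3 q 0)
      (Submodule.smul_mem _ _ (word_mem_biggerSpan rfl (by decide)))
      (Submodule.subset_span ⟨0, rfl⟩) ?_
    simp [word, relation3]
  · refine mem_biggerSpan_sup_of_eq
      (a := -((1 - q ^ 4) / q) • word ℂ [1, 1] + word ℂ [2, 0]) (b := relation3 q 1)
      (add_mem (Submodule.smul_mem _ _ (word_mem_biggerSpan rfl (by decide)))
        (word_mem_biggerSpan rfl (by decide))) (Submodule.subset_span ⟨1, rfl⟩) ?_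
    simp only [word, relation3, List.map_cons, List.map_nil, List.prod_cons, List.prod_nil,
      mul_one, Matrix.cons_val]
    module
  -- The leading word of this relation has coefficient `q^3`, so the relation is divided by it.
  · refine mem_biggerSpan_sup_of_eq
      (a := -((q ^ 2 + 1 - q ^ 4) / q) • word ℂ [1, 2] +
        -((q - q ^ 3 - q ^ 5) / q ^ 3) • word ℂ [2, 1] + (q ^ 3)⁻¹ • word ℂ [3, 0])
      (b := (q ^ 3)⁻¹ • relation3 q 2)
      (add_mem (add_mem (Submodule.smul_mem _ _ (word_mem_biggerSpan rfl (by decide)))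
        (Submodule.smul_mem _ _ (word_mem_biggerSpan rfl (by decide))))
        (Submodule.smul_mem _ _ (word_mem_biggerSpan rfl (by decide))))
      (Submodule.smul_mem _ _ (Submodule.subset_span ⟨2, rfl⟩)) ?_
    simp only [word, relation3, List.map_cons, List.map_nil, List.prod_cons, List.prod_nil,
      mul_one, Matrix.cons_val]
    match_scalars <;> field_simp <;> ring
  · refine mem_biggerSpan_sup_of_eq
      (a := -((1 - q ^ 6) / (q * (q ^ 2 + 1))) • word ℂ [2, 2] + word ℂ [3, 1])
      (b := relation3 q 3)
      (add_mem (Submodule.smul_mem _ _ (word_mem_biggerSpan rfl (by decide)))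
        (word_mem_biggerSpan rfl (by decide))) (Submodule.subset_span ⟨3, rfl⟩) ?_
    simp only [word, relation3, List.map_cons, List.map_nil, List.prod_cons, List.prod_nil,
      mul_one, Matrix.cons_val]
    module
  · refine mem_biggerSpan_sup_of_eq (a := q ^ 3 • word ℂ [3, 2]) (b := relation3 q 4)
      (Submodule.smul_mem _ _ (word_mem_biggerSpan rfl (by decide)))
      (Submodule.subset_span ⟨4, rfl⟩) ?_
    simp [word, relation3]
  · simp at h2
  · simp at h2

theorem word_mem_biggerSpan_sup (hq0 : q ≠ 0) (hq : ∀ m : ℕ, 0 < m → q ^ m ≠ 1)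
    {b : List (Fin 4)} (hb : b ∈ leadingWord3) :
    word ℂ b ∈ biggerSpan ℂ b ⊔
      idealSubmodule (TwoSidedIdeal.span (Set.range (relation3 q))) := by
  by_cases h2 : b.length = 2
  · exact sup_le_sup_left (span_le_idealSubmodule_span _) _ (word_two_mem_biggerSpan_sup hq0 hb h2)
  · rcases hb with rfl | rfl | rfl | rfl | rfl | rfl | rfl
    · simp at h2
    · simp at h2
    · simp at h2
    · simp at h2
    · simp at h2
    -- The cubic relation expands to `x_1 x_1 x_2 - (q + q^3) x_1 x_2 x_1 + q^4 x_2 x_1 x_1`.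
    · refine mem_biggerSpan_sup_of_eq
        (a := (q + q ^ 3) • word ℂ [1, 2, 1] + -q ^ 4 • word ℂ [2, 1, 1])
        (add_mem (Submodule.smul_mem _ _ (word_mem_biggerSpan rfl (by decide)))
          (Submodule.smul_mem _ _ (word_mem_biggerSpan rfl (by decide))))
        (mem_idealSubmodule.2 (ι_one_mul_skewComm hq0 hq)) ?_
      simp only [word, skewComm, List.map_cons, List.map_nil, List.prod_cons, List.prod_nil,
        mul_one, mul_sub, sub_mul, mul_assoc, mul_smul_comm, smul_mul_assoc]
      module
    · refine mem_biggerSpan_sup_of_eq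
        (a := (q + q ^ 3) • word ℂ [2, 1, 2] + -q ^ 4 • word ℂ [2, 2, 1])
        (add_mem (Submodule.smul_mem _ _ (word_mem_biggerSpan rfl (by decide)))
          (Submodule.smul_mem _ _ (word_mem_biggerSpan rfl (by decide))))
        (mem_idealSubmodule.2 (skewComm_mul_ι_two hq0 hq)) ?_
      simp only [word, skewComm, List.map_cons, List.map_nil, List.prod_cons, List.prod_nil,
        mul_one, mul_sub, sub_mul, mul_assoc, mul_smul_comm, smul_mul_assoc]
      module

/-- The degree of a monomial with given exponents. -/
def degree3 (e : ℕ × ℕ × ℕ × ℕ × ℕ) : ℕ :=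
  e.1 + e.2.1 + e.2.2.1 * 2 + e.2.2.2.1 + e.2.2.2.2

theorem length_normalWord3 (e : ℕ × ℕ × ℕ × ℕ × ℕ) : (normalWord3 e).length = degree3 e := by
  simp [normalWord3, degree3, add_assoc]

theorem pow_mem_homogeneousPart {k ι : Type*} [Field k] {m : ℕ} {a : FreeAlgebra k ι}
    (ha : a ∈ homogeneousPart k ι m) (j : ℕ) : a ^ j ∈ homogeneousPart k ι (j * m) := by
  induction j with
  | zero =>
    rw [pow_zero, zero_mul, ← word_nil]
    exact word_mem_homogeneousPart []
  | succ j ih =>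
    rw [pow_succ, Nat.succ_mul]
    exact mul_mem_homogeneousPart ih ha

theorem ι_pow_mem_homogeneousPart {k ι : Type*} [Field k] (i : ι) (j : ℕ) :
    FreeAlgebra.ι k i ^ j ∈ homogeneousPart k ι j := by
  have : FreeAlgebra.ι k i ∈ homogeneousPart k ι 1 := by
    rw [← word_singleton]
    exact word_mem_homogeneousPart [i]
  simpa using pow_mem_homogeneousPart this j

theorem skewComm_mem_homogeneousPart : skewComm q ∈ homogeneousPart ℂ (Fin 4) 2 := by
  have h : ∀ i j : Fin 4, FreeAlgebra.ι ℂ i * FreeAlgebra.ι ℂ j ∈ homogeneousPart ℂ (Fin 4) 2 :=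
    fun i j => by simpa [word] using word_mem_homogeneousPart (k := ℂ) [i, j]
  exact sub_mem (h 1 2) (Submodule.smul_mem _ _ (h 2 1))

theorem skewMonomial_mem_homogeneousPart (e : ℕ × ℕ × ℕ × ℕ × ℕ) :
    skewMonomial q e ∈ homogeneousPart ℂ (Fin 4) (degree3 e) :=
  mul_mem_homogeneousPart (mul_mem_homogeneousPart (mul_mem_homogeneousPart
    (mul_mem_homogeneousPart (ι_pow_mem_homogeneousPart _ _) (ι_pow_mem_homogeneousPart _ _))
    (pow_mem_homogeneousPart skewComm_mem_homogeneousPart _)) (ι_pow_mem_homogeneousPart _ _))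
    (ι_pow_mem_homogeneousPart _ _)

theorem homogeneousPart_le_span_normalWord3 (hq0 : q ≠ 0) (hq : ∀ m : ℕ, 0 < m → q ^ m ≠ 1)
    (m : ℕ) : homogeneousPart ℂ (Fin 4) m ≤
      Submodule.span ℂ {a | ∃ e, degree3 e = m ∧ a = word ℂ (normalWord3 e)} ⊔
        idealSubmodule (nicholsIdeal (uqBraiding q 3)) := by
  rw [homogeneousPart, Submodule.span_le]
  rintro _ ⟨u, hu, rfl⟩
  refine mem_span_sup_of_subset ?_ (idealSubmodule_mono (span_relation3_le hq0 hq))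
    (word_mem_span_normal_sup (S := Set.range normalWord3) (fun v _ hv => ?_) u hu)
  · rintro _ ⟨_, ⟨e, rfl⟩, hl, -, rfl⟩
    exact ⟨e, by rw [← length_normalWord3, hl], rfl⟩
  · obtain ⟨b, hb, h⟩ := (normalWord3_or_infix v).resolve_left hv
    exact word_mem_biggerSpan_sup_of_infix (word_mem_biggerSpan_sup hq0 hq hb) h

/-- In each degree, the monomials with `skewComm q` and the normal words are indexed by the same
exponents. The former are independent, and by homogeneous reduction they lie in the span of the
latter modulo the ideal. -/
theorem linearIndependent_normalWord3 (hq0 : q ≠ 0) (hq : ∀ m : ℕ, 0 < m → q ^ m ≠ 1) :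
    LinearIndependent ℂ fun e =>
      (idealSubmodule (nicholsIdeal (uqBraiding q 3))).mkQ (word ℂ (normalWord3 e)) := by
  refine linearIndependent_of_filtered_span degree3 (fun m => ?_)
    (linearIndependent_skewMonomial hq0 hq) fun e => ?_
  -- Every exponent is bounded by the degree.
  · refine (Set.finite_Iic (m, m, m, m, m)).subset fun e he => ?_
    simp only [Set.mem_ofPred_eq, degree3] at he
    simp only [Set.mem_Iic, Prod.le_def]
    omega
  · obtain ⟨a, ha, b, hb, h⟩ := Submodule.mem_sup.1
      (homogeneousPart_le_span_normalWord3 hq0 hq _ (skewMonomial_mem_homogeneousPart (q := q) e))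
    have hb0 : (idealSubmodule (nicholsIdeal (uqBraiding q 3))).mkQ b = 0 :=
      (Submodule.Quotient.mk_eq_zero _).2 hb
    rw [← h, map_add, hb0, add_zero]
    have := Submodule.mem_map_of_mem (f := (idealSubmodule (nicholsIdeal (uqBraiding q 3))).mkQ) ha
    rw [Submodule.map_span] at this
    refine Submodule.span_mono ?_ this
    rintro _ ⟨_, ⟨e', he', rfl⟩, rfl⟩
    exact ⟨e', he'.le, rfl⟩

theorem isPresentation3 (hq0 : q ≠ 0) (hq : ∀ m : ℕ, 0 < m → q ^ m ≠ 1) :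
    IsPresentation (nicholsIdeal (uqBraiding q 3)) (Set.range (relation3 q)) normalWord3 := by
  refine IsPresentation.of_infix leadingWord3 (mem_of_span_range_le (span_relation3_le hq0 hq))
    (relation_mem_homogeneousPart (quad_relationMatrix3 q))
    (fun b hb => ⟨?_, word_mem_biggerSpan_sup hq0 hq hb⟩)
    (fun b => word_two_mem_biggerSpan_sup hq0) normalWord3_or_infix
    (linearIndependent_normalWord3 hq0 hq)
  rcases hb with rfl | rfl | rfl | rfl | rfl | rfl | rfl <;> simp

theorem isLyndon_one_two : IsLyndon ([1, 2] : List (Fin 4)) := by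
  refine ⟨by simp, fun v w hv hw h => ?_⟩
  rcases v with _ | ⟨a, _ | ⟨b, v⟩⟩
  · exact absurd rfl hv
  · obtain rfl : w = [2] := by simpa using (List.cons.inj h).2.symm
    decide
  · have := congrArg List.length h
    have h0 := List.length_pos_iff.2 hw
    simp only [List.cons_append, List.length_cons, List.length_append, List.length_nil] at this
    omega

theorem pbwGenerators3 (hq0 : q ≠ 0) (hq : ∀ m : ℕ, 0 < m → q ^ m ≠ 1) :
    pbwGenerators (nicholsIdeal (uqBraiding q 3)) = {[0], [1], [2], [3], [1, 2]} := by
  rw [(isPresentation3 hq0 hq).pbwGenerators_eq]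
  ext u
  simp only [Set.mem_ofPred_eq, Set.mem_insert_iff, Set.mem_singleton_iff]
  constructor
  · rintro ⟨hL, ⟨i, j, c, d, e⟩, rfl⟩
    rcases e with _ | e
    · rcases d with _ | d
      · rcases c with _ | c
        · rcases j with _ | j
          · rcases i with _ | i
            · exact absurd rfl hL.1
            · simp only [normalWord3, List.replicate_succ', List.replicate_zero,
                List.append_nil, List.flatten_nil] at hL ⊢
              rw [hL.eq_nil_of_last (by simp)]
              simp
          · simp only [normalWord3, List.replicate_succ', List.replicate_zero, List.append_nil,
              List.flatten_nil, ← List.append_assoc] at hL ⊢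
            rw [hL.eq_nil_of_last (by simp; grind)]
            simp
        · simp only [normalWord3, List.replicate_succ', List.replicate_zero, List.append_nil,
            List.flatten_append, List.flatten_singleton, ← List.append_assoc] at hL ⊢
          rw [hL.eq_nil (by simp) ?_]
          · simp
          -- The word ends in `[1, 2]`. It begins with 3, with 2 or with `[1, 2]`, so it is not
          -- smaller than this ending, and a Lyndon word of this form has nothing before it.
          · refine not_lt.1 fun h => ?_
            rcases i with _ | i
            · rcases j with _ | j
              · rcases c with _ | c <;> simp [List.replicate_succ] at h
              · simp [List.replicate_succ, List.cons_lt_cons_iff] at h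
            · simp [List.replicate_succ, List.cons_lt_cons_iff] at h
      · simp only [normalWord3, List.replicate_succ', List.replicate_zero, List.append_nil,
          ← List.append_assoc] at hL ⊢
        rw [hL.eq_nil_of_last (by simp; grind)]
        simp
    · simp only [normalWord3, List.replicate_succ', ← List.append_assoc] at hL ⊢
      rw [hL.eq_nil_of_last (by simp)]
      simp
  · rintro (rfl | rfl | rfl | rfl | rfl)
    · exact ⟨isLyndon_singleton _, (0, 0, 0, 0, 1), rfl⟩
    · exact ⟨isLyndon_singleton _, (0, 0, 0, 1, 0), rfl⟩
    · exact ⟨isLyndon_singleton _, (0, 1, 0, 0, 0), rfl⟩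
    · exact ⟨isLyndon_singleton _, (1, 0, 0, 0, 0), rfl⟩
    · exact ⟨isLyndon_one_two, (0, 0, 1, 0, 0), rfl⟩

theorem pbwHeight3 (hq0 : q ≠ 0) (hq : ∀ m : ℕ, 0 < m → q ^ m ≠ 1) :
    ∀ u ∈ pbwGenerators (nicholsIdeal (uqBraiding q 3)),
      pbwHeight (nicholsIdeal (uqBraiding q 3)) u = ⊤ := by
  rw [pbwGenerators3 hq0 hq]
  rintro _ (rfl | rfl | rfl | rfl | rfl) <;>
    refine (isPresentation3 hq0 hq).pbwHeight_eq_top fun m => ?_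
  · exact ⟨(0, 0, 0, 0, m), by simp [normalWord3]⟩
  · exact ⟨(0, 0, 0, m, 0), by simp [normalWord3]⟩
  · exact ⟨(0, m, 0, 0, 0), by simp [normalWord3]⟩
  · exact ⟨(m, 0, 0, 0, 0), by simp [normalWord3]⟩
  · exact ⟨(0, 0, m, 0, 0), by simp [normalWord3]⟩

theorem range_relation3 : Set.range (relation3 q) =
    {FreeAlgebra.ι ℂ 0 * FreeAlgebra.ι ℂ 1 - q ^ 3 • (FreeAlgebra.ι ℂ 1 * FreeAlgebra.ι ℂ 0),
      FreeAlgebra.ι ℂ 0 * FreeAlgebra.ι ℂ 2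
        + ((1 - q ^ 4) / q) • (FreeAlgebra.ι ℂ 1 * FreeAlgebra.ι ℂ 1)
        - FreeAlgebra.ι ℂ 2 * FreeAlgebra.ι ℂ 0,
      q ^ 3 • (FreeAlgebra.ι ℂ 0 * FreeAlgebra.ι ℂ 3)
        + (q ^ 2 * (q ^ 2 + 1 - q ^ 4)) • (FreeAlgebra.ι ℂ 1 * FreeAlgebra.ι ℂ 2)
        + (q - q ^ 3 - q ^ 5) • (FreeAlgebra.ι ℂ 2 * FreeAlgebra.ι ℂ 1)
        - FreeAlgebra.ι ℂ 3 * FreeAlgebra.ι ℂ 0,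
      FreeAlgebra.ι ℂ 1 * FreeAlgebra.ι ℂ 3
        + ((1 - q ^ 6) / (q * (q ^ 2 + 1))) • (FreeAlgebra.ι ℂ 2 * FreeAlgebra.ι ℂ 2)
        - FreeAlgebra.ι ℂ 3 * FreeAlgebra.ι ℂ 1,
      FreeAlgebra.ι ℂ 2 * FreeAlgebra.ι ℂ 3
        - q ^ 3 • (FreeAlgebra.ι ℂ 3 * FreeAlgebra.ι ℂ 2)} := by
  simp only [relation3, Matrix.range_cons, Matrix.range_empty, Set.union_empty,
    Set.singleton_union]

theorem isBasisFamily3 (hq0 : q ≠ 0) (hq : ∀ m : ℕ, 0 < m → q ^ m ≠ 1) :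
    IsBasisFamily ℂ fun e : ℕ × ℕ × ℕ × ℕ × ℕ =>
      nicholsGen (uqBraiding q 3) 3 ^ e.1 * nicholsGen (uqBraiding q 3) 2 ^ e.2.1 *
        (nicholsGen (uqBraiding q 3) 1 * nicholsGen (uqBraiding q 3) 2) ^ e.2.2.1 *
        nicholsGen (uqBraiding q 3) 1 ^ e.2.2.2.1 * nicholsGen (uqBraiding q 3) 0 ^ e.2.2.2.2 := by
  simpa [normalWord3, word_append, word_replicate, word_flatten_replicate, word_cons, word_nil,
    nicholsGen, mul_assoc] using (isPresentation3 hq0 hq).isBasisFamily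

end DimensionFour

end NicholsSl2

end

theorem mainTheorem6 (q : ℂ) (hq0 : q ≠ 0) (hq : ∀ m : ℕ, 0 < m → q ^ m ≠ 1) :
    -- the module of dimension 2
    (let I := nicholsIdeal (uqBraiding q 1)
     let X : Fin 2 → FreeAlgebra ℂ (Fin 2) := FreeAlgebra.ι ℂ
     let x : Fin 2 → NicholsAlgebra (uqBraiding q 1) := nicholsGen (uqBraiding q 1)
     IsQuadratic I ∧
     quadraticRelations I = Submodule.span ℂ {X 0 * X 1 - q • (X 1 * X 0)} ∧
     pbwGenerators I = {[0], [1]} ∧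
     (∀ u ∈ pbwGenerators I, pbwHeight I u = ⊤) ∧
     IsBasisFamily ℂ (fun e : ℕ × ℕ => x 1 ^ e.1 * x 0 ^ e.2)) ∧
    -- the module of dimension 3
    (let I := nicholsIdeal (uqBraiding q 2)
     let X : Fin 3 → FreeAlgebra ℂ (Fin 3) := FreeAlgebra.ι ℂ
     let x : Fin 3 → NicholsAlgebra (uqBraiding q 2) := nicholsGen (uqBraiding q 2)
     IsQuadratic I ∧
     quadraticRelations I = Submodule.span ℂ
       {X 0 * X 1 - q ^ 2 • (X 1 * X 0),
        X 1 * X 2 - q ^ 2 • (X 2 * X 1),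
        X 0 * X 2 - (q ^ 2 - 1) • (X 1 * X 1) - X 2 * X 0} ∧
     pbwGenerators I = {[0], [1], [2]} ∧
     (∀ u ∈ pbwGenerators I, pbwHeight I u = ⊤) ∧
     IsBasisFamily ℂ (fun e : ℕ × ℕ × ℕ => x 2 ^ e.1 * x 1 ^ e.2.1 * x 0 ^ e.2.2)) ∧
    -- the module of dimension 4
    (let I := nicholsIdeal (uqBraiding q 3)
     let X : Fin 4 → FreeAlgebra ℂ (Fin 4) := FreeAlgebra.ι ℂ
     let x : Fin 4 → NicholsAlgebra (uqBraiding q 3) := nicholsGen (uqBraiding q 3)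
     IsQuadratic I ∧
     quadraticRelations I = Submodule.span ℂ
       {X 0 * X 1 - q ^ 3 • (X 1 * X 0),
        X 0 * X 2 + ((1 - q ^ 4) / q) • (X 1 * X 1) - X 2 * X 0,
        q ^ 3 • (X 0 * X 3) + (q ^ 2 * (q ^ 2 + 1 - q ^ 4)) • (X 1 * X 2)
          + (q - q ^ 3 - q ^ 5) • (X 2 * X 1) - X 3 * X 0,
        X 1 * X 3 + ((1 - q ^ 6) / (q * (q ^ 2 + 1))) • (X 2 * X 2) - X 3 * X 1,
        X 2 * X 3 - q ^ 3 • (X 3 * X 2)} ∧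
     pbwGenerators I = {[0], [1], [2], [3], [1, 2]} ∧
     (∀ u ∈ pbwGenerators I, pbwHeight I u = ⊤) ∧
     IsBasisFamily ℂ (fun e : ℕ × ℕ × ℕ × ℕ × ℕ =>
       x 3 ^ e.1 * x 2 ^ e.2.1 * (x 1 * x 2) ^ e.2.2.1 * x 1 ^ e.2.2.2.1 * x 0 ^ e.2.2.2.2)) := by
  refine ⟨⟨(isPresentation1 hq0 hq).isQuadratic, ?_, pbwGenerators1 hq0 hq, pbwHeight1 hq0 hq,
      isBasisFamily1 hq0 hq⟩,
    ⟨(isPresentation2 hq0 hq).isQuadratic, ?_, pbwGenerators2 hq0 hq, pbwHeight2 hq0 hq,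
      isBasisFamily2 hq0 hq⟩,
    ⟨(isPresentation3 hq0 hq).isQuadratic, ?_, pbwGenerators3 hq0 hq, pbwHeight3 hq0 hq,
      isBasisFamily3 hq0 hq⟩⟩
  · rw [(isPresentation1 hq0 hq).quadraticRelations_eq, range_relation1]
  · rw [(isPresentation2 hq0 hq).quadraticRelations_eq, range_relation2]
  · rw [(isPresentation3 hq0 hq).quadraticRelations_eq, range_relation3]
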